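/- A handle-structure consists of finitely many beams and plates, each a copy of $D^2\times[0,1]$, glued along finitely many strips. A strip is a square with coordinates $(s,t)\in[0,1]^2$; it is embedded in a beam as $\alpha\times[0,1]$ by $(s,t)\mapsto(a(s),t)$ and in a plate as $\alpha'\times[0,1]$ by $(s,t)\mapsto(c(t),s)$, where $a,c$ parametrize arcs $\alpha,\alpha'$ in $S^1=\partial D^2$, different strips on the same beam or plate being disjoint, and the two images are identified. Let $M$ be the resulting space (the total space) and let $S\subset M$ (the sticky end) be the union of the ends $D^2\times\{0,1\}$ of the beams and of the part of $S^1\times[0,1]$ on the plates that is not glued to a beam. An isomorphism of handle-structures is a homeomorphism of total spaces taking beams to beams and plates to plates with the same labels, and sticky end to sticky end. Write $M/S$ for the space obtained from $M$ by identifying $S$ to a point, with $M/\emptyset=M\sqcup\{\mathrm{pt}\}$. Let $\langle X\mid (r_j)_{j\in J}\rangle$ be a finite presentation of a group $G$, the relators $r_j$ being words (not necessarily reduced, possibly empty) in the generators and their inverses. Call a handle-structure associated to the presentation if it has one beam for each generator, one plate for each relator and one strip for each letter of each relator, such that going once counterclockwise around $\partial D^2$ of the plate of $r_j$ from some base point on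 no strip, one meets the strips in the order of the letters of $r_j$, each being glued to the beam of its generator and running along the $[0,1]$-direction of that beam from $0$ to $1$ or from $1$ to $0$ according to whether the exponent is $+1$ or $-1$. Then: 1. There is a handle-structure associated to the presentation; it can be chosen so that the standard orientations of the beams and plates fit together to an orientation of $M$. 2. It is canonical up to finitely many choices: two associated handle-structures are isomorphic if the strips have the same cyclic order around each beam and each strip is attached to its beam with the same sense ($a$ running counterclockwise or clockwise), and there are finitely many associated handle-structures such that every associated handle-structure is isomorphic to one of them. 3. For every associated handle-structure, $M/S$ is path-connected and $\pi_1(M/S)\cong G$ for every base point. -/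

import Mathlib

open scoped unitInterval

noncomputable section

/-- The closed unit disc `D²`. -/
abbrev Disc : Type := Metric.closedBall (0 : ℂ) 1

/-- The inclusion of the unit circle `S¹ = ∂D²` into `D²`. -/
def circleToDisc (z : Circle) : Disc := ⟨z, mem_closedBall_zero_iff.2 (Circle.norm_coe z).le⟩

/-- The path `γ` in the circle runs strictly monotonically in the counterclockwise direction. -/
def IsCcw (γ : I → Circle) : Prop :=
  ∃ f : I → ℝ, Continuous f ∧ StrictMono f ∧ ∀ t, γ t = Circle.exp (f t)

/-- Going once around the circle counterclockwise from `x` one meets `y` and then `z`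
(the three points being distinct). -/
def CcwOrdered (x y z : Circle) : Prop :=
  ∃ a b c : ℝ, a < b ∧ b < c ∧ c < a + 2 * Real.pi ∧
    x = Circle.exp a ∧ y = Circle.exp b ∧ z = Circle.exp c

/-- The space `X / Y`, obtained from `X` by identifying `Y` to a point. The point is adjoined
first, which changes nothing if `Y` is nonempty and gives the usual convention that
`X / ∅` is `X` with a disjoint point added. -/
def Collapse {X : Type*} [TopologicalSpace X] (Y : Set X) : Type _ :=
  Quot (fun p q : X ⊕ Unit => ∃ y ∈ Y, p = Sum.inl y ∧ q = Sum.inr ())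

instance {X : Type*} [TopologicalSpace X] (Y : Set X) : TopologicalSpace (Collapse Y) :=
  inferInstanceAs (TopologicalSpace (Quot _))

/-- Gluing data of a handle-structure with beams `B`, plates `P` and discs of intersection
(strips) `K`. Every beam and every plate is a copy of `D² × [0,1]`. The strip `k` is a square
with coordinates `(s, t)`. It lies on its beam as `α × [0,1]`, by `(s, t) ↦ (beamArc k s, t)`, and
on its plate as `α' × [0,1]`, by `(s, t) ↦ (plateArc k t, s)`, where `α` and `α'` are arcs in
`∂D²`: as for handles of a `3`-manifold, the boundary of the plate runs along the core of the
beam. -/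
structure HandleStructure (B P K : Type*) where
  beamOf : K → B
  plateOf : K → P
  beamArc : K → I → Circle
  plateArc : K → I → Circle
  continuous_beamArc : ∀ k, Continuous (beamArc k)
  injective_beamArc : ∀ k, Function.Injective (beamArc k)
  continuous_plateArc : ∀ k, Continuous (plateArc k)
  injective_plateArc : ∀ k, Function.Injective (plateArc k)
  disjoint_beamArc : ∀ k l, k ≠ l → beamOf k = beamOf l →
    Disjoint (Set.range (beamArc k)) (Set.range (beamArc l))
  disjoint_plateArc : ∀ k l, k ≠ l → plateOf k = plateOf l →
    Disjoint (Set.range (plateArc k)) (Set.range (plateArc l))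

namespace HandleStructure

variable {B P K : Type*} (H : HandleStructure B P K)

/-- The disjoint union of the beams and the plates, before gluing. -/
abbrev Pieces (_ : HandleStructure B P K) : Type _ :=
  (Σ _ : B, Disc × I) ⊕ (Σ _ : P, Disc × I)

/-- The identifications: each strip on a beam is glued to the same strip on a plate. -/
def Glue (x y : H.Pieces) : Prop :=
  ∃ (k : K) (s t : I),
    x = Sum.inl ⟨H.beamOf k, circleToDisc (H.beamArc k s), t⟩ ∧
    y = Sum.inr ⟨H.plateOf k, circleToDisc (H.plateArc k t), s⟩

/-- The total space `M`, the union of the beams and the plates. -/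
def Total : Type _ := Quot H.Glue

instance : TopologicalSpace H.Total := inferInstanceAs (TopologicalSpace (Quot _))

/-- The map of a beam to the total space. -/
def beamMap (b : B) (x : Disc × I) : H.Total := Quot.mk _ (Sum.inl ⟨b, x⟩)

/-- The map of a plate to the total space. -/
def plateMap (p : P) (x : Disc × I) : H.Total := Quot.mk _ (Sum.inr ⟨p, x⟩)

/-- The islands: the ends `D² × {0, 1}` of the beams. -/
def islands : Set H.Total :=
  {x | ∃ (b : B) (z : Disc) (t : I), (t = 0 ∨ t = 1) ∧ x = H.beamMap b (z, t)}

/-- The part of `S¹ × [0,1]` on the plates that is not glued to a beam. The edges of the closed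
bridges lie on islands, so `islands ∪ bridges` is a closed set. -/
def bridges : Set H.Total :=
  {x | ∃ (p : P) (z : Circle) (s : I), (∀ k, H.plateOf k = p → z ∉ Set.range (H.plateArc k)) ∧
    x = H.plateMap p (circleToDisc z, s)}

/-- The sticky end `S`. -/
def sticky : Set H.Total := H.islands ∪ H.bridges

/-- Isomorphism of handle-structures: a homeomorphism of the total spaces that takes each beam
to the beam and each plate to the plate with the same label, and the sticky end to the sticky
end. -/
def Iso (H H' : HandleStructure B P K) : Prop :=
  ∃ φ : H.Total ≃ₜ H'.Total,
    (∀ b, φ '' Set.range (H.beamMap b) = Set.range (H'.beamMap b)) ∧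
    (∀ p, φ '' Set.range (H.plateMap p) = Set.range (H'.plateMap p)) ∧
    φ '' H.sticky = H'.sticky

/-- The standard orientations of the beams and plates fit together to an orientation of `M`:
each gluing of strips reverses the boundary orientations. -/
def IsOriented : Prop := ∀ k, IsCcw (H.beamArc k) ↔ IsCcw (H.plateArc k)

/-- The strips have the same positions relative to each other around each beam (the same cyclic
order) and are attached to the beams with the same sense. -/
def SameChoices (H H' : HandleStructure B P K) : Prop :=
  (∀ k l m, H.beamOf k = H.beamOf l → H.beamOf l = H.beamOf m →
    (CcwOrdered (H.beamArc k 0) (H.beamArc l 0) (H.beamArc m 0) ↔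
      CcwOrdered (H'.beamArc k 0) (H'.beamArc l 0) (H'.beamArc m 0))) ∧
  ∀ k, IsCcw (H.beamArc k) ↔ IsCcw (H'.beamArc k)

end HandleStructure

/-- The letters (occurrences of generators) in the family of words `r`. -/
abbrev Letters {X J : Type*} (r : J → List (X × Bool)) : Type _ :=
  Σ j : J, Fin (r j).length

/-- `H` is a handle-structure associated to the presentation with generators `X` and relators
`r`: it has one beam for each generator, one plate for each relator and one strip for each letter
of each relator. Going around the boundary of the plate of `r j` counterclockwise once, from a
base point `β` that lies on no strip, one meets the strips in the order of the letters of `r j`.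
Each is attached to the beam of its generator, and runs along the beam from height `0` to `1` if
the exponent is `1` (sign `true`) and from height `1` to `0` if it is `-1`. -/
def IsAssociated {X J : Type*} (r : J → List (X × Bool))
    (H : HandleStructure X J (Letters r)) : Prop :=
  (∀ j (i : Fin (r j).length), H.plateOf ⟨j, i⟩ = j) ∧
  (∀ j (i : Fin (r j).length), H.beamOf ⟨j, i⟩ = ((r j).get i).1) ∧
  ∀ j, ∃ (β : Circle) (f : Fin (r j).length → I → ℝ),
    (∀ i, Continuous (f i)) ∧
    (∀ i, ((r j).get i).2 = true → StrictMono (f i)) ∧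
    (∀ i, ((r j).get i).2 = false → StrictAnti (f i)) ∧
    (∀ i t, 0 < f i t ∧ f i t < 2 * Real.pi) ∧
    (∀ i i' t t', i < i' → f i t < f i' t') ∧
    ∀ i t, H.plateArc ⟨j, i⟩ t = β * Circle.exp (f i t)

end

/-! After the collapse, a beam is a disc times an arc with both ends at one point `pt`, hence
contributes a generator, and a plate is a disc whose boundary runs along the beams as its relator
prescribes. This is made precise with three open charts: `near` (off the middle level of the beams),
`mid` (strictly between the ends of the beams) and `plate` (the interiors of the plates). The first
two are extended radially into the plates, up to the centres. Over each chart, every point is joined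
to `pt` by a path class that is carried along by paths in the chart (`flatClass`,
`flatClass_trans`). At a point of two charts the two classes differ by a loop, `transition`, which
is constant along paths in the overlap.

Relators die: on a circle around the centre of a plate, the transition to the chart `near` at angle
`θ` is the image of the part of the word read up to `θ`. Close to the base direction it is trivial
on both sides, so the whole relator maps to 1 (`transition_plate`). This gives `coreMap` from the
presented group to the fundamental group. It is surjective because all transitions lie in its image
and transitions generate (`subgroup_eq_top_of_flat`). It is injective because the words read off,
taken in the presented group, have locally constant quotients on the overlaps. They define a
covering whose parallel transport (`exists_transport`) along `coreHom w` is multiplication by the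
inverse of `w`, so that `w` can be recovered from its loop. That the letters of an associated
handle-structure provide such words is `exists_reading`.

For the uniqueness, the strips around each beam or plate are matched by a homeomorphism of the
boundary circle (`exists_circle_matching`, `exists_circle_matching_of_angles`). Coning extends it
over the disc, and the extensions respect the gluing (`Match.iso`). On the plates the words already
fix order and senses. On the beams these are the choices, and they are relations on the finite set
of letters, hence finite in number. Existence comes from evenly spaced arcs, `slot`. -/

section

open scoped unitInterval
open Topology Set Filter

/-! ### Arcs in the circle -/

/-- An embedded arc in the circle lifts to a strictly monotone or antitone path of angles. -/
theorem exists_angle_lift {γ : I → Circle} (hc : Continuous γ) (hi : Function.Injective γ) :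
    ∃ f : I → ℝ, Continuous f ∧ (StrictMono f ∨ StrictAnti f) ∧ ∀ t, γ t = Circle.exp (f t) := by
  obtain ⟨θ, hθ⟩ := Circle.exp_surjective (γ 0)
  let f := Circle.isCoveringMap_exp.liftPath ⟨γ, hc⟩ θ hθ.symm
  have hf : ∀ t, γ t = Circle.exp (f t) := fun t =>
    (congrFun (Circle.isCoveringMap_exp.liftPath_lifts ⟨γ, hc⟩ θ hθ.symm) t).symm
  refine ⟨f, f.continuous, ?_, hf⟩
  refine Continuous.strictMono_of_inj f.continuous fun s t h => hi ?_
  rw [hf, hf, h]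

theorem isOpenMap_circleExp : IsOpenMap Circle.exp := isLocalHomeomorph_circleExp.isOpenMap

theorem isOpen_image_of_strictMono {f : I → ℝ} (hc : Continuous f) (hm : StrictMono f)
    {O : Set I} (hO : IsOpen O) (hO' : O ⊆ Ioo 0 1) : IsOpen (f '' O) := by
  rw [isOpen_iff_mem_nhds]
  rintro _ ⟨t, ht, rfl⟩
  obtain ⟨⟨a, b⟩, ⟨hat, htb⟩, hab⟩ := (nhds_basis_Ioo' ⟨0, (hO' ht).1⟩ ⟨1, (hO' ht).2⟩).mem_iff.1
    (hO.mem_nhds ht)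
  refine mem_of_superset (Ioo_mem_nhds (hm hat) (hm htb)) ?_
  have : Ioo (f a) (f b) ⊆ f '' Ioo a b :=
    intermediate_value_Ioo (hat.trans htb).le hc.continuousOn
  exact this.trans (image_mono hab)

theorem isOpen_image_of_strictAnti {f : I → ℝ} (hc : Continuous f) (hm : StrictAnti f)
    {O : Set I} (hO : IsOpen O) (hO' : O ⊆ Ioo 0 1) : IsOpen (f '' O) := by
  have h := (isOpen_image_of_strictMono (f := fun t => - f t) hc.neg
    (fun _ _ h => neg_lt_neg (hm h)) hO hO').neg
  convert h using 1
  ext x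
  simp [neg_eq_iff_eq_neg]

/-- The interior of an embedded arc is open in the circle. -/
theorem isOpen_image_arc {γ : I → Circle} (hc : Continuous γ) (hi : Function.Injective γ)
    {O : Set I} (hO : IsOpen O) (hO' : O ⊆ Ioo 0 1) : IsOpen (γ '' O) := by
  obtain ⟨f, hf, hm, he⟩ := exists_angle_lift hc hi
  have : γ '' O = Circle.exp '' (f '' O) := by
    rw [image_image]; exact image_congr fun t _ => he t
  rw [this]
  refine isOpenMap_circleExp _ ?_
  rcases hm with hm | hm
  · exact isOpen_image_of_strictMono hf hm hO hO'
  · exact isOpen_image_of_strictAnti hf hm hO hO'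

/-! ### Parallel transport with values in a discrete group -/

section Transport

variable {Z ι G : Type*} [TopologicalSpace Z] [Group G] [TopologicalSpace G] [DiscreteTopology G]

/-- The principal bundle with discrete fibre `G` whose transition functions are the quotients of
the `G`-valued functions `α i`. -/
def potentialBundle (U : ι → Set Z) (hU : ∀ i, IsOpen (U i)) (idx : Z → ι)
    (hidx : ∀ x, x ∈ U (idx x)) (α : ι → Z → G)
    (hα : ∀ i j, ContinuousOn (fun x => α i x * (α j x)⁻¹) (U i ∩ U j)) :
    FiberBundleCore ι Z G where
  baseSet := U
  isOpen_baseSet := hU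
  indexAt := idx
  mem_baseSet_at := hidx
  coordChange i j x v := v * (α i x * (α j x)⁻¹)
  coordChange_self i x _ v := by simp
  continuousOn_coordChange i j := by
    refine ContinuousOn.mul continuousOn_snd ?_
    exact (hα i j).comp continuousOn_fst fun p hp => hp.1
  coordChange_comp i j k x _ v := by group

/-- Parallel transport in the bundle defined by a family of local `G`-valued functions whose
quotients are locally constant. -/
theorem exists_transport (U : ι → Set Z) (hU : ∀ i, IsOpen (U i)) (hcov : ∀ x, ∃ i, x ∈ U i)
    (α : ι → Z → G) (hα : ∀ i j, ContinuousOn (fun x => α i x * (α j x)⁻¹) (U i ∩ U j)) :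
    ∃ τ : ∀ {x y : Z}, Path.Homotopic.Quotient x y → G → G,
      (∀ x v, τ (.refl x) v = v) ∧
      (∀ {x y z : Z} (p : Path.Homotopic.Quotient x y) (q : Path.Homotopic.Quotient y z) v,
        τ (p.trans q) v = τ q (τ p v)) ∧
      ∀ i {x y : Z} (γ : Path x y), (∀ t, γ t ∈ U i) →
        ∀ v, τ (.mk γ) v = v * (α i x)⁻¹ * α i y := by
  choose idx hidx using hcov
  let C := potentialBundle U hU idx hidx α hα
  have cov : IsCoveringMap (C.proj) :=
    FiberBundle.isCoveringMap (F := G) (E := C.Fiber)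
  let pt (x : Z) (v : G) : C.proj ⁻¹' {x} := ⟨⟨x, (v * (α (idx x) x)⁻¹ : G)⟩, rfl⟩
  let fib (e : C.TotalSpace) : G := e.2
  -- Multiplying a fibre coordinate by `α` of its chart gives a coordinate independent of the chart.
  -- In it the flat sections over `U i` are the functions `c * α i`, although `α i` itself need not
  -- be continuous.
  let glob {x : Z} (e : C.proj ⁻¹' {x}) : G := fib e.1 * α (idx x) x
  have glob_pt (x v) : glob (pt x v) = v := by
    simp only [glob, pt, fib]; group
  have pt_glob {x : Z} (e : C.proj ⁻¹' {x}) : pt x (glob e) = e := by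
    obtain ⟨⟨y, w⟩, hy⟩ := e
    obtain rfl : y = x := hy
    exact Subtype.ext (congrArg (Bundle.TotalSpace.mk y) (mul_inv_cancel_right (G := G) w _))
  refine ⟨fun p v => glob (cov.monodromy p (pt _ v)), ?_, ?_, ?_⟩
  · intro x v
    change glob (cov.monodromy _ _) = v
    rw [cov.monodromy_refl]; exact glob_pt x v
  · intro x y z p q v
    change glob (cov.monodromy _ _) = glob (cov.monodromy _ (pt _ (glob (cov.monodromy _ _))))
    rw [cov.monodromy_trans_apply, pt_glob]
  · intro i x y γ hγ v
    let c : G := v * (α i x)⁻¹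
    have key : cov.monodromy (.mk γ) (pt x v) = pt y (c * α i y) := by
      have hc : Continuous fun t : I => (C.localTriv i).toOpenPartialHomeomorph.symm (γ t, c) := by
        refine (C.localTriv i).toOpenPartialHomeomorph.continuousOn_symm.comp_continuous
          (by fun_prop) fun t => ?_
        rw [(C.localTriv i).target_eq]
        exact ⟨hγ t, mem_univ _⟩
      have e0 : ∀ z : Z, (C.localTriv i).toOpenPartialHomeomorph.symm (z, c) =
          (pt z (c * α i z)).1 := by
        intro z
        rw [C.localTriv_symm_apply]
        simp only [pt]
        congr 1
        change c * (α i z * (α (idx z) z)⁻¹) = _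
        group
      have hx : pt x v = pt x (c * α i x) := by simp [c]
      rw [hx]
      let Γ : Path (pt x (c * α i x)).1 (pt y (c * α i y)).1 :=
        ⟨⟨_, hc⟩, by simp only [γ.source]; exact e0 x, by simp only [γ.target]; exact e0 y⟩
      exact cov.monodromy_eq_of_map_eq (.mk Γ) rfl
    change glob (cov.monodromy _ _) = _
    rw [key]; exact glob_pt _ _

end Transport

/-! ### Generation of the fundamental group by differences of flat families -/

section Generation

variable {Z ι : Type*} [TopologicalSpace Z]

theorem eventually_uIcc_subset {S : Set I} {t₀ : I} (h : S ∈ 𝓝 t₀) :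
    ∀ᶠ t in 𝓝 t₀, uIcc t₀ t ⊆ S := by
  filter_upwards [ordConnectedComponent_mem_nhds.2 h] with t ht
  exact ht

theorem subpath_mem {x y : Z} (γ : Path x y) {t₀ t₁ : I} {U : Set Z}
    (h : uIcc t₀ t₁ ⊆ γ ⁻¹' U) (t : I) : γ.subpath t₀ t₁ t ∈ U := by
  have : γ.subpath t₀ t₁ t ∈ range (γ.subpath t₀ t₁) := mem_range_self t
  rw [γ.range_subpath] at this
  obtain ⟨s, hs, e⟩ := this
  rw [← e]; exact h hs

theorem mk_subpath_trans {x y : Z} (γ : Path x y) (a b c : I) :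
    (Path.Homotopic.Quotient.mk (γ.subpath a b)).trans (.mk (γ.subpath b c)) =
      .mk (γ.subpath a c) := by
  rw [← Path.Homotopic.Quotient.mk_trans, Path.Homotopic.Quotient.eq]
  exact ⟨Path.Homotopy.subpathTransSubpath γ a b c⟩

section Classes

open Path.Homotopic (Quotient)

variable {w x y z : Z}

theorem Path.Homotopic.Quotient.symm_trans_rev (p : Quotient x y) (q : Quotient y z) :
    (p.trans q).symm = q.symm.trans p.symm := by
  have : ((p.trans q).symm.trans (p.trans q)).trans (q.symm.trans p.symm) =
    (p.trans q).symm.trans ((p.trans q).trans (q.symm.trans p.symm)) := by grind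
  grind

/-- The difference of two classes of paths with the same end points. -/
noncomputable def pathDiff (p q : Quotient x y) : FundamentalGroup Z x :=
  FundamentalGroup.fromPath (p.trans q.symm)

theorem pathDiff_mul (p q r : Quotient x y) : pathDiff q r * pathDiff p q = pathDiff p r := by
  change (p.trans q.symm).trans (q.trans r.symm) = p.trans r.symm
  grind

theorem pathDiff_self (p : Quotient x y) : pathDiff p p = 1 := by
  change p.trans p.symm = _
  rw [FundamentalGroup.one_def]
  grind

theorem pathDiff_inv (p q : Quotient x y) : (pathDiff p q)⁻¹ = pathDiff q p := by
  rw [inv_eq_iff_mul_eq_one, pathDiff_mul, pathDiff_self]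

theorem pathDiff_trans (p q : Quotient x y) (r : Quotient y z) :
    pathDiff (p.trans r) (q.trans r) = pathDiff p q := by
  change (p.trans r).trans (q.trans r).symm = p.trans q.symm
  rw [Path.Homotopic.Quotient.symm_trans_rev]
  grind

end Classes

/-- A subgroup of the fundamental group is everything, if on an open cover there are flat
families of paths from the base point, whose differences lie in the subgroup. -/
theorem subgroup_eq_top_of_flat {z₀ : Z} (U : ι → Set Z) (hU : ∀ i, IsOpen (U i))
    (hcov : ∀ x, ∃ i, x ∈ U i) (s : ∀ i x, x ∈ U i → Path.Homotopic.Quotient z₀ x)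
    (flat : ∀ i {x y : Z} (γ : Path x y) (_ : ∀ t, γ t ∈ U i) (hx : x ∈ U i) (hy : y ∈ U i),
      (s i x hx).trans (.mk γ) = s i y hy)
    (H : Subgroup (FundamentalGroup Z z₀))
    (hH : ∀ i j x (hi : x ∈ U i) (hj : x ∈ U j), pathDiff (s i x hi) (s j x hj) ∈ H)
    (h₀ : ∀ i (hi : z₀ ∈ U i), FundamentalGroup.fromPath (s i z₀ hi) ∈ H) : H = ⊤ := by
  have main {x y : Z} (γ : Path x y) (i j) (hi : x ∈ U i) (hj : y ∈ U j) :
      pathDiff ((s i x hi).trans (.mk γ)) (s j y hj) ∈ H := by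
    have hs : γ = (γ.subpath 0 1).cast γ.source.symm γ.target.symm := by
      ext t; simp
    have aux : ∀ (t : I) (i j) (hi : γ 0 ∈ U i) (hj : γ t ∈ U j),
        pathDiff ((s i _ hi).trans (.mk (γ.subpath 0 t))) (s j _ hj) ∈ H := by
      intro t i j hi hj
      let d (t : I) (j : ι) (hj : γ t ∈ U j) : FundamentalGroup Z z₀ :=
        pathDiff ((s i _ hi).trans (.mk (γ.subpath 0 t))) (s j _ hj)
      have hd (t : I) (k l : ι) (hk : γ t ∈ U k) (hl : γ t ∈ U l) :
          d t k hk ∈ H → d t l hl ∈ H := fun h => by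
        have := H.mul_mem (hH k l _ hk hl) h
        rwa [pathDiff_mul] at this
      -- Membership in `H` is propagated along `γ`: by flatness the difference does not change while
      -- `γ` stays in one chart, and changing the chart multiplies it by an element of `H`. Hence
      -- `P` is locally constant on the interval.
      let P : I → Prop := fun t => ∀ i hi, d t i hi ∈ H
      have hP : IsLocallyConstant P := by
        refine (IsLocallyConstant.iff_eventually_eq P).2 fun t₀ => ?_
        obtain ⟨k, hk⟩ := hcov (γ t₀)
        have hn : γ ⁻¹' U k ∈ 𝓝 t₀ := γ.continuous.continuousAt ((hU k).mem_nhds hk)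
        filter_upwards [eventually_uIcc_subset hn] with t ht
        have hkt : γ t ∈ U k := ht right_mem_uIcc
        have e : d t k hkt = d t₀ k hk := by
          simp only [d]
          rw [← flat k (γ.subpath t₀ t) (subpath_mem γ ht) hk hkt, ← mk_subpath_trans γ 0 t₀ t,
            ← Path.Homotopic.Quotient.trans_assoc, pathDiff_trans]
        exact propext ⟨fun h l hl => hd t₀ k l hk hl (e ▸ h k hkt),
          fun h l hl => hd t k l hkt hl (e.symm ▸ h k hk)⟩
      have h0 : P 0 := by
        intro l hl
        simp only [d, Path.subpath_self, Path.Homotopic.Quotient.mk_refl,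
          Path.Homotopic.Quotient.trans_refl]
        exact hH _ _ _ _ _
      have := hP.apply_eq_of_preconnectedSpace t 0
      exact (this.symm ▸ h0 : P t) j hj
    have gen : ∀ (x' y' : Z) (hx : γ 0 = x') (hy : γ 1 = y') (hi : x' ∈ U i) (hj : y' ∈ U j),
        pathDiff ((s i x' hi).trans (.mk ((γ.subpath 0 1).cast hx.symm hy.symm)))
          (s j y' hj) ∈ H := by
      rintro _ _ rfl rfl hi hj
      exact aux 1 i j hi hj
    rw [hs]
    exact gen x y γ.source γ.target hi hj
  refine eq_top_iff.2 fun g _ => ?_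
  induction g using Path.Homotopic.Quotient.ind with | mk γ =>
  obtain ⟨i, hi⟩ := hcov z₀
  -- The flat class at `z₀` is itself a loop, possibly nontrivial, so the loop `γ` is recovered from
  -- its difference by conjugation with it.
  have h := H.mul_mem (H.mul_mem (h₀ i hi) (main γ i i hi hi)) (H.inv_mem (h₀ i hi))
  convert h using 1
  generalize s i z₀ hi = p
  generalize Path.Homotopic.Quotient.mk γ = q
  change q = p.symm.trans (((p.trans q).trans p.symm).trans p)
  grind

end Generation

/-! ### Homotopies from triangles and squares -/

section Simplices

instance contractibleSpace_unitInterval : ContractibleSpace I :=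
  (convex_Icc (0 : ℝ) 1).contractibleSpace ⟨0, by simp⟩

variable {Y Z : Type*} [TopologicalSpace Y] [TopologicalSpace Z]

/-- Paths that factor through a simply connected space and bound a triangle there. -/
theorem mk_trans_eq_of_factor [SimplyConnectedSpace Y] {F : Y → Z} (hF : Continuous F)
    {p q r : Z} (a : Path p q) (b : Path q r) (c : Path p r) {a' b' c' : I → Y}
    (ha' : Continuous a') (hb' : Continuous b') (hc' : Continuous c')
    (ha : ∀ t, a t = F (a' t)) (hb : ∀ t, b t = F (b' t)) (hc : ∀ t, c t = F (c' t))
    (h₀ : c' 0 = a' 0) (h₁ : a' 1 = b' 0) (h₂ : c' 1 = b' 1) :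
    (Path.Homotopic.Quotient.mk a).trans (.mk b) = .mk c := by
  obtain rfl : F (a' 0) = p := by rw [← ha, a.source]
  obtain rfl : F (a' 1) = q := by rw [← ha, a.target]
  obtain rfl : F (b' 1) = r := by rw [← hb, b.target]
  let A : Path (a' 0) (a' 1) := ⟨⟨a', ha'⟩, rfl, rfl⟩
  let B : Path (a' 1) (b' 1) := ⟨⟨b', hb'⟩, h₁.symm, rfl⟩
  let C : Path (a' 0) (b' 1) := ⟨⟨c', hc'⟩, h₀, h₂⟩
  have eA : a = A.map hF := Path.ext (funext ha)
  have eB : b = B.map hF := Path.ext (funext hb)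
  have eC : c = C.map hF := Path.ext (funext hc)
  rw [eA, eB, eC, ← Path.Homotopic.Quotient.mk_trans, ← Path.map_trans,
    Path.Homotopic.Quotient.eq]
  exact (SimplyConnectedSpace.paths_homotopic _ _).map ⟨F, hF⟩

/-- A square all of whose sides are paths commutes up to homotopy. -/
theorem mk_trans_eq_of_square {K : I × I → Z} (hK : Continuous K) {p q q' r : Z}
    (a : Path p q) (b : Path q r) (c : Path p q') (d : Path q' r)
    (ha : ∀ t, a t = K (0, t)) (hb : ∀ t, b t = K (t, 1)) (hc : ∀ t, c t = K (t, 0))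
    (hd : ∀ t, d t = K (1, t)) :
    (Path.Homotopic.Quotient.mk a).trans (.mk b) =
      (Path.Homotopic.Quotient.mk c).trans (.mk d) := by
  have hp : p = K (0, 0) := by rw [← ha, a.source]
  have hr : r = K (1, 1) := by rw [← hd, d.target]
  -- The diagonal cuts the square into two triangles.
  let e : Path p r := ⟨⟨fun t => K (t, t), by fun_prop⟩, hp.symm, hr.symm⟩
  rw [mk_trans_eq_of_factor hK a b e (a' := fun t => (0, t)) (b' := fun t => (t, 1))
      (c' := fun t => (t, t)) (by fun_prop) (by fun_prop) (by fun_prop) ha hb (fun _ => rfl)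
      rfl rfl rfl,
    mk_trans_eq_of_factor hK c d e (a' := fun t => (t, 0)) (b' := fun t => (1, t))
      (c' := fun t => (t, t)) (by fun_prop) (by fun_prop) (by fun_prop) hc hd (fun _ => rfl)
      rfl rfl rfl]

/-- Paths from a base point, composed of two stages that depend continuously on the end point. -/
theorem mk_trans_of_two_stages {R A : Z → I → Z} {z₀ : Z} {O : Set Z}
    (hR : ContinuousOn (fun q : Z × I => R q.1 q.2) (O ×ˢ univ))
    (hA : ContinuousOn (fun q : Z × I => A q.1 q.2) (O ×ˢ univ))
    (hR₁ : ∀ x, R x 1 = x) (hA₁ : ∀ x, A x 1 = R x 0) (hA₀ : ∀ x, A x 0 = z₀)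
    {x y : Z} (γ : Path x y) (hγ : ∀ t, γ t ∈ O) (rx : Path (R x 0) x) (ry : Path (R y 0) y)
    (ax : Path z₀ (R x 0)) (ay : Path z₀ (R y 0)) (hrx : ∀ t, rx t = R x t)
    (hry : ∀ t, ry t = R y t) (hax : ∀ t, ax t = A x t) (hay : ∀ t, ay t = A y t) :
    ((Path.Homotopic.Quotient.mk ax).trans (.mk rx)).trans (.mk γ) =
      (Path.Homotopic.Quotient.mk ay).trans (.mk ry) := by
  have hr : Continuous fun q : I × I => R (γ q.1) q.2 :=
    hR.comp_continuous (f := fun q : I × I => (γ q.1, q.2)) (by fun_prop)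
      fun q => ⟨hγ _, mem_univ _⟩
  have ha : Continuous fun q : I × I => A (γ q.1) q.2 :=
    hA.comp_continuous (f := fun q : I × I => (γ q.1, q.2)) (by fun_prop)
      fun q => ⟨hγ _, mem_univ _⟩
  have hs : Continuous fun t => R (γ t) 0 := hr.comp (continuous_id.prodMk continuous_const)
  -- The intermediate end points form a path as `x` runs along `γ`. It is the common side of two
  -- squares, and the side of the second square at `z₀` is constant.
  let γ' : Path (R x 0) (R y 0) := ⟨⟨fun t => R (γ t) 0, hs⟩, by simp, by simp⟩
  have h1 := mk_trans_eq_of_square hr rx γ γ' ry (fun t => by simp [hrx]) (fun t => by simp [hR₁])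
    (fun t => rfl) (fun t => by simp [hry])
  have h2 := mk_trans_eq_of_square ha ax γ' (Path.refl _) ay (fun t => by simp [hax])
    (fun t => by simp [hA₁, γ']) (fun t => by simp [hA₀]) (fun t => by simp [hay])
  rw [Path.Homotopic.Quotient.mk_refl, Path.Homotopic.Quotient.refl_trans] at h2
  rw [Path.Homotopic.Quotient.trans_assoc, h1, ← Path.Homotopic.Quotient.trans_assoc, h2]

end Simplices

/-! ### The disc -/

/-- The direction of a point of the disc, with value `1` at the centre. -/
noncomputable def Disc.dir (w : Disc) : Circle := Circle.exp (Complex.arg w)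

theorem Disc.dir_circleToDisc (z : Circle) : Disc.dir (circleToDisc z) = z := Circle.exp_arg z

theorem Disc.norm_smul_dir (w : Disc) : ((‖(w : ℂ)‖ : ℝ) : ℂ) * (Disc.dir w : ℂ) = w := by
  simp [Disc.dir, Circle.coe_exp, Complex.norm_mul_exp_arg_mul_I]

theorem Disc.dir_mul {ρ : ℝ} (hρ : 0 < ρ) (z : Circle) (w : Disc) (h : (w : ℂ) = ρ * z) :
    Disc.dir w = z := by
  rw [Disc.dir, h, Complex.arg_real_mul _ hρ]
  exact Circle.exp_arg z

theorem Disc.continuousOn_dir : ContinuousOn Disc.dir {w | (w : ℂ) ≠ 0} := by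
  refine IsInducing.subtypeVal.continuousOn_iff.2 ?_
  have : ContinuousOn (fun w : Disc => (w : ℂ) / ((‖(w : ℂ)‖ : ℝ) : ℂ)) {w | (w : ℂ) ≠ 0} := by
    refine ContinuousOn.div (by fun_prop) (by fun_prop) fun w hw => ?_
    simpa using hw
  refine this.congr fun w hw => ?_
  have hw' : ((‖(w : ℂ)‖ : ℝ) : ℂ) ≠ 0 := by simpa using hw
  rw [eq_div_iff hw', mul_comm]
  exact Disc.norm_smul_dir w

theorem continuous_circleToDisc : Continuous circleToDisc :=
  Continuous.subtype_mk continuous_subtype_val _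

/-- The point dividing the segment between two points of the disc in a given ratio. -/
noncomputable def Disc.lerp (a b : Disc) (t : I) : Disc :=
  ⟨(1 - (t : ℝ)) • (a : ℂ) + (t : ℝ) • (b : ℂ), (convex_closedBall (0 : ℂ) 1) a.2 b.2
    (by linarith [t.2.2]) t.2.1 (by ring)⟩

@[simp] theorem Disc.lerp_zero (a b : Disc) : Disc.lerp a b 0 = a := Subtype.ext (by simp [lerp])

@[simp] theorem Disc.lerp_one (a b : Disc) : Disc.lerp a b 1 = b := Subtype.ext (by simp [lerp])

@[simp] theorem Disc.lerp_self (a : Disc) (t : I) : Disc.lerp a a t = a :=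
  Subtype.ext (by simp [lerp]; ring)

theorem Disc.continuous_lerp : Continuous fun p : Disc × Disc × I => Disc.lerp p.1 p.2.1 p.2.2 :=
  Continuous.subtype_mk (by fun_prop) _

/-- The centre of the disc. -/
noncomputable def Disc.centre : Disc := ⟨0, by simp⟩

instance contractibleSpace_disc : ContractibleSpace Disc :=
  (convex_closedBall (0 : ℂ) 1).contractibleSpace ⟨0, by simp⟩

/-! ### Continuity of families of paths -/

/-- The product of a quotient with `I` is awkward to test for continuity. Currying, possible because
`I` is locally compact, turns a family of paths into a map from the quotient alone, which can be
tested on the pieces. -/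
theorem continuousOn_curry_iff {A Y : Type*} [TopologicalSpace A] [TopologicalSpace Y]
    {F : A → I → Y} (hF : ∀ x, Continuous (F x)) {S : Set A} :
    ContinuousOn (fun x => (⟨F x, hF x⟩ : C(I, Y))) S ↔
      ContinuousOn (fun q : A × I => F q.1 q.2) (S ×ˢ univ) := by
  constructor
  · intro h
    rw [continuousOn_iff_continuous_domRestrict] at h ⊢
    have h2 := ContinuousMap.continuous_uncurry_of_continuous ⟨_, h⟩
    let m : (S ×ˢ (univ : Set I) : Set (A × I)) → S × I := fun p => (⟨p.1.1, p.2.1⟩, p.1.2)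
    have hm : Continuous m := by fun_prop
    exact h2.comp hm
  · intro h
    rw [continuousOn_iff_continuous_domRestrict]
    refine ContinuousMap.continuous_of_continuous_uncurry _ ?_
    exact h.comp_continuous (f := fun p : S × I => ((p.1 : A), p.2)) (by fun_prop)
      fun p => ⟨p.1.2, mem_univ _⟩

/-- A function that is constant off finitely many arcs is continuous if it is so on the arcs. -/
theorem continuousOn_of_arcs {ι Y : Type*} [Finite ι] [TopologicalSpace Y]
    (arc : ι → I → Circle) (hc : ∀ i, Continuous (arc i))
    (hi : ∀ i, Function.Injective (arc i)) {A : Type*} [TopologicalSpace A]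
    {g : Circle × A → Y} {S : Set Circle} (y : Y)
    (hy : ∀ u a, (∀ i, u ∉ arc i '' Ioo 0 1) → g (u, a) = y)
    (hg : ∀ i, ContinuousOn (fun q : I × A => g (arc i q.1, q.2)) ((arc i ⁻¹' S) ×ˢ univ)) :
    ContinuousOn g (S ×ˢ univ) := by
  -- A finite closed cover of the circle: the complement of the open arcs, where `g` does not depend
  -- on the point, and the closed arcs, which are embedded intervals.
  let D : Option ι → Set Circle := fun o =>
    o.elim {u | ∀ i, u ∉ arc i '' Ioo 0 1} fun i => range (arc i)
  have hD : ∀ o, IsClosed (D o) := by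
    rintro (_ | i)
    · have : D none = (⋃ i, arc i '' Ioo 0 1)ᶜ := by ext u; simp [D]
      rw [this]
      exact (isOpen_iUnion fun i =>
        isOpen_image_arc (hc i) (hi i) isOpen_Ioo subset_rfl).isClosed_compl
    · exact (isCompact_range (hc i)).isClosed
  have hcov : S ×ˢ (univ : Set A) = ⋃ o, (D o ∩ S) ×ˢ univ := by
    ext ⟨u, a⟩
    simp only [mem_prod, mem_univ, and_true, mem_iUnion, mem_inter_iff, exists_and_right,
      iff_and_self]
    intro _
    by_cases h : ∃ i, u ∈ range (arc i)
    · obtain ⟨i, h⟩ := h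
      exact ⟨some i, h⟩
    · exact ⟨none, fun i ⟨t, _, e⟩ => h ⟨i, t, e⟩⟩
  rintro ⟨u, a⟩ hu
  rw [ContinuousWithinAt, hcov, nhdsWithin_iUnion, tendsto_iSup]
  intro o
  by_cases hu' : u ∈ D o
  swap
  · have : 𝓝[(D o ∩ S) ×ˢ univ] (u, a) = ⊥ := by
      rw [← notMem_closure_iff_nhdsWithin_eq_bot, closure_prod_eq]
      exact fun h => hu' ((hD o).closure_subset_iff.2 inter_subset_left h.1)
    rw [this]; exact tendsto_bot
  cases o with
  | none =>
    refine tendsto_nhds_of_eventually_eq ?_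
    filter_upwards [self_mem_nhdsWithin] with p hp
    rw [hy u a hu', show p = (p.1, p.2) from rfl, hy p.1 p.2 hp.1.1]
  | some i =>
    obtain ⟨t, rfl⟩ := hu'
    have emb : IsEmbedding (Prod.map (arc i) (id : A → A)) :=
      ((hc i).isClosedEmbedding (hi i)).isEmbedding.prodMap .id
    have hset : (D (some i) ∩ S) ×ˢ (univ : Set A) =
        Prod.map (arc i) id '' ((arc i ⁻¹' S) ×ˢ univ) := by
      rw [prodMap_image_prod, image_preimage_eq_inter_range, inter_comm]; simp [D]
    have := emb.map_nhdsWithin_eq ((arc i ⁻¹' S) ×ˢ univ) (t, a)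
    rw [hset]
    change Tendsto g (𝓝[_] (Prod.map (arc i) id (t, a))) _
    rw [← this, tendsto_map'_iff]
    exact hg i (t, a) ⟨hu.1, mem_univ _⟩

namespace HandleStructure

variable {B P K : Type*} (H : HandleStructure B P K)

/-! ### The quotient of the total space by the sticky end -/

/-- The space obtained from the total space by identifying the sticky end to a point. -/
abbrev Collapsed : Type _ := Collapse H.sticky

/-- The point of the collapsed space that is the image of the sticky end. -/
def pt : H.Collapsed := Quot.mk _ (Sum.inr ())

/-- The map from the total space to the collapsed space. -/
def proj (x : H.Total) : H.Collapsed := Quot.mk _ (Sum.inl x)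

/-- The map of a beam to the collapsed space. -/
def cbeam (b : B) (x : Disc × I) : H.Collapsed := H.proj (H.beamMap b x)

/-- The map of a plate to the collapsed space. -/
def cplate (p : P) (x : Disc × I) : H.Collapsed := H.proj (H.plateMap p x)

theorem proj_eq_pt {x : H.Total} (h : x ∈ H.sticky) : H.proj x = H.pt :=
  Quot.sound ⟨x, h, rfl, rfl⟩

theorem cbeam_eq_pt (b : B) (z : Disc) {t : I} (ht : t = 0 ∨ t = 1) : H.cbeam b (z, t) = H.pt :=
  H.proj_eq_pt (Or.inl ⟨b, z, t, ht, rfl⟩)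

theorem cplate_eq_pt {p : P} {z : Circle} (hz : ∀ k, H.plateOf k = p → z ∉ range (H.plateArc k))
    (s : I) : H.cplate p (circleToDisc z, s) = H.pt :=
  H.proj_eq_pt (Or.inr ⟨p, z, s, hz, rfl⟩)

theorem glue_eq (k : K) (s t : I) :
    H.cbeam (H.beamOf k) (circleToDisc (H.beamArc k s), t) =
      H.cplate (H.plateOf k) (circleToDisc (H.plateArc k t), s) :=
  congrArg H.proj (Quot.sound ⟨k, s, t, rfl, rfl⟩)

theorem continuous_proj : Continuous H.proj := continuous_quot_mk.comp continuous_inl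

theorem continuous_cbeam (b : B) : Continuous (H.cbeam b) :=
  H.continuous_proj.comp (continuous_quot_mk.comp (continuous_inl.comp continuous_sigmaMk))

theorem continuous_cplate (p : P) : Continuous (H.cplate p) :=
  H.continuous_proj.comp (continuous_quot_mk.comp (continuous_inr.comp continuous_sigmaMk))

theorem isOpen_collapsed_iff {O : Set H.Collapsed} :
    IsOpen O ↔ (∀ b, IsOpen (H.cbeam b ⁻¹' O)) ∧ ∀ p, IsOpen (H.cplate p ⁻¹' O) := by
  refine ⟨fun h => ⟨fun b => h.preimage (H.continuous_cbeam b),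
    fun p => h.preimage (H.continuous_cplate p)⟩, fun ⟨hb, hp⟩ => ?_⟩
  have q₁ : IsQuotientMap (Quot.mk _ : H.Total ⊕ Unit → H.Collapsed) := isQuotientMap_quot_mk
  have q₂ : IsQuotientMap (Quot.mk _ : H.Pieces → H.Total) := isQuotientMap_quot_mk
  refine q₁.isOpen_preimage.1 (isOpen_sum_iff.2 ⟨q₂.isOpen_preimage.1 ?_, isOpen_discrete _⟩)
  rw [isOpen_sum_iff, isOpen_sigma_iff, isOpen_sigma_iff]
  exact ⟨hb, hp⟩

theorem continuousOn_collapsed {Y : Type*} [TopologicalSpace Y] {f : H.Collapsed → Y}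
    {O : Set H.Collapsed} (hO : IsOpen O)
    (hb : ∀ b, ContinuousOn (fun x => f (H.cbeam b x)) (H.cbeam b ⁻¹' O))
    (hp : ∀ p, ContinuousOn (fun x => f (H.cplate p x)) (H.cplate p ⁻¹' O)) :
    ContinuousOn f O := by
  rw [continuousOn_open_iff hO]
  intro t ht
  rw [isOpen_collapsed_iff]
  exact ⟨fun b => (hb b).isOpen_inter_preimage (hO.preimage (H.continuous_cbeam b)) ht,
    fun p => (hp p).isOpen_inter_preimage (hO.preimage (H.continuous_cplate p)) ht⟩

theorem continuousOn_collapsed_prod {Y : Type*} [TopologicalSpace Y] {F : H.Collapsed → I → Y}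
    (hF : ∀ x, Continuous (F x)) {O : Set H.Collapsed} (hO : IsOpen O)
    (hb : ∀ b, ContinuousOn (fun q : (Disc × I) × I => F (H.cbeam b q.1) q.2)
      ((H.cbeam b ⁻¹' O) ×ˢ univ))
    (hp : ∀ p, ContinuousOn (fun q : (Disc × I) × I => F (H.cplate p q.1) q.2)
      ((H.cplate p ⁻¹' O) ×ˢ univ)) :
    ContinuousOn (fun q : H.Collapsed × I => F q.1 q.2) (O ×ˢ univ) := by
  rw [← continuousOn_curry_iff hF]
  exact H.continuousOn_collapsed hO (fun b => (continuousOn_curry_iff fun x => hF _).2 (hb b))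
    fun p => (continuousOn_curry_iff fun x => hF _).2 (hp p)

variable {H} in
/-- A function on the collapsed space, given on the pieces. -/
def collapsedLift {Y : Type*} (f : B → Disc × I → Y) (g : P → Disc × I → Y) (y : Y)
    (hglue : ∀ k s t, f (H.beamOf k) (circleToDisc (H.beamArc k s), t) =
      g (H.plateOf k) (circleToDisc (H.plateArc k t), s))
    (hf : ∀ b z t, t = 0 ∨ t = 1 → f b (z, t) = y)
    (hg : ∀ p z s, (∀ k, H.plateOf k = p → z ∉ range (H.plateArc k)) →
      g p (circleToDisc z, s) = y) : H.Collapsed → Y :=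
  Quot.lift (Sum.elim (Quot.lift (Sum.elim (fun x => f x.1 x.2) fun x => g x.1 x.2) (by
    rintro _ _ ⟨k, s, t, rfl, rfl⟩
    exact hglue k s t)) fun _ => y) (by
    rintro _ _ ⟨x, hx, rfl, rfl⟩
    rcases hx with ⟨b, z, t, ht, rfl⟩ | ⟨p, z, s, hz, rfl⟩
    · exact hf b z t ht
    · exact hg p z s hz)

theorem collapsed_cases {motive : H.Collapsed → Prop} (x : H.Collapsed) (pt : motive H.pt)
    (beam : ∀ b z t, motive (H.cbeam b (z, t))) (plate : ∀ p w s, motive (H.cplate p (w, s))) :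
    motive x := by
  obtain ⟨x⟩ := x
  rcases x with x | _
  · obtain ⟨x⟩ := x
    rcases x with ⟨b, z, t⟩ | ⟨p, w, s⟩
    · exact beam b z t
    · exact plate p w s
  · exact pt

/-! ### Angular position on the plates -/

open Classical in
/-- The strip, and the position along it, at a point of the boundary circle of a plate. -/
noncomputable def arcPt (p : P) (u : Circle) : Option (K × I) :=
  if h : ∃ q : K × I, H.plateOf q.1 = p ∧ H.plateArc q.1 q.2 = u then some h.choose else none

theorem arcPt_eq_some_iff {p : P} {u : Circle} {k : K} {t : I} :
    H.arcPt p u = some (k, t) ↔ H.plateOf k = p ∧ H.plateArc k t = u := by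
  unfold arcPt
  split_ifs with h
  · obtain ⟨h1, h2⟩ := h.choose_spec
    generalize h.choose = q at h1 h2
    rw [Option.some_inj]
    constructor
    · rintro rfl; exact ⟨h1, h2⟩
    · rintro ⟨h3, h4⟩
      -- The strip is unique because strips on one plate are disjoint, and then the position is
      -- unique because the arc is injective.
      have hk : q.1 = k := by
        by_contra hne
        exact disjoint_left.1 (H.disjoint_plateArc _ _ hne (h1.trans h3.symm))
          ⟨q.2, h2⟩ ⟨t, h4⟩
      refine Prod.ext hk (H.injective_plateArc k ?_)
      rw [h4, ← h2, hk]
  · simp only [false_iff]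
    exact fun h3 => h ⟨(k, t), h3⟩

theorem arcPt_arc (k : K) (t : I) : H.arcPt (H.plateOf k) (H.plateArc k t) = some (k, t) :=
  H.arcPt_eq_some_iff.2 ⟨rfl, rfl⟩

theorem arcPt_eq_none {p : P} {u : Circle}
    (h : ∀ k, H.plateOf k = p → u ∉ range (H.plateArc k)) : H.arcPt p u = none := by
  rw [Option.eq_none_iff_forall_ne_some]
  rintro ⟨k, t⟩ e
  obtain ⟨h1, h2⟩ := H.arcPt_eq_some_iff.1 e
  exact h k h1 ⟨t, h2⟩

/-! ### Paths that run along the beams and then radially inwards in the plates -/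

/-- A family of paths in the interval, ending at a given point and starting at an end point. -/
structure IsTrack (e : I → I → I) : Prop where
  continuous : ∀ t, Continuous (e t)
  start : ∀ t, e t 0 = 0 ∨ e t 0 = 1
  stop_eq : ∀ t, e t 1 = t
  -- The tracks of the end points stay at the ends, so their images in the collapsed space are
  -- constant. This makes `track` compatible with the collapse.
  bot : ∀ τ, e 0 τ = 0 ∨ e 0 τ = 1
  top : ∀ τ, e 1 τ = 0 ∨ e 1 τ = 1

variable {H} in
/-- The path along a beam to a point of the boundary of a plate. -/
noncomputable def boundaryTrack (e : I → I → I) (p : P) (u : Circle) (s τ : I) : H.Collapsed :=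
  match H.arcPt p u with
  | some (k, t) => H.cbeam (H.beamOf k) (circleToDisc (H.beamArc k s), e t τ)
  | none => H.pt

theorem boundaryTrack_arc (e : I → I → I) (k : K) (t s τ : I) :
    boundaryTrack e (H.plateOf k) (H.plateArc k t) s τ =
      H.cbeam (H.beamOf k) (circleToDisc (H.beamArc k s), e t τ) := by
  simp only [boundaryTrack, arcPt_arc]

/-- Also at the end points of a strip the path is constant, by `bot` and `top`. So the definitions
on the strips and between them agree at the ends of the arcs, as `continuousOn_of_arcs` requires. -/
theorem boundaryTrack_eq_pt {e : I → I → I} (he : IsTrack e) {p : P} {u : Circle}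
    (h : ∀ k, H.plateOf k = p → u ∉ H.plateArc k '' Ioo 0 1) (s τ : I) :
    boundaryTrack (H := H) e p u s τ = H.pt := by
  unfold boundaryTrack
  split
  · rename_i k t heq
    obtain ⟨h1, h2⟩ := H.arcPt_eq_some_iff.1 heq
    have ht : t ∉ Ioo 0 1 := fun ht => h k h1 ⟨t, ht, h2⟩
    have : t = 0 ∨ t = 1 := by
      by_contra! hne
      exact ht ⟨unitInterval.pos_iff_ne_zero.2 hne.1, unitInterval.lt_one_iff_ne_one.2 hne.2⟩
    refine H.cbeam_eq_pt _ _ ?_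
    rcases this with rfl | rfl
    · exact he.bot τ
    · exact he.top τ
  · rfl

variable {H} in
/-- The path that runs along a beam and ends at a given point of the beams, or at the point of
the boundary of a plate in the direction of a given point of the plate. -/
noncomputable def track {e : I → I → I} (he : IsTrack e) (x : H.Collapsed) (τ : I) : H.Collapsed :=
  collapsedLift (fun b q => H.cbeam b (q.1, e q.2 τ))
    (fun p q => boundaryTrack e p (Disc.dir q.1) q.2 τ) H.pt
    (fun k s t => by simp only [Disc.dir_circleToDisc, boundaryTrack_arc])
    (fun b z t ht => H.cbeam_eq_pt _ _ (by
      rcases ht with rfl | rfl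
      exacts [he.bot τ, he.top τ]))
    (fun p z s hz => by
      simp only [Disc.dir_circleToDisc, boundaryTrack, H.arcPt_eq_none hz]) x

variable {H} in
/-- The radial path in a plate, from the boundary to a given point. -/
noncomputable def radial (x : H.Collapsed) (τ : I) : H.Collapsed :=
  collapsedLift (fun b q => H.cbeam b q)
    (fun p q => H.cplate p (Disc.lerp (circleToDisc (Disc.dir q.1)) q.1 τ, q.2)) H.pt
    (fun k s t => by simp only [Disc.dir_circleToDisc, Disc.lerp_self, glue_eq])
    (fun b z t ht => H.cbeam_eq_pt _ _ ht)
    (fun p z s hz => by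
      simp only [Disc.dir_circleToDisc, Disc.lerp_self, H.cplate_eq_pt hz]) x

section Track

variable {e : I → I → I} (he : IsTrack e)

theorem continuous_track (x : H.Collapsed) : Continuous (track he x) := by
  induction x using H.collapsed_cases with
  | pt => exact continuous_const
  | beam b z t =>
    exact (H.continuous_cbeam b).comp (continuous_const.prodMk (he.continuous t))
  | plate p w s =>
    change Continuous fun τ => boundaryTrack e p (Disc.dir w) s τ
    unfold boundaryTrack
    split
    · rename_i k t _
      exact (H.continuous_cbeam _).comp (continuous_const.prodMk (he.continuous t))
    · exact continuous_const

theorem continuous_radial (x : H.Collapsed) : Continuous (radial x) := by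
  induction x using H.collapsed_cases with
  | pt => exact continuous_const
  | beam b z t => exact continuous_const
  | plate p w s =>
    exact (H.continuous_cplate p).comp ((Disc.continuous_lerp.comp (f := fun τ : I =>
      (circleToDisc (Disc.dir w), w, τ)) (by fun_prop)).prodMk continuous_const)

theorem track_zero (x : H.Collapsed) : track he x 0 = H.pt := by
  induction x using H.collapsed_cases with
  | pt => rfl
  | beam b z t => exact H.cbeam_eq_pt _ _ (he.start t)
  | plate p w s =>
    change boundaryTrack e p (Disc.dir w) s 0 = _
    unfold boundaryTrack
    split
    · exact H.cbeam_eq_pt _ _ (he.start _)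
    · rfl

theorem track_one (x : H.Collapsed) : track he x 1 = radial x 0 := by
  induction x using H.collapsed_cases with
  | pt => rfl
  | beam b z t =>
    change H.cbeam b (z, e t 1) = H.cbeam b (z, t)
    rw [he.stop_eq]
  | plate p w s =>
    change boundaryTrack e p (Disc.dir w) s 1 =
      H.cplate p (Disc.lerp (circleToDisc (Disc.dir w)) w 0, s)
    rw [Disc.lerp_zero]
    unfold boundaryTrack
    split
    · rename_i k t heq
      obtain ⟨rfl, h2⟩ := H.arcPt_eq_some_iff.1 heq
      rw [he.stop_eq, glue_eq, h2]
    · rename_i heq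
      rw [H.cplate_eq_pt]
      rintro k rfl ⟨t, ht⟩
      rw [← ht, arcPt_arc] at heq
      cases heq

theorem radial_one (x : H.Collapsed) : radial x 1 = x := by
  induction x using H.collapsed_cases with
  | pt => rfl
  | beam b z t => rfl
  | plate p w s =>
    change H.cplate p (Disc.lerp _ w 1, s) = _
    rw [Disc.lerp_one]

/-- `track` as a path. -/
noncomputable def trackPath (x : H.Collapsed) : Path H.pt (radial x 0) :=
  ⟨⟨track he x, H.continuous_track he x⟩, H.track_zero he x, H.track_one he x⟩

/-- `radial` as a path. -/
noncomputable def radialPath (x : H.Collapsed) : Path (radial x 0) x :=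
  ⟨⟨radial x, H.continuous_radial x⟩, rfl, H.radial_one x⟩

/-- The class of the path along a beam and then radially inwards to a given point. -/
noncomputable def trackClass (x : H.Collapsed) : Path.Homotopic.Quotient H.pt x :=
  (Path.Homotopic.Quotient.mk (H.trackPath he x)).trans (.mk (H.radialPath x))

variable {H} in
/-- The centres of the plates. -/
def IsCentre (x : H.Collapsed) : Prop :=
  collapsedLift (fun _ _ => False) (fun _ q => (q.1 : ℂ) = 0) False
    (fun k s t => by simp [circleToDisc]) (fun _ _ _ _ => rfl)
    (fun p z s hz => by simp [circleToDisc]) x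

theorem isCentre_cplate {p : P} {w : Disc} {s : I} :
    IsCentre (H.cplate p (w, s)) ↔ (w : ℂ) = 0 := Iff.rfl

theorem not_isCentre_cbeam {b : B} {x : Disc × I} : ¬ IsCentre (H.cbeam b x) := id

theorem continuousOn_radial {O : Set H.Collapsed} (hO : IsOpen O) (hc : ∀ x ∈ O, ¬ IsCentre x) :
    ContinuousOn (fun q : H.Collapsed × I => radial q.1 q.2) (O ×ˢ univ) := by
  refine H.continuousOn_collapsed_prod H.continuous_radial hO (fun b => ?_) fun p => ?_
  · exact ((H.continuous_cbeam b).comp continuous_fst).continuousOn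
  · refine (H.continuous_cplate p).comp_continuousOn (ContinuousOn.prodMk ?_ (by fun_prop))
    refine Disc.continuous_lerp.comp_continuousOn (f := fun q : (Disc × I) × I =>
      (circleToDisc (Disc.dir q.1.1), q.1.1, q.2)) (ContinuousOn.prodMk ?_ (by fun_prop))
    refine continuous_circleToDisc.comp_continuousOn ?_
    exact Disc.continuousOn_dir.comp (by fun_prop) fun q hq => hc _ hq.1

/-- The track has to be jointly continuous only at the heights `T` that occur over `O`. Centres are
excluded because the direction is discontinuous there; on a plate everything depends on direction
and height, and is tested arc by arc. -/
theorem continuousOn_track [Finite K] {T : Set I}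
    (hT : ContinuousOn (fun q : I × I => e q.1 q.2) (T ×ˢ univ))
    {O : Set H.Collapsed} (hO : IsOpen O) (hc : ∀ x ∈ O, ¬ IsCentre x)
    (hb : ∀ b z t, H.cbeam b (z, t) ∈ O → t ∈ T)
    (hp : ∀ p w s k t, H.cplate p (w, s) ∈ O → H.arcPt p (Disc.dir w) = some (k, t) → t ∈ T) :
    ContinuousOn (fun q : H.Collapsed × I => track he q.1 q.2) (O ×ˢ univ) := by
  refine H.continuousOn_collapsed_prod (H.continuous_track he) hO (fun b => ?_) fun p => ?_
  · refine (H.continuous_cbeam b).comp_continuousOn (ContinuousOn.prodMk (by fun_prop) ?_)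
    exact hT.comp (f := fun q : (Disc × I) × I => (q.1.2, q.2)) (by fun_prop)
      fun q hq => ⟨hb _ _ _ hq.1, mem_univ _⟩
  · let S : Set Circle := {u | ∀ k t, H.arcPt p u = some (k, t) → t ∈ T}
    have key : ContinuousOn (fun q : Circle × (I × I) =>
        boundaryTrack (H := H) e p q.1 q.2.1 q.2.2) (S ×ˢ univ) := by
      refine continuousOn_of_arcs (fun k : {k // H.plateOf k = p} => H.plateArc k)
        (fun k => H.continuous_plateArc k) (fun k => H.injective_plateArc k) H.pt ?_ ?_
      · intro u a h
        exact H.boundaryTrack_eq_pt he (fun k hk => h ⟨k, hk⟩) _ _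
      · rintro ⟨k, rfl⟩
        simp only [boundaryTrack_arc]
        refine (H.continuous_cbeam _).comp_continuousOn (ContinuousOn.prodMk ?_ ?_)
        · exact (continuous_circleToDisc.comp ((H.continuous_beamArc k).comp
            (by fun_prop))).continuousOn
        · exact hT.comp (f := fun q : I × (I × I) => (q.1, q.2.2)) (by fun_prop)
            fun q hq => ⟨hq.1 _ _ (H.arcPt_arc k q.1), mem_univ _⟩
    refine key.comp (f := fun q : (Disc × I) × I => (Disc.dir q.1.1, (q.1.2, q.2))) ?_ ?_
    · refine ContinuousOn.prodMk ?_ (by fun_prop)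
      exact Disc.continuousOn_dir.comp (by fun_prop) fun q hq => hc _ hq.1
    · rintro ⟨⟨w, s⟩, τ⟩ hq
      exact ⟨fun k t h => hp p w s k t hq.1 h, mem_univ _⟩

theorem trackClass_trans {O : Set H.Collapsed} (hO : IsOpen O) (hc : ∀ x ∈ O, ¬ IsCentre x)
    (ht : ContinuousOn (fun q : H.Collapsed × I => track he q.1 q.2) (O ×ˢ univ))
    {x y : H.Collapsed} (γ : Path x y) (hγ : ∀ t, γ t ∈ O) :
    (H.trackClass he x).trans (.mk γ) = H.trackClass he y :=
  mk_trans_of_two_stages (H.continuousOn_radial hO hc) ht H.radial_one (H.track_one he)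
    (H.track_zero he) γ hγ (H.radialPath x) (H.radialPath y) (H.trackPath he x) (H.trackPath he y)
    (fun _ => rfl) (fun _ => rfl) (fun _ => rfl) (fun _ => rfl)

end Track

end HandleStructure

namespace HandleStructure

/-! ### The charts -/

/-- The midpoint of the unit interval. -/
noncomputable def midpt : I := ⟨1 / 2, by norm_num, by norm_num⟩

open Classical in
/-- The path to `t` from the nearest end point of the interval. -/
noncomputable def nearTrack (t τ : I) : I :=
  if t ≤ midpt then τ * t else unitInterval.symm (τ * unitInterval.symm t)

open Classical in
/-- The path from `0` to `t`, for `t < 1`. -/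
noncomputable def lowTrack (t τ : I) : I := if t < 1 then τ * t else 1

theorem midpt_lt_one : midpt < 1 := Subtype.coe_lt_coe.1 (by norm_num [midpt])

theorem midpt_pos : 0 < midpt := Subtype.coe_lt_coe.1 (by norm_num [midpt])

theorem isTrack_nearTrack : IsTrack nearTrack where
  continuous t := by
    unfold nearTrack
    split_ifs <;> fun_prop
  start t := by
    unfold nearTrack
    split_ifs
    · left; simp
    · right; simp
  stop_eq t := by
    unfold nearTrack
    split_ifs <;> simp
  bot τ := by
    left
    simp [nearTrack, midpt_pos.le]
  top τ := by
    right
    simp [nearTrack, midpt_lt_one.not_ge]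

theorem isTrack_lowTrack : IsTrack lowTrack where
  continuous t := by
    unfold lowTrack
    split_ifs <;> fun_prop
  start t := by
    unfold lowTrack
    split_ifs
    · left; simp
    · right; rfl
  stop_eq t := by
    unfold lowTrack
    split_ifs with h
    · simp
    · exact (unitInterval.le_one' (t := t)).eq_of_not_lt h |>.symm
  bot τ := by
    left
    simp [lowTrack]
  -- This is the reason for the separate value of `lowTrack` at `t = 1`: the path from 0 to 1 would
  -- not stay at the ends.
  top τ := by
    right
    simp [lowTrack]

theorem continuousOn_nearTrack :
    ContinuousOn (fun q : I × I => nearTrack q.1 q.2) ({midpt}ᶜ ×ˢ univ) := by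
  rintro ⟨t, τ⟩ ⟨ht, -⟩
  refine ContinuousAt.continuousWithinAt ?_
  rcases lt_or_gt_of_ne ht with h | h
  · have : ContinuousAt (fun q : I × I => q.2 * q.1) (t, τ) := by fun_prop
    refine this.congr ?_
    filter_upwards [(isOpen_Iio.preimage continuous_fst).mem_nhds h] with q hq
    exact (if_pos (le_of_lt hq)).symm
  · have : ContinuousAt (fun q : I × I => unitInterval.symm (q.2 * unitInterval.symm q.1))
      (t, τ) := by fun_prop
    refine this.congr ?_
    filter_upwards [(isOpen_Ioi.preimage continuous_fst).mem_nhds h] with q hq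
    exact (if_neg (not_le_of_gt hq)).symm

theorem continuousOn_lowTrack :
    ContinuousOn (fun q : I × I => lowTrack q.1 q.2) (Ioo 0 1 ×ˢ univ) := by
  have : Continuous (fun q : I × I => q.2 * q.1) := by fun_prop
  refine this.continuousOn.congr ?_
  rintro ⟨t, τ⟩ ⟨ht, -⟩
  exact if_pos ht.2

variable {B P K : Type*} (H : HandleStructure B P K)

open Classical in
variable {H} in
/-- The beam and the height of the points that lie strictly between the ends of the beams or
radially inwards from such a point on a plate. -/
noncomputable def height (x : H.Collapsed) : Option (B × I) :=
  let ins : B → I → Option (B × I) := fun b t => if t ∈ Ioo 0 1 then some (b, t) else none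
  collapsedLift (fun b q => ins b q.2)
    (fun p q => (H.arcPt p (Disc.dir q.1)).elim none fun a => ins (H.beamOf a.1) a.2) none
    (fun k s t => by simp only [Disc.dir_circleToDisc, arcPt_arc, Option.elim])
    (fun b z t ht => if_neg (by rcases ht with rfl | rfl <;> simp))
    (fun p z s hz => by simp only [Disc.dir_circleToDisc, H.arcPt_eq_none hz, Option.elim]) x

theorem height_cbeam {b : B} {z : Disc} {t : I} {a : B × I} :
    height (H.cbeam b (z, t)) = some a ↔ t ∈ Ioo 0 1 ∧ a = (b, t) := by
  change ite _ _ _ = _ ↔ _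
  split_ifs with h
  · rw [Option.some_inj]
    exact ⟨fun e => ⟨h, e.symm⟩, fun e => e.2.symm⟩
  · simp [h]

theorem height_cplate {p : P} {w : Disc} {s : I} {a : B × I} :
    height (H.cplate p (w, s)) = some a ↔
      ∃ k, H.arcPt p (Disc.dir w) = some (k, a.2) ∧ a.2 ∈ Ioo 0 1 ∧ H.beamOf k = a.1 := by
  change (H.arcPt p (Disc.dir w)).elim none _ = _ ↔ _
  cases h : H.arcPt p (Disc.dir w) with
  | none => simp
  | some q =>
    obtain ⟨k, t⟩ := q
    obtain ⟨b, t'⟩ := a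
    simp only [Option.elim]
    split_ifs with ht
    · simp only [Option.some_inj, Prod.mk.injEq]
      constructor
      · rintro ⟨rfl, rfl⟩; exact ⟨k, ⟨rfl, rfl⟩, ht, rfl⟩
      · rintro ⟨k', ⟨rfl, rfl⟩, -, rfl⟩; exact ⟨rfl, rfl⟩
    · simp only [Option.some_inj, Prod.mk.injEq, false_iff, not_exists, not_and]
      rintro k' ⟨-, rfl⟩ h'
      exact absurd h' ht

theorem height_mem_Ioo {x : H.Collapsed} {a : B × I} (h : height x = some a) : a.2 ∈ Ioo 0 1 := by
  induction x using H.collapsed_cases with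
  | pt => cases h
  | beam b z t =>
    obtain ⟨h1, rfl⟩ := H.height_cbeam.1 h
    exact h1
  | plate p w s =>
    obtain ⟨k, -, h, -⟩ := H.height_cplate.1 h
    exact h

/-- All tracks of a point run in one segment `{z} × I` of a beam, so different tracks can be
compared inside an interval. -/
theorem track_of_height {x : H.Collapsed} {a : B × I} (h : height x = some a) :
    ∃ z, ∀ {e : I → I → I} (he : IsTrack e) τ, track he x τ = H.cbeam a.1 (z, e a.2 τ) := by
  induction x using H.collapsed_cases with
  | pt => cases h
  | beam b z t =>
    obtain ⟨h1, rfl⟩ := H.height_cbeam.1 h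
    exact ⟨z, fun _ _ => rfl⟩
  | plate p w s =>
    obtain ⟨k, h1, -, h2⟩ := H.height_cplate.1 h
    refine ⟨circleToDisc (H.beamArc k s), fun he τ => ?_⟩
    change boundaryTrack _ p (Disc.dir w) s τ = _
    simp only [boundaryTrack, h1, h2]

theorem isOpen_dir_preimage {S : Set Circle} (hS : IsOpen S) :
    IsOpen {q : Disc × I | (q.1 : ℂ) ≠ 0 ∧ Disc.dir q.1 ∈ S} := by
  have h : IsOpen {w : Disc | (w : ℂ) ≠ 0} := isOpen_ne_fun (by fun_prop) (by fun_prop)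
  exact (Disc.continuousOn_dir.isOpen_inter_preimage h hS).preimage continuous_fst

/-- On a plate the set consists of the rays through the images of `O` in the strips, and these
images are open in the circle because `O` avoids the ends of the interval. -/
theorem isOpen_height_mem (b : B) {O : Set I} (hO : IsOpen O) (hO' : O ⊆ Ioo 0 1) :
    IsOpen {x : H.Collapsed | ¬ IsCentre x ∧ ∃ t ∈ O, height x = some (b, t)} := by
  rw [isOpen_collapsed_iff]
  constructor
  · intro b'
    by_cases hb : b' = b
    · subst hb
      convert hO.preimage (continuous_snd : Continuous (Prod.snd : Disc × I → I)) using 1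
      ext ⟨z, t⟩
      simp only [mem_preimage, mem_ofPred_eq, height_cbeam, Prod.mk.injEq, true_and,
        H.not_isCentre_cbeam, not_false_eq_true]
      exact ⟨fun ⟨t', h, _, e⟩ => e ▸ h, fun h => ⟨t, h, hO' h, rfl⟩⟩
    · convert isOpen_empty using 1
      ext ⟨z, t⟩
      simp only [mem_preimage, mem_ofPred_eq, height_cbeam, Prod.mk.injEq, mem_empty_iff_false,
        iff_false]
      rintro ⟨-, t', -, -, e, -⟩
      exact hb e.symm
  · intro p
    have hS : IsOpen (⋃ k : {k // H.plateOf k = p ∧ H.beamOf k = b}, H.plateArc k '' O) :=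
      isOpen_iUnion fun k => isOpen_image_arc (H.continuous_plateArc k) (H.injective_plateArc k)
        hO hO'
    convert isOpen_dir_preimage hS using 1
    ext ⟨w, s⟩
    simp only [mem_preimage, mem_ofPred_eq, isCentre_cplate, height_cplate, mem_iUnion, ne_eq,
      arcPt_eq_some_iff]
    refine and_congr_right fun _ => ⟨?_, ?_⟩
    · rintro ⟨t, ht, k, ⟨h1, h2⟩, -, h3⟩
      exact ⟨⟨k, h1, h3⟩, t, ht, h2⟩
    · rintro ⟨⟨k, h1, h3⟩, t, ht, h2⟩
      exact ⟨t, ht, k, ⟨h1, h2⟩, hO' ht, h3⟩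

/-- The charts of the collapsed space: `near` is a neighbourhood of the collapsed sticky end,
`mid` is a neighbourhood of the middle parts of the beams, and `plate` consists of the interiors
of the plates. -/
inductive Chart
  | near
  | mid
  | plate

theorem norm_circleToDisc (z : Circle) : ‖(circleToDisc z : ℂ)‖ = 1 := Circle.norm_coe z

open Classical in
variable {H} in
/-- The coordinates of the points in the interiors of the plates. -/
noncomputable def plateCoord (x : H.Collapsed) : Option (P × Disc × I) :=
  collapsedLift (fun _ _ => none)
    (fun p q => if ‖(q.1 : ℂ)‖ < 1 then some (p, q) else none) none
    (fun _ _ _ => (if_neg (norm_circleToDisc _).not_lt).symm)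
    (fun _ _ _ _ => rfl) (fun _ _ _ _ => if_neg (norm_circleToDisc _).not_lt) x

theorem plateCoord_cplate {p : P} {q : Disc × I} (h : ‖(q.1 : ℂ)‖ < 1) :
    plateCoord (H.cplate p q) = some (p, q) := if_pos h

theorem plateCoord_eq_some_iff {x : H.Collapsed} {a : P × Disc × I} :
    plateCoord x = some a ↔ ‖(a.2.1 : ℂ)‖ < 1 ∧ x = H.cplate a.1 a.2 := by
  constructor
  · intro h
    induction x using H.collapsed_cases with
    | pt => cases h
    | beam b z t => cases h
    | plate p w s =>
      change ite _ _ _ = _ at h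
      split_ifs at h with hw
      cases h
      exact ⟨hw, rfl⟩
  · rintro ⟨h, rfl⟩
    exact H.plateCoord_cplate h

/-- The domains of the charts. -/
def domain : Chart → Set H.Collapsed
  | .near => {x | ¬ IsCentre x ∧ ∀ b, height x ≠ some (b, midpt)}
  | .mid => {x | ¬ IsCentre x ∧ ∃ a, height x = some a}
  | .plate => {x | ∃ a, plateCoord x = some a}

/-- On a plate, the middle level of the beams removes the rays through the midpoints of the strips;
finitely many such rays form a closed set off the centre. -/
theorem isOpen_domain_near [Finite K] : IsOpen (H.domain .near) := by
  rw [isOpen_collapsed_iff]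
  constructor
  · intro b
    convert (isOpen_compl_singleton (x := midpt)).preimage
      (continuous_snd : Continuous (Prod.snd : Disc × I → I)) using 1
    ext ⟨z, t⟩
    simp only [domain, mem_preimage, mem_ofPred_eq, ne_eq, height_cbeam, H.not_isCentre_cbeam,
      not_false_eq_true, true_and, Prod.mk.injEq, not_and, mem_compl_iff, mem_singleton_iff]
    constructor
    · rintro h rfl
      exact h b ⟨midpt_pos, midpt_lt_one⟩ rfl rfl
    · rintro h b' - - rfl
      exact h rfl
  · intro p
    have hS : IsOpen (⋃ k : {k // H.plateOf k = p}, {H.plateArc k midpt})ᶜ :=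
      (isClosed_iUnion_of_finite fun k => isClosed_singleton).isOpen_compl
    convert isOpen_dir_preimage hS using 1
    ext ⟨w, s⟩
    simp only [domain, mem_preimage, mem_ofPred_eq, isCentre_cplate, height_cplate, mem_iUnion,
      ne_eq, arcPt_eq_some_iff, mem_compl_iff, mem_singleton_iff, not_exists]
    refine and_congr_right fun _ => ⟨?_, ?_⟩
    · rintro h ⟨k, hk⟩ h1
      exact h (H.beamOf k) k ⟨⟨hk, h1.symm⟩, ⟨midpt_pos, midpt_lt_one⟩, rfl⟩
    · rintro h b k ⟨⟨h1, h2⟩, -⟩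
      exact h ⟨k, h1⟩ h2.symm

theorem isOpen_domain_mid : IsOpen (H.domain .mid) := by
  convert isOpen_iUnion fun b => H.isOpen_height_mem b isOpen_Ioo subset_rfl using 1
  ext x
  simp only [domain, mem_ofPred_eq, Prod.exists, mem_iUnion, exists_and_left]
  refine and_congr_right fun _ => exists_congr fun b => exists_congr fun t => ?_
  exact ⟨fun h => ⟨H.height_mem_Ioo h, h⟩, fun h => h.2⟩

theorem isOpen_domain_plate : IsOpen (H.domain .plate) := by
  rw [isOpen_collapsed_iff]
  constructor
  · intro b
    convert isOpen_empty using 1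
    ext ⟨z, t⟩
    simp only [domain, mem_preimage, mem_ofPred_eq, mem_empty_iff_false, iff_false]
    rintro ⟨a, h⟩
    cases h
  · intro p
    have : IsOpen {q : Disc × I | ‖(q.1 : ℂ)‖ < 1} := isOpen_lt (by fun_prop) (by fun_prop)
    convert this using 1
    ext q
    simp only [domain, mem_preimage, mem_ofPred_eq]
    constructor
    · rintro ⟨a, h⟩
      change ite _ _ _ = _ at h
      split_ifs at h with hq
      exact hq
    · intro h
      exact ⟨_, H.plateCoord_cplate h⟩

theorem isOpen_domain [Finite K] (c : Chart) : IsOpen (H.domain c) := by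
  cases c
  exacts [H.isOpen_domain_near, H.isOpen_domain_mid, H.isOpen_domain_plate]

theorem mem_near_or_mid {x : H.Collapsed} (h : ¬ IsCentre x) :
    x ∈ H.domain .near ∨ x ∈ H.domain .mid := by
  by_cases hb : ∃ b, height x = some (b, midpt)
  · obtain ⟨b, hb⟩ := hb
    exact Or.inr ⟨h, _, hb⟩
  · exact Or.inl ⟨h, fun b e => hb ⟨b, e⟩⟩

theorem exists_mem_domain (x : H.Collapsed) : ∃ c, x ∈ H.domain c := by
  by_cases h : IsCentre x
  · refine ⟨.plate, ?_⟩
    induction x using H.collapsed_cases with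
    | pt => exact h.elim
    | beam b z t => exact h.elim
    | plate p w s =>
      have hw : (w : ℂ) = 0 := h
      exact ⟨_, H.plateCoord_cplate (by simp [hw])⟩
  · rcases H.mem_near_or_mid h with h | h
    exacts [⟨_, h⟩, ⟨_, h⟩]

theorem pt_notMem_mid : H.pt ∉ H.domain .mid := fun ⟨_, _, h⟩ => by cases h

theorem pt_notMem_plate : H.pt ∉ H.domain .plate := fun ⟨_, h⟩ => by cases h

/-! ### Flat families of paths over the charts -/

section Paths

variable (β : P → Circle)

variable {H} in
/-- The straight path in a plate from a given point of the boundary. -/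
noncomputable def straight (x : H.Collapsed) (τ : I) : H.Collapsed :=
  (plateCoord x).elim H.pt fun a =>
    H.cplate a.1 (Disc.lerp (circleToDisc (β a.1)) a.2.1 τ, a.2.2)

theorem continuous_straight (x : H.Collapsed) : Continuous (straight β x) := by
  unfold straight
  cases plateCoord x with
  | none => exact continuous_const
  | some a =>
    exact (H.continuous_cplate a.1).comp ((Disc.continuous_lerp.comp (f := fun τ : I =>
      (circleToDisc (β a.1), a.2.1, τ)) (by fun_prop)).prodMk continuous_const)

theorem straight_zero (hβ : ∀ k, β (H.plateOf k) ∉ range (H.plateArc k)) (x : H.Collapsed) :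
    straight β x 0 = H.pt := by
  unfold straight
  cases plateCoord x with
  | none => rfl
  | some a =>
    simp only [Option.elim, Disc.lerp_zero]
    exact H.cplate_eq_pt (fun k hk => hk ▸ hβ k) _

theorem straight_one {x : H.Collapsed} (hx : x ∈ H.domain .plate) : straight β x 1 = x := by
  obtain ⟨a, ha⟩ := hx
  simp only [straight, ha, Option.elim, Disc.lerp_one]
  exact (H.plateCoord_eq_some_iff.1 ha).2.symm

theorem continuousOn_straight :
    ContinuousOn (fun q : H.Collapsed × I => straight β q.1 q.2) (H.domain .plate ×ˢ univ) := by
  refine H.continuousOn_collapsed_prod (H.continuous_straight β) H.isOpen_domain_plate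
    (fun b => ?_) fun p => ?_
  · rintro ⟨x, τ⟩ ⟨⟨a, h⟩, -⟩
    cases h
  · have : Continuous fun q : (Disc × I) × I =>
        H.cplate p (Disc.lerp (circleToDisc (β p)) q.1.1 q.2, q.1.2) :=
      (H.continuous_cplate p).comp ((Disc.continuous_lerp.comp (f := fun q : (Disc × I) × I =>
        (circleToDisc (β p), q.1.1, q.2)) (by fun_prop)).prodMk (by fun_prop))
    refine this.continuousOn.congr ?_
    rintro ⟨q, τ⟩ ⟨⟨a, h⟩, -⟩
    obtain ⟨hn, e⟩ := H.plateCoord_eq_some_iff.1 h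
    have hq : ‖(q.1 : ℂ)‖ < 1 := by
      by_contra hq
      exact absurd h (by simp [show plateCoord (H.cplate p q) = none from if_neg hq])
    simp only [straight, H.plateCoord_cplate hq, Option.elim]

variable (hβ : ∀ k, β (H.plateOf k) ∉ range (H.plateArc k))

/-- `straight` as a path. -/
noncomputable def straightPath (x : H.Collapsed) (hx : x ∈ H.domain .plate) : Path H.pt x :=
  ⟨⟨straight β x, H.continuous_straight β x⟩, H.straight_zero β hβ x, H.straight_one β hx⟩

/-- The flat families of classes of paths over the charts. -/
noncomputable def flatClass : (c : Chart) → (x : H.Collapsed) → x ∈ H.domain c →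
    Path.Homotopic.Quotient H.pt x
  | .near, x, _ => H.trackClass isTrack_nearTrack x
  | .mid, x, _ => H.trackClass isTrack_lowTrack x
  | .plate, x, hx => .mk (H.straightPath β hβ x hx)

/-- A family of paths that is continuous over a chart sweeps out a homotopy along each path in the
chart. The tracks are discontinuous only where the chart is cut: `nearTrack` at the middle level,
`lowTrack` at the upper end. The straight paths are continuous even at the centres of the plates. -/
theorem flatClass_trans [Finite K] (c : Chart) {x y : H.Collapsed} (γ : Path x y)
    (hγ : ∀ t, γ t ∈ H.domain c) (hx : x ∈ H.domain c) (hy : y ∈ H.domain c) :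
    (H.flatClass β hβ c x hx).trans (.mk γ) = H.flatClass β hβ c y hy := by
  cases c with
  | near =>
    refine H.trackClass_trans isTrack_nearTrack (H.isOpen_domain .near) (fun x hx => hx.1) ?_ γ hγ
    refine H.continuousOn_track _ continuousOn_nearTrack (H.isOpen_domain .near)
      (fun x hx => hx.1) ?_ ?_
    · rintro b z t h rfl
      exact h.2 b (H.height_cbeam.2 ⟨⟨midpt_pos, midpt_lt_one⟩, rfl⟩)
    · rintro p w s k t h h' rfl
      exact h.2 (H.beamOf k) (H.height_cplate.2 ⟨k, h', ⟨midpt_pos, midpt_lt_one⟩, rfl⟩)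
  | mid =>
    refine H.trackClass_trans isTrack_lowTrack (H.isOpen_domain .mid) (fun x hx => hx.1) ?_ γ hγ
    refine H.continuousOn_track _ continuousOn_lowTrack (H.isOpen_domain .mid)
      (fun x hx => hx.1) ?_ ?_
    · rintro b z t ⟨-, a, h⟩
      exact (H.height_cbeam.1 h).1
    · rintro p w s k t ⟨-, a, h⟩ h'
      obtain ⟨k', h1, h2, -⟩ := H.height_cplate.1 h
      rw [h'] at h1
      cases h1
      exact h2
  | plate =>
    have hs : Continuous fun q : I × I => straight β (γ q.1) q.2 :=
      (H.continuousOn_straight β).comp_continuous (f := fun q : I × I => (γ q.1, q.2))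
        (by fun_prop) fun q => ⟨hγ _, mem_univ _⟩
    have := mk_trans_eq_of_square hs (H.straightPath β hβ x hx) γ (Path.refl _)
      (H.straightPath β hβ y hy) (fun t => by simp [straightPath])
      (fun t => by simp [H.straight_one β (hγ t)]) (fun t => by simp [H.straight_zero β hβ])
      (fun t => by simp [straightPath])
    rw [flatClass, this, Path.Homotopic.Quotient.mk_refl, Path.Homotopic.Quotient.refl_trans,
      flatClass]

theorem pathConnectedSpace_collapsed [Finite K]
    (hβ : ∀ k, β (H.plateOf k) ∉ range (H.plateArc k)) : PathConnectedSpace H.Collapsed := by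
  have : ∀ x : H.Collapsed, Joined H.pt x := by
    intro x
    obtain ⟨c, hc⟩ := H.exists_mem_domain x
    obtain ⟨p, -⟩ := Path.Homotopic.Quotient.mk_surjective (H.flatClass β hβ c x hc)
    exact ⟨p⟩
  exact ⟨⟨H.pt⟩, fun x y => (this x).symm.trans (this y)⟩

end Paths

/-! ### Comparison of the flat families -/

/-- The core of a beam, as a loop in the collapsed space. -/
noncomputable def coreLoop (b : B) : Path H.pt H.pt :=
  ⟨⟨fun t => H.cbeam b (Disc.centre, t),
    (H.continuous_cbeam b).comp (continuous_const.prodMk continuous_id)⟩,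
    H.cbeam_eq_pt _ _ (Or.inl rfl), H.cbeam_eq_pt _ _ (Or.inr rfl)⟩

/-- The homomorphism from the free group on the beams that maps a generator to the inverse of
the core of the beam. (Products in the fundamental group are taken from right to left.) -/
noncomputable def coreHom : FreeGroup B →* FundamentalGroup H.Collapsed H.pt :=
  FreeGroup.lift fun b => (FundamentalGroup.fromPath (.mk (H.coreLoop b)))⁻¹

open Classical in
variable {H} in
/-- The generator of the beam at the points in the upper half of the middle part of a beam. -/
noncomputable def midWord (x : H.Collapsed) : FreeGroup B :=
  (height x).elim 1 fun a => if midpt < a.2 then .of a.1 else 1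

variable {H} in
/-- The holonomies of the flat families on the beams. -/
noncomputable def chartWord : Chart → H.Collapsed → FreeGroup B
  | .mid, x => midWord x
  | _, _ => 1

/-- In the segment `{z} × I`, climbing to `t` from 0 is climbing all the way to 1 and descending to
`t`. The full segment is homotopic to the core, since moving `z` to the centre keeps its ends in the
collapsed islands. -/
theorem trackClass_low_eq (x : H.Collapsed) {b : B} {t : I} (h : height x = some (b, t))
    (ht : midpt < t) : H.trackClass isTrack_lowTrack x =
      (Path.Homotopic.Quotient.mk (H.coreLoop b)).trans (H.trackClass isTrack_nearTrack x) := by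
  obtain ⟨z, hz⟩ := H.track_of_height h
  have ht1 : t < 1 := (H.height_mem_Ioo h).2
  let c : Path H.pt H.pt :=
    ⟨⟨fun t => H.cbeam b (z, t),
      (H.continuous_cbeam b).comp (continuous_const.prodMk continuous_id)⟩,
      H.cbeam_eq_pt _ _ (Or.inl rfl), H.cbeam_eq_pt _ _ (Or.inr rfl)⟩
  have hc : Path.Homotopic.Quotient.mk c = .mk (H.coreLoop b) := by
    have hK : Continuous fun q : I × I => H.cbeam b (Disc.lerp z Disc.centre q.1, q.2) :=
      (H.continuous_cbeam b).comp ((Disc.continuous_lerp.comp (f := fun q : I × I =>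
        (z, Disc.centre, q.1)) (by fun_prop)).prodMk continuous_snd)
    have := mk_trans_eq_of_square hK c (Path.refl _) (Path.refl _) (H.coreLoop b)
      (fun t => by rw [Disc.lerp_zero]; rfl) (fun t => (H.cbeam_eq_pt _ _ (Or.inr rfl)).symm)
      (fun t => (H.cbeam_eq_pt _ _ (Or.inl rfl)).symm) (fun t => by rw [Disc.lerp_one]; rfl)
    simpa using this
  have hF : Continuous fun t => H.cbeam b (z, t) := c.continuous
  have key := mk_trans_eq_of_factor hF c (H.trackPath isTrack_nearTrack x)
    (H.trackPath isTrack_lowTrack x) (a' := id) (b' := nearTrack t) (c' := lowTrack t)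
    continuous_id (isTrack_nearTrack.continuous t) (isTrack_lowTrack.continuous t)
    (fun _ => rfl) (fun τ => hz isTrack_nearTrack τ) (fun τ => hz isTrack_lowTrack τ)
    (by simp [lowTrack, ht1]) (by simp [nearTrack, ht.not_ge])
    (by rw [isTrack_lowTrack.stop_eq, isTrack_nearTrack.stop_eq])
  rw [trackClass, ← key, hc, trackClass, Path.Homotopic.Quotient.trans_assoc]

theorem trackClass_low_eq_near (x : H.Collapsed) {b : B} {t : I} (h : height x = some (b, t))
    (ht : t < midpt) :
    H.trackClass isTrack_lowTrack x = H.trackClass isTrack_nearTrack x := by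
  obtain ⟨z, hz⟩ := H.track_of_height h
  have ht1 : t < 1 := (H.height_mem_Ioo h).2
  have : H.trackPath isTrack_lowTrack x = H.trackPath isTrack_nearTrack x := by
    ext τ
    change track isTrack_lowTrack x τ = track isTrack_nearTrack x τ
    rw [hz, hz]
    simp [lowTrack, nearTrack, ht1, ht.le]
  rw [trackClass, this, trackClass]

theorem pathDiff_near_mid {x : H.Collapsed} (hn : x ∈ H.domain .near) (hm : x ∈ H.domain .mid) :
    pathDiff (H.trackClass isTrack_lowTrack x) (H.trackClass isTrack_nearTrack x) =
      H.coreHom (midWord x)⁻¹ := by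
  obtain ⟨-, ⟨b, t⟩, h⟩ := hm
  have hne : t ≠ midpt := by
    rintro rfl
    exact hn.2 b h
  rcases lt_or_gt_of_ne hne with ht | ht
  · rw [H.trackClass_low_eq_near x h ht, pathDiff_self]
    simp [midWord, h, ht.not_gt]
  · rw [H.trackClass_low_eq x h ht]
    simp only [midWord, h, Option.elim, ht, if_true, coreHom, map_inv, FreeGroup.lift_apply_of,
      inv_inv]
    change (Path.Homotopic.Quotient.trans _ _).trans _ = _
    rw [Path.Homotopic.Quotient.trans_assoc, Path.Homotopic.Quotient.trans_symm,
      Path.Homotopic.Quotient.trans_refl]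

theorem eventually_midWord_eq [Finite K] {x : H.Collapsed} (hn : x ∈ H.domain .near)
    (hm : x ∈ H.domain .mid) : ∀ᶠ y in 𝓝 x, midWord y = midWord x := by
  obtain ⟨hx, ⟨b, t⟩, h⟩ := hm
  have hne : t ≠ midpt := by
    rintro rfl
    exact hn.2 b h
  have ht01 := H.height_mem_Ioo h
  rcases lt_or_gt_of_ne hne with ht | ht
  · have hO := H.isOpen_height_mem b (O := Ioo 0 midpt) isOpen_Ioo
      (Ioo_subset_Ioo_right midpt_lt_one.le)
    filter_upwards [hO.mem_nhds ⟨hx, t, ⟨ht01.1, ht⟩, h⟩] with y hy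
    obtain ⟨-, t', ht', h'⟩ := hy
    simp [midWord, h, h', ht.not_gt, ht'.2.not_gt]
  · have hO := H.isOpen_height_mem b (O := Ioo midpt 1) isOpen_Ioo
      (Ioo_subset_Ioo_left midpt_pos.le)
    filter_upwards [hO.mem_nhds ⟨hx, t, ⟨ht, ht01.2⟩, h⟩] with y hy
    obtain ⟨-, t', ht', h'⟩ := hy
    simp [midWord, h, h', ht, ht'.1]

section Comparison

variable (β : P → Circle) (hβ : ∀ k, β (H.plateOf k) ∉ range (H.plateArc k))

/-- The loop that runs out along the flat family of the second chart and back along that of the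
first one. -/
noncomputable def transition (c c' : Chart) (x : H.Collapsed) (hc : x ∈ H.domain c)
    (hc' : x ∈ H.domain c') : FundamentalGroup H.Collapsed H.pt :=
  pathDiff (H.flatClass β hβ c' x hc') (H.flatClass β hβ c x hc)

theorem transition_mul {c c' c'' : Chart} {x : H.Collapsed} (h : x ∈ H.domain c)
    (h' : x ∈ H.domain c') (h'' : x ∈ H.domain c'') :
    H.transition β hβ c c' x h h' * H.transition β hβ c' c'' x h' h'' =
      H.transition β hβ c c'' x h h'' :=
  pathDiff_mul _ _ _

theorem transition_inv {c c' : Chart} {x : H.Collapsed} (h : x ∈ H.domain c)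
    (h' : x ∈ H.domain c') :
    (H.transition β hβ c c' x h h')⁻¹ = H.transition β hβ c' c x h' h :=
  pathDiff_inv _ _

theorem transition_self {c : Chart} {x : H.Collapsed} (h : x ∈ H.domain c) :
    H.transition β hβ c c x h h = 1 :=
  pathDiff_self _

/-- Flatness extends both path classes by the same `γ`, which cancels in their difference. -/
theorem transition_eq_of_path [Finite K] {c c' : Chart} {x y : H.Collapsed} (γ : Path x y)
    (hγ : ∀ t, γ t ∈ H.domain c) (hγ' : ∀ t, γ t ∈ H.domain c') (hx : x ∈ H.domain c)
    (hx' : x ∈ H.domain c') (hy : y ∈ H.domain c) (hy' : y ∈ H.domain c') :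
    H.transition β hβ c c' x hx hx' = H.transition β hβ c c' y hy hy' := by
  unfold transition
  rw [← H.flatClass_trans β hβ c γ hγ hx hy, ← H.flatClass_trans β hβ c' γ hγ' hx' hy',
    pathDiff_trans]

theorem transition_eq_coreHom {c c' : Chart} (hc : c ≠ .plate) (hc' : c' ≠ .plate)
    {x : H.Collapsed} (h : x ∈ H.domain c) (h' : x ∈ H.domain c') :
    H.transition β hβ c c' x h h' = H.coreHom (chartWord c x * (chartWord c' x)⁻¹) := by
  have key := fun hn hm => H.pathDiff_near_mid (x := x) hn hm
  cases c <;> cases c' <;> first | contradiction | skip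
  · rw [transition_self]; simp
  · refine (key h h').trans ?_
    simp [chartWord]
  · rw [← transition_inv]
    refine (congrArg (·⁻¹) (key h' h)).trans ?_
    simp [chartWord]
  · rw [transition_self]; simp

/-- The point of a plate with given polar coordinates and height. -/
noncomputable def polar (p : P) (ρ s : I) (u : Circle) : H.Collapsed :=
  H.cplate p (Disc.lerp Disc.centre (circleToDisc u) ρ, s)

theorem continuous_polar (p : P) (ρ s : I) : Continuous (H.polar p ρ s) :=
  (H.continuous_cplate p).comp ((Disc.continuous_lerp.comp (f := fun u : Circle =>
    (Disc.centre, circleToDisc u, ρ)) (continuous_const.prodMk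
      (continuous_circleToDisc.prodMk continuous_const))).prodMk continuous_const)

theorem coe_lerp_centre (u : Circle) (ρ : I) :
    (Disc.lerp Disc.centre (circleToDisc u) ρ : ℂ) = (ρ : ℝ) * (u : ℂ) := by
  simp [Disc.lerp, Disc.centre, circleToDisc]

theorem dir_lerp_centre {ρ : I} (hρ : 0 < ρ) (u : Circle) :
    Disc.dir (Disc.lerp Disc.centre (circleToDisc u) ρ) = u :=
  Disc.dir_mul (ρ := ρ) hρ u _ (coe_lerp_centre u ρ)

theorem norm_lerp_centre (ρ : I) (u : Circle) :
    ‖(Disc.lerp Disc.centre (circleToDisc u) ρ : ℂ)‖ = ρ := by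
  rw [coe_lerp_centre]
  rw [norm_mul, Circle.norm_coe]
  simp [abs_of_nonneg ρ.2.1]

section

variable {p : P} {ρ s : I} (hρ : ρ ∈ Ioo 0 1) {u : Circle}

include hρ

theorem plateCoord_polar : plateCoord (H.polar p ρ s u) =
    some (p, Disc.lerp Disc.centre (circleToDisc u) ρ, s) := by
  refine H.plateCoord_cplate ?_
  rw [norm_lerp_centre]
  exact hρ.2

theorem polar_mem_plate : H.polar p ρ s u ∈ H.domain .plate := ⟨_, H.plateCoord_polar hρ⟩

theorem not_isCentre_polar : ¬ IsCentre (H.polar p ρ s u) := by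
  change ¬ (Disc.lerp Disc.centre (circleToDisc u) ρ : ℂ) = 0
  rw [← norm_eq_zero, norm_lerp_centre]
  exact (Subtype.coe_lt_coe.2 hρ.1).ne'

theorem height_polar {a : B × I} : height (H.polar p ρ s u) = some a ↔
    ∃ k, H.arcPt p u = some (k, a.2) ∧ a.2 ∈ Ioo 0 1 ∧ H.beamOf k = a.1 := by
  rw [polar, height_cplate, dir_lerp_centre hρ.1]

theorem polar_mem_near (h : ∀ k, H.plateOf k = p → u ∉ range (H.plateArc k)) :
    H.polar p ρ s u ∈ H.domain .near := by
  refine ⟨H.not_isCentre_polar hρ, fun b e => ?_⟩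
  obtain ⟨k, e, -⟩ := (H.height_polar hρ).1 e
  rw [H.arcPt_eq_none h] at e
  cases e

/-- In the base direction no strip is met, so the track is constant at `pt` and the radial path that
follows is the straight path itself. -/
theorem transition_plate_near_base {hn : H.polar p ρ s (β p) ∈ H.domain .near} :
    H.transition β hβ .plate .near (H.polar p ρ s (β p)) (H.polar_mem_plate hρ) hn = 1 := by
  have hp : ∀ k, H.plateOf k = p → β p ∉ range (H.plateArc k) := by
    rintro k rfl
    exact hβ k
  have hs : ∀ τ, straight β (H.polar p ρ s (β p)) τ =
      H.cplate p (Disc.lerp (circleToDisc (β p))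
        (Disc.lerp Disc.centre (circleToDisc (β p)) ρ) τ, s) := by
    intro τ
    simp only [straight, H.plateCoord_polar hρ, Option.elim]
  have key := mk_trans_eq_of_factor (H.continuous_straight β (H.polar p ρ s (β p)))
    (H.trackPath isTrack_nearTrack (H.polar p ρ s (β p))) (H.radialPath (H.polar p ρ s (β p)))
    (H.straightPath β hβ _ (H.polar_mem_plate hρ)) (a' := fun _ => 0) (b' := id) (c' := id)
    continuous_const continuous_id continuous_id ?_ ?_ (fun _ => rfl) rfl rfl rfl
  · change pathDiff ((Path.Homotopic.Quotient.mk _).trans (.mk _)) (.mk _) = 1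
    rw [key, pathDiff_self]
  · intro τ
    rw [H.straight_zero β hβ]
    change boundaryTrack _ p (Disc.dir _) s τ = _
    rw [dir_lerp_centre hρ.1]
    simp only [boundaryTrack, H.arcPt_eq_none hp]
  · intro τ
    rw [id, hs]
    change H.cplate p (Disc.lerp (circleToDisc (Disc.dir _)) _ τ, s) = _
    rw [dir_lerp_centre hρ.1]

/-- The holonomy around the boundary of a plate. -/
theorem transition_plate [Finite K] (W : ℝ → FreeGroup B) {R : FreeGroup B}
    (hW : ∀ c ≠ Chart.plate, ∀ θ ∈ Ioo 0 (2 * Real.pi),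
      H.polar p ρ s (β p * Circle.exp θ) ∈ H.domain c → ∀ᶠ θ' in 𝓝 θ,
        W θ' * (chartWord c (H.polar p ρ s (β p * Circle.exp θ')))⁻¹ =
        W θ * (chartWord c (H.polar p ρ s (β p * Circle.exp θ)))⁻¹)
    {m M : ℝ} (hm : 0 < m) (hmM : m ≤ M) (hM : M < 2 * Real.pi)
    (hm' : ∀ θ ∈ Icc 0 m, W θ = 1 ∧
      ∀ k, H.plateOf k = p → β p * Circle.exp θ ∉ range (H.plateArc k))
    (hM' : ∀ θ ∈ Icc M (2 * Real.pi), W θ = R ∧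
      ∀ k, H.plateOf k = p → β p * Circle.exp θ ∉ range (H.plateArc k)) :
    H.coreHom R = 1 ∧ ∀ c (_ : c ≠ Chart.plate), ∀ θ ∈ Icc 0 (2 * Real.pi),
      ∀ hc : H.polar p ρ s (β p * Circle.exp θ) ∈ H.domain c,
        H.transition β hβ .plate c _ (H.polar_mem_plate hρ) hc =
          H.coreHom (W θ * (chartWord c (H.polar p ρ s (β p * Circle.exp θ)))⁻¹) := by
  set x : ℝ → H.Collapsed := fun θ => H.polar p ρ s (β p * Circle.exp θ) with hx
  have hxc : Continuous x := (H.continuous_polar p ρ s).comp (by fun_prop)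
  have hxV : ∀ θ, x θ ∈ H.domain .plate := fun θ => H.polar_mem_plate hρ
  have segment {a b : ℝ} : ∃ γ : Path (x a) (x b), ∀ t, ∃ θ ∈ uIcc a b, γ t = x θ := by
    refine ⟨⟨⟨fun t => x (a + t * (b - a)), by fun_prop⟩, by simp, by simp⟩, fun t => ?_⟩
    refine ⟨_, ?_, rfl⟩
    have h0 := t.2.1
    have h1 := t.2.2
    rcases le_total a b with h | h
    · rw [uIcc_of_le h]
      constructor <;> nlinarith
    · rw [uIcc_of_ge h]
      constructor <;> nlinarith
  -- On an arc of directions that meets no strip and starts at the base direction, the transition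
  -- keeps its value 1.
  have near_one {a b : ℝ} (ha : x a = H.polar p ρ s (β p)) (hn : ∀ θ ∈ uIcc a b, ∀ k,
      H.plateOf k = p → β p * Circle.exp θ ∉ range (H.plateArc k)) (hb : x b ∈ H.domain .near) :
      H.transition β hβ .plate .near (x b) (hxV b) hb = 1 := by
    obtain ⟨γ, hγ⟩ := segment (a := a) (b := b)
    have h1 : ∀ t, γ t ∈ H.domain .plate := fun t => by
      obtain ⟨θ, -, e⟩ := hγ t
      exact e ▸ hxV θ
    have h2 : ∀ t, γ t ∈ H.domain .near := fun t => by
      obtain ⟨θ, hθ, e⟩ := hγ t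
      exact e ▸ H.polar_mem_near hρ (hn θ hθ)
    have han : x a ∈ H.domain .near := H.polar_mem_near hρ (hn a left_mem_uIcc)
    rw [← H.transition_eq_of_path β hβ γ h1 h2 (hxV a) han (hxV b) hb]
    have : ∀ y (hy : y = H.polar p ρ s (β p)) (h : y ∈ H.domain .plate) (h' : y ∈ H.domain .near),
        H.transition β hβ .plate .near y h h' = 1 := by
      rintro y rfl h h'
      exact H.transition_plate_near_base β hβ hρ
    exact this _ ha _ _
  have x0 : x 0 = H.polar p ρ s (β p) := by simp [x]
  have x1 : x (2 * Real.pi) = H.polar p ρ s (β p) := by simp [x]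
  have one_low (θ) (hθ : θ ∈ Icc 0 m) (h : x θ ∈ H.domain .near) :
      H.transition β hβ .plate .near (x θ) (hxV θ) h = 1 := by
    refine near_one x0 (fun θ' hθ' => (hm' θ' ?_).2) h
    rw [uIcc_of_le hθ.1] at hθ'
    exact ⟨hθ'.1, hθ'.2.trans hθ.2⟩
  have one_high (θ) (hθ : θ ∈ Icc M (2 * Real.pi)) (h : x θ ∈ H.domain .near) :
      H.transition β hβ .plate .near (x θ) (hxV θ) h = 1 := by
    refine near_one x1 (fun θ' hθ' => (hM' θ' ?_).2) h
    rw [uIcc_of_ge hθ.2] at hθ'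
    exact ⟨hθ.1.trans hθ'.1, hθ'.2⟩
  -- The formula is independent of the chart, holds near angle 0, and its truth is locally constant
  -- on `(0, 2π)` because both sides are locally constant there in a suitable chart. So it holds on
  -- the whole interval.
  let Fm (θ : ℝ) (c : Chart) (hc : x θ ∈ H.domain c) : Prop :=
    H.transition β hβ .plate c (x θ) (hxV θ) hc = H.coreHom (W θ * (chartWord c (x θ))⁻¹)
  have change_chart (θ) (c c' : Chart) (hc : c ≠ .plate) (hc' : c' ≠ .plate)
      (h : x θ ∈ H.domain c) (h' : x θ ∈ H.domain c') : Fm θ c h → Fm θ c' h' := by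
    intro hF
    simp only [Fm] at hF ⊢
    rw [← H.transition_mul β hβ (hxV θ) h h', hF, H.transition_eq_coreHom β hβ hc hc', ← map_mul]
    congr 1
    group
  have ex_chart (θ) : ∃ c, c ≠ Chart.plate ∧ x θ ∈ H.domain c := by
    rcases H.mem_near_or_mid (H.not_isCentre_polar hρ (p := p) (s := s)
      (u := β p * Circle.exp θ)) with h | h
    exacts [⟨.near, by simp, h⟩, ⟨.mid, by simp, h⟩]
  let Pr (θ : Ioo 0 (2 * Real.pi)) : Prop := ∀ c, c ≠ .plate → ∀ hc, Fm θ c hc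
  have hPr : IsLocallyConstant Pr := by
    refine (IsLocallyConstant.iff_eventually_eq Pr).2 fun θ₀ => ?_
    obtain ⟨c, hc, h₀⟩ := ex_chart θ₀
    have hn : x ⁻¹' H.domain c ∈ 𝓝 (θ₀ : ℝ) :=
      hxc.continuousAt ((H.isOpen_domain c).mem_nhds h₀)
    have hn' := ordConnectedComponent_mem_nhds.2 hn
    have he := (hW c hc θ₀ θ₀.2 h₀).and hn'
    filter_upwards [continuous_subtype_val.continuousAt.eventually he] with θ hθ
    obtain ⟨hθ1, hθ2⟩ := hθ
    have h1 : x θ ∈ H.domain c := hθ2 right_mem_uIcc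
    obtain ⟨γ, hγ⟩ := segment (a := θ₀) (b := θ)
    have h3 : ∀ t, γ t ∈ H.domain .plate := fun t => by
      obtain ⟨θ, -, e⟩ := hγ t
      exact e ▸ hxV θ
    have h4 : ∀ t, γ t ∈ H.domain c := fun t => by
      obtain ⟨θ', hθ', e⟩ := hγ t
      exact e ▸ hθ2 hθ'
    have e : Fm θ c h1 ↔ Fm θ₀ c h₀ := by
      simp only [Fm]
      rw [hθ1, H.transition_eq_of_path β hβ γ h3 h4 (hxV θ₀) h₀ (hxV θ) h1]
    exact propext ⟨fun h c' hc' h' => change_chart θ₀ c c' hc hc' h₀ h' (e.1 (h c hc h1)),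
      fun h c' hc' h' => change_chart θ c c' hc hc' h1 h' (e.2 (h c hc h₀))⟩
  have : PreconnectedSpace (Ioo 0 (2 * Real.pi)) :=
    Subtype.preconnectedSpace isPreconnected_Ioo
  have hmI : m ∈ Ioo 0 (2 * Real.pi) := ⟨hm, hmM.trans_lt hM⟩
  have hMI : M ∈ Ioo 0 (2 * Real.pi) := ⟨hm.trans_le hmM, hM⟩
  have low (θ) (hθ : θ ∈ Icc 0 m) (c) (hc : c ≠ .plate) (h : x θ ∈ H.domain c) : Fm θ c h := by
    have hn : x θ ∈ H.domain .near := H.polar_mem_near hρ (hm' θ hθ).2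
    refine change_chart _ .near c (by simp) hc hn h ?_
    simp only [Fm]
    rw [one_low θ hθ hn, (hm' θ hθ).1]
    simp [chartWord]
  have all : ∀ θ, Pr θ := fun θ => by
    have h := hPr.apply_eq_of_preconnectedSpace θ ⟨m, hmI⟩
    rw [h]
    exact low m ⟨hm.le, le_rfl⟩
  have hMn : x M ∈ H.domain .near := H.polar_mem_near hρ (hM' M ⟨le_rfl, hM.le⟩).2
  have hR : H.coreHom R = 1 := by
    -- At `M` the formula carried from angle 0 gives the image of `R`, whereas coming back from
    -- angle `2π` gives 1.
    have h := all ⟨M, hMI⟩ .near (by simp) hMn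
    simp only [Fm] at h
    rw [one_high M ⟨le_rfl, hM.le⟩ hMn, (hM' M ⟨le_rfl, hM.le⟩).1] at h
    simpa [chartWord] using h.symm
  refine ⟨hR, fun c hc θ hθ h => ?_⟩
  rcases hθ.1.eq_or_lt with rfl | h0
  · exact low 0 ⟨le_rfl, hm.le⟩ c hc h
  rcases hθ.2.eq_or_lt with rfl | h1
  · have hI : 2 * Real.pi ∈ Icc M (2 * Real.pi) := ⟨hM.le, le_rfl⟩
    have hn : x (2 * Real.pi) ∈ H.domain .near := H.polar_mem_near hρ (hM' _ hI).2
    refine change_chart _ .near c (by simp) hc hn h ?_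
    simp only [Fm]
    rw [one_high _ hI hn, (hM' _ hI).1]
    simp [chartWord, hR]
  · exact all ⟨θ, h0, h1⟩ c hc h

end

end Comparison

/-! ### Words read off around the plates and their holonomy -/

/-- The words met when going around the plates, as functions of the angle measured from a base
point that lies on no strip. -/
structure Reading (β : P → Circle) (R : P → FreeGroup B) where
  word : P → ℝ → FreeGroup B
  low : P → ℝ
  high : P → ℝ
  low_pos : ∀ p, 0 < low p
  low_le_high : ∀ p, low p ≤ high p
  high_lt : ∀ p, high p < 2 * Real.pi
  word_low : ∀ p, ∀ θ ∈ Icc 0 (low p), word p θ = 1 ∧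
    ∀ k, H.plateOf k = p → β p * Circle.exp θ ∉ range (H.plateArc k)
  word_high : ∀ p, ∀ θ ∈ Icc (high p) (2 * Real.pi), word p θ = R p ∧
    ∀ k, H.plateOf k = p → β p * Circle.exp θ ∉ range (H.plateArc k)
  eventually_eq : ∀ p, ∀ ρ ∈ Ioo (0 : I) 1, ∀ s, ∀ c ≠ Chart.plate, ∀ θ ∈ Ioo 0 (2 * Real.pi),
    H.polar p ρ s (β p * Circle.exp θ) ∈ H.domain c → ∀ᶠ θ' in 𝓝 θ,
      word p θ' * (chartWord c (H.polar p ρ s (β p * Circle.exp θ')))⁻¹ =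
      word p θ * (chartWord c (H.polar p ρ s (β p * Circle.exp θ)))⁻¹

namespace Reading

variable {H} {β : P → Circle} {R : P → FreeGroup B} (D : H.Reading β R)

include D in
theorem base_notMem (k : K) : β (H.plateOf k) ∉ range (H.plateArc k) := by
  have := (D.word_low (H.plateOf k) 0 ⟨le_rfl, (D.low_pos _).le⟩).2 k rfl
  simpa using this

/-- The angle of a point of the circle, measured from a given base point. -/
noncomputable def angle (b u : Circle) : ℝ :=
  toIcoMod Real.two_pi_pos 0 (Complex.arg (u / b : Circle))

theorem angle_mem (b u : Circle) : angle b u ∈ Ico 0 (2 * Real.pi) := by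
  have h := toIcoMod_mem_Ico Real.two_pi_pos 0 (Complex.arg (u / b : Circle))
  rwa [zero_add] at h

theorem mul_exp_angle (b u : Circle) : b * Circle.exp (angle b u) = u := by
  have h : Circle.exp (angle b u) = Circle.exp (Complex.arg (u / b : Circle)) := by
    rw [Circle.exp_eq_exp]
    refine ⟨-toIcoDiv Real.two_pi_pos 0 (Complex.arg (u / b : Circle)), ?_⟩
    simp [angle, toIcoMod, sub_eq_add_neg]
  rw [h, Circle.exp_arg, mul_div_cancel]

theorem angle_eq {b : Circle} {θ : ℝ} (hθ : θ ∈ Ico 0 (2 * Real.pi)) :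
    angle b (b * Circle.exp θ) = θ := by
  have h := mul_exp_angle b (b * Circle.exp θ)
  have h1 := angle_mem b (b * Circle.exp θ)
  exact Circle.exp_injOn_Ico (by linarith) h1 hθ (mul_left_cancel h)

theorem map_nhds_mul_exp (b : Circle) (θ : ℝ) :
    map (fun t : ℝ => b * Circle.exp t) (𝓝 θ) = 𝓝 (b * Circle.exp θ) := by
  have h : 𝓝 (b * Circle.exp θ) = map (b * ·) (𝓝 (Circle.exp θ)) :=
    ((Homeomorph.mulLeft b).map_nhds_eq (Circle.exp θ)).symm
  rw [h, ← isLocalHomeomorph_circleExp.map_nhds_eq, map_map]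
  rfl

/-- The height depends only on the direction in the plate, so chart words can be computed on a
single circle with `s` fixed. -/
theorem height_cplate_eq_polar {p : P} {ρ s s' : I} (hρ : ρ ∈ Ioo 0 1) (w : Disc) :
    height (H.cplate p (w, s)) = height (H.polar p ρ s' (Disc.dir w)) :=
  Option.ext fun _ => (H.height_cplate).trans (H.height_polar hρ).symm

theorem chartWord_cplate_eq_polar {p : P} {ρ s s' : I} (hρ : ρ ∈ Ioo 0 1) (w : Disc) (c : Chart) :
    chartWord c (H.cplate p (w, s)) = chartWord c (H.polar p ρ s' (Disc.dir w)) := by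
  cases c <;> simp only [chartWord, midWord, height_cplate_eq_polar (s := s) (s' := s') hρ]

theorem polar_mem_domain {p : P} {ρ s s' : I} (hρ : ρ ∈ Ioo 0 1) {w : Disc} {c : Chart}
    (h : H.cplate p (w, s) ∈ H.domain c) : H.polar p ρ s' (Disc.dir w) ∈ H.domain c := by
  cases c with
  | near => exact ⟨H.not_isCentre_polar hρ, by
      rw [← height_cplate_eq_polar (s := s) hρ]; exact h.2⟩
  | mid => exact ⟨H.not_isCentre_polar hρ, by
      rw [← height_cplate_eq_polar (s := s) hρ]; exact h.2⟩
  | plate => exact H.polar_mem_plate hρ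

theorem norm_lt_one_of_mem {p : P} {q : Disc × I} (h : H.cplate p q ∈ H.domain .plate) :
    ‖(q.1 : ℂ)‖ < 1 := by
  obtain ⟨a, ha⟩ := h
  change (if ‖(q.1 : ℂ)‖ < 1 then some (p, q) else none) = some a at ha
  by_contra hc
  simp [hc] at ha

/-- The word that is read off at a point in the interior of a plate. -/
noncomputable def plateWord (x : H.Collapsed) : FreeGroup B :=
  (plateCoord x).elim 1 fun a => D.word a.1 (angle (β a.1) (Disc.dir a.2.1))

/-- The holonomies of the flat families. -/
noncomputable def holWord : Chart → H.Collapsed → FreeGroup B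
  | .plate, x => D.plateWord x
  | c, x => chartWord c x

theorem holWord_of_ne {c : Chart} (hc : c ≠ .plate) (x : H.Collapsed) :
    D.holWord c x = chartWord c x := by
  cases c <;> first | contradiction | rfl

theorem plateWord_cplate {p : P} {q : Disc × I} (h : ‖(q.1 : ℂ)‖ < 1) :
    D.plateWord (H.cplate p q) = D.word p (angle (β p) (Disc.dir q.1)) := by
  rw [plateWord, plateCoord_cplate _ h]
  rfl

variable {G : Type*} [Group G] (π : FreeGroup B →* G) (hπ : ∀ p, π (R p) = 1)

-- Away from the base direction this is the defining property of a reading. Across it the word jumps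
-- from the relator to 1, a jump that `π` does not see. Of the two charts only `near` contains that
-- direction, since the base point lies on no strip.
include hπ in
theorem eventually_polar {p : P} {ρ s : I} (hρ : ρ ∈ Ioo 0 1) {c : Chart} (hc : c ≠ .plate)
    {u : Circle} (h : H.polar p ρ s u ∈ H.domain c) : ∀ᶠ v in 𝓝 u,
      π (D.word p (angle (β p) v) * (chartWord c (H.polar p ρ s v))⁻¹) =
      π (D.word p (angle (β p) u) * (chartWord c (H.polar p ρ s u))⁻¹) := by
  obtain ⟨θ, hθ, rfl⟩ : ∃ θ ∈ Ico 0 (2 * Real.pi), β p * Circle.exp θ = u :=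
    ⟨_, angle_mem (β p) u, mul_exp_angle _ _⟩
  rw [← map_nhds_mul_exp, eventually_map]
  rcases hθ.1.eq_or_lt with rfl | h0
  · have hb := fun k (hk : H.plateOf k = p) => hk ▸ D.base_notMem k
    obtain rfl : c = .near := by
      cases c with
      | near => rfl
      | plate => contradiction
      | mid =>
        obtain ⟨-, a, ha⟩ := h
        obtain ⟨k, hk, -⟩ := (H.height_polar hρ).1 ha
        obtain ⟨rfl, hk⟩ := H.arcPt_eq_some_iff.1 hk
        refine absurd ⟨a.2, ?_⟩ (hb k rfl)
        simpa using hk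
    have hlow := D.low_pos p
    have hhigh := D.high_lt p
    have hlh := D.low_le_high p
    filter_upwards [Ioo_mem_nhds (by linarith : D.high p - 2 * Real.pi < 0) hlow] with θ hθ'
    rw [angle_eq hθ, (D.word_low p 0 ⟨le_rfl, hlow.le⟩).1]
    simp only [chartWord, inv_one, mul_one, map_one]
    rcases lt_or_ge θ 0 with hn | hn
    · have : Circle.exp θ = Circle.exp (θ + 2 * Real.pi) := by simp
      rw [this, angle_eq ⟨by linarith [hθ'.1], by linarith⟩,
        (D.word_high p _ ⟨by linarith [hθ'.1], by linarith⟩).1, hπ]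
    · rw [angle_eq ⟨hn, by linarith [hθ'.2]⟩, (D.word_low p _ ⟨hn, hθ'.2.le⟩).1, map_one]
  · filter_upwards [D.eventually_eq p ρ hρ s c hc θ ⟨h0, hθ.2⟩ h, Ioo_mem_nhds h0 hθ.2]
      with θ' h1 h2
    rw [angle_eq hθ, angle_eq ⟨h2.1.le, h2.2⟩, h1]

include hπ in
theorem continuousOn_plate [Finite K] [TopologicalSpace G] {c : Chart} (hc : c ≠ .plate) :
    ContinuousOn (fun x => π (D.plateWord x * (chartWord c x)⁻¹))
      (H.domain .plate ∩ H.domain c) := by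
  refine H.continuousOn_collapsed ((H.isOpen_domain .plate).inter (H.isOpen_domain c))
    (fun b x hx => ?_) fun p => ?_
  · obtain ⟨⟨_, h⟩, -⟩ := hx
    cases h
  · have hm : midpt ∈ Ioo (0 : I) 1 := ⟨midpt_pos, midpt_lt_one⟩
    have hcongr : ∀ q ∈ H.cplate p ⁻¹' (H.domain .plate ∩ H.domain c),
        π (D.plateWord (H.cplate p q) * (chartWord c (H.cplate p q))⁻¹) =
        (fun u => π (D.word p (angle (β p) u) * (chartWord c (H.polar p midpt 0 u))⁻¹))
          (Disc.dir q.1) := by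
      rintro ⟨w, s⟩ ⟨h1, h2⟩
      rw [D.plateWord_cplate (norm_lt_one_of_mem h1), chartWord_cplate_eq_polar hm]
    refine ContinuousOn.congr (fun q hq => ?_) hcongr
    have hq0 : (q.1 : ℂ) ≠ 0 := by
      have h2 := hq.2
      cases c with
      | near => exact h2.1
      | mid => exact h2.1
      | plate => contradiction
    refine ContinuousAt.comp_continuousWithinAt (g := fun u =>
      π (D.word p (angle (β p) u) * (chartWord c (H.polar p midpt 0 u))⁻¹))
      (f := fun q : Disc × I => Disc.dir q.1) ?_ ?_
    · have h := D.eventually_polar π hπ hm hc (polar_mem_domain (s' := 0) hm hq.2)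
      exact (continuousAt_const (y := π (D.word p (angle (β p) (Disc.dir q.1)) *
        (chartWord c (H.polar p midpt 0 (Disc.dir q.1)))⁻¹))).congr (h.mono fun _ e => e.symm)
    · have h : {w : Disc | (w : ℂ) ≠ 0} ∈ 𝓝 q.1 :=
        (isOpen_ne.preimage continuous_subtype_val).mem_nhds hq0
      exact ((Disc.continuousOn_dir.continuousAt h).comp continuousAt_fst).continuousWithinAt

-- These are the locally constant quotients that `exists_transport` needs: the overlaps with `plate`
-- come from the reading, that of `near` and `mid` from the two separate halves of the beams.
include hπ in
theorem continuousOn_holWord [Finite K] [TopologicalSpace G] [IsTopologicalGroup G] (c c' : Chart) :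
    ContinuousOn (fun x => π (D.holWord c x) * (π (D.holWord c' x))⁻¹)
      (H.domain c ∩ H.domain c') := by
  have inv {c c' : Chart} (h : ContinuousOn (fun x => π (D.holWord c x) * (π (D.holWord c' x))⁻¹)
      (H.domain c ∩ H.domain c')) :
      ContinuousOn (fun x => π (D.holWord c' x) * (π (D.holWord c x))⁻¹)
        (H.domain c' ∩ H.domain c) := by
    rw [inter_comm]
    exact h.inv.congr fun x _ => by simp
  have plate {c : Chart} (hc : c ≠ .plate) :
      ContinuousOn (fun x => π (D.holWord .plate x) * (π (D.holWord c x))⁻¹)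
        (H.domain .plate ∩ H.domain c) := by
    simpa [holWord_of_ne _ hc, holWord] using D.continuousOn_plate π hπ hc
  have mid : ContinuousOn (fun x => π (D.holWord .mid x) * (π (D.holWord .near x))⁻¹)
        (H.domain .mid ∩ H.domain .near) := fun x hx => by
    refine (continuousAt_const.congr (f := fun _ => π (midWord x)) ?_).continuousWithinAt
    filter_upwards [H.eventually_midWord_eq hx.2 hx.1] with y hy
    simp [holWord, chartWord, hy]
  have self (c : Chart) : ContinuousOn (fun x => π (D.holWord c x) * (π (D.holWord c x))⁻¹)
      (H.domain c ∩ H.domain c) := by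
    simpa using continuousOn_const
  cases c <;> cases c' <;>
    first | exact self _ | exact mid | exact inv mid | exact plate (by simp) |
      exact inv (plate (by simp))

end Reading

end HandleStructure

/-! ### The isomorphism from the presented group to the fundamental group -/

namespace HandleStructure

variable {B P K : Type*} {H : HandleStructure B P K}

theorem trackClass_pt {e : I → I → I} (he : IsTrack e) : H.trackClass he H.pt = .refl _ := by
  have h1 : H.trackPath he H.pt = Path.refl H.pt := Path.ext (funext fun _ => rfl)
  have h2 : H.radialPath H.pt = Path.refl H.pt := Path.ext (funext fun _ => rfl)
  exact (congrArg₂ (fun p q : Path H.pt H.pt => (Path.Homotopic.Quotient.mk p).trans (.mk q))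
    h1 h2).trans (Path.Homotopic.Quotient.refl_trans _)

theorem transport_subpath {Z G : Type*} [TopologicalSpace Z]
    (τ : ∀ {x y : Z}, Path.Homotopic.Quotient x y → G → G) {x y : Z} (γ : Path x y) (v : G) :
    τ (.mk γ) v = τ (.mk (γ.subpath 0 1)) v := by
  have gen : ∀ (x' y' : Z) (hx : γ 0 = x') (hy : γ 1 = y'),
      τ (.mk ((γ.subpath 0 1).cast hx.symm hy.symm)) v = τ (.mk (γ.subpath 0 1)) v := by
    rintro _ _ rfl rfl
    rfl
  rw [← gen x y γ.source γ.target]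
  congr 2
  ext t
  simp

theorem exists_eq_polar {c : Chart} (hc : c ≠ .plate) {x : H.Collapsed} (h : x ∈ H.domain .plate)
    (h' : x ∈ H.domain c) : ∃ p, ∃ ρ ∈ Ioo (0 : I) 1, ∃ s u, x = H.polar p ρ s u := by
  obtain ⟨⟨p, w, s⟩, ha⟩ := h
  obtain ⟨h1, rfl⟩ := H.plateCoord_eq_some_iff.1 ha
  have h0 : (w : ℂ) ≠ 0 := by
    cases c with
    | near => exact h'.1
    | mid => exact h'.1
    | plate => contradiction
  refine ⟨p, ⟨‖(w : ℂ)‖, norm_nonneg _, h1.le⟩, ⟨?_, ?_⟩, s, Disc.dir w, ?_⟩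
  · exact Subtype.coe_lt_coe.1 (norm_pos_iff.2 h0)
  · exact Subtype.coe_lt_coe.1 h1
  · rw [polar]
    refine congrArg (fun v : Disc => H.cplate p (v, s)) ?_
    exact Subtype.ext ((Disc.norm_smul_dir w).symm.trans
      (coe_lerp_centre (Disc.dir w) ⟨‖(w : ℂ)‖, norm_nonneg _, h1.le⟩).symm)

namespace Reading

variable {β : P → Circle} {R : P → FreeGroup B} (D : H.Reading β R) [Finite K]

include D in
theorem coreHom_relator (p : P) : H.coreHom (R p) = 1 :=
  (H.transition_plate (s := 0) β D.base_notMem ⟨midpt_pos, midpt_lt_one⟩ (D.word p)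
    (D.eventually_eq p _ ⟨midpt_pos, midpt_lt_one⟩ 0) (D.low_pos p) (D.low_le_high p) (D.high_lt p)
    (D.word_low p) (D.word_high p)).1

/-- The homomorphism from the presented group to the fundamental group. -/
noncomputable def coreMap : PresentedGroup (range R) →* FundamentalGroup H.Collapsed H.pt :=
  PresentedGroup.toGroup (f := fun b => (FundamentalGroup.fromPath (.mk (H.coreLoop b)))⁻¹) (by
    rintro _ ⟨p, rfl⟩
    exact D.coreHom_relator p)

theorem coreMap_mk (w : FreeGroup B) : D.coreMap (PresentedGroup.mk _ w) = H.coreHom w := rfl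

theorem coreHom_mem_range (w : FreeGroup B) : H.coreHom w ∈ D.coreMap.range := ⟨_, D.coreMap_mk w⟩

theorem transition_polar_mem {p : P} {ρ s : I} (hρ : ρ ∈ Ioo 0 1) (u : Circle) {c : Chart}
    (hc : c ≠ .plate) (h : H.polar p ρ s u ∈ H.domain c) :
    H.transition β D.base_notMem .plate c _ (H.polar_mem_plate hρ) h ∈ D.coreMap.range := by
  obtain ⟨θ, hθ, rfl⟩ : ∃ θ ∈ Ico 0 (2 * Real.pi), β p * Circle.exp θ = u :=
    ⟨_, angle_mem (β p) u, mul_exp_angle _ _⟩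
  rw [(H.transition_plate β D.base_notMem hρ (D.word p)
    (D.eventually_eq p _ hρ s) (D.low_pos p) (D.low_le_high p) (D.high_lt p)
    (D.word_low p) (D.word_high p)).2 c hc θ ⟨hθ.1, hθ.2.le⟩ h]
  exact D.coreHom_mem_range _

theorem transition_plate_mem {c : Chart} (hc : c ≠ .plate) {x : H.Collapsed}
    (h : x ∈ H.domain .plate) (h' : x ∈ H.domain c) :
    H.transition β D.base_notMem .plate c x h h' ∈ D.coreMap.range := by
  obtain ⟨p, ρ, hρ, s, u, rfl⟩ := exists_eq_polar hc h h'
  exact D.transition_polar_mem hρ u hc h'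

theorem transition_mem (c c' : Chart) {x : H.Collapsed} (h : x ∈ H.domain c)
    (h' : x ∈ H.domain c') : H.transition β D.base_notMem c c' x h h' ∈ D.coreMap.range := by
  by_cases hc : c = .plate
  · subst hc
    by_cases hc' : c' = .plate
    · subst hc'
      rw [transition_self]
      exact one_mem _
    · exact D.transition_plate_mem hc' h h'
  · by_cases hc' : c' = .plate
    · subst hc'
      rw [← transition_inv]
      exact inv_mem (D.transition_plate_mem hc h' h)
    · rw [H.transition_eq_coreHom _ _ hc hc' h h']
      exact D.coreHom_mem_range _

/-- The range contains all transitions between the flat families, and at `pt`, which lies only in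
`near`, the flat class is trivial; so the range is the whole group. -/
theorem coreMap_surjective : Function.Surjective D.coreMap := by
  rw [← MonoidHom.range_eq_top]
  refine subgroup_eq_top_of_flat H.domain H.isOpen_domain H.exists_mem_domain
    (H.flatClass β D.base_notMem) (fun c _ _ γ hγ hx hy => H.flatClass_trans β _ c γ hγ hx hy) _
    (fun c c' x h h' => D.transition_mem c' c h' h) fun c hc => ?_
  cases c with
  | mid => exact absurd hc H.pt_notMem_mid
  | plate => exact absurd hc H.pt_notMem_plate
  | near =>
    change H.trackClass isTrack_nearTrack H.pt ∈ _
    rw [trackClass_pt]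
    exact one_mem _

/-- Transport with values in the presented group depends only on the homotopy class. Along the loop
of a word `w` it multiplies by the inverse of `w`, so a word with trivial loop is trivial in the
presented group. -/
theorem coreMap_injective : Function.Injective D.coreMap := by
  let _ : TopologicalSpace (PresentedGroup (range R)) := ⊥
  have : DiscreteTopology (PresentedGroup (range R)) := ⟨rfl⟩
  obtain ⟨τ, τ_refl, τ_trans, τ_chart⟩ := exists_transport H.domain H.isOpen_domain
    H.exists_mem_domain (fun c x => PresentedGroup.mk (range R) (D.holWord c x))
    (D.continuousOn_holWord (PresentedGroup.mk (range R)) fun p =>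
      PresentedGroup.one_of_mem ⟨p, rfl⟩)
  -- The core is cut at heights 1/4 and 3/4. The outer parts lie in `near`, where transport is
  -- trivial; the inner part lies in `mid`, where the word changes from 1 to the generator.
  have core (b : B) (v) : τ (.mk (H.coreLoop b)) v = v * PresentedGroup.mk (range R) (.of b) := by
    let q₁ : I := ⟨1 / 4, by norm_num, by norm_num⟩
    let q₃ : I := ⟨3 / 4, by norm_num, by norm_num⟩
    have hnear {s t : I} (h : ∀ u ∈ uIcc s t, u ≠ midpt) (v) :
        τ (.mk ((H.coreLoop b).subpath s t)) v = v := by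
      rw [τ_chart .near _ (subpath_mem _ fun u hu => ⟨id, fun b' hb' => ?_⟩)]
      · simp [holWord, chartWord]
      · exact h u hu (congrArg Prod.snd (H.height_cbeam.1 hb').2).symm
    have hmid : ∀ v, τ (.mk ((H.coreLoop b).subpath q₁ q₃)) v =
        v * PresentedGroup.mk (range R) (.of b) := by
      intro v
      have hh (u : I) (hu : u ∈ Ioo 0 1) : height (H.coreLoop b u) = some (b, u) :=
        H.height_cbeam.2 ⟨hu, rfl⟩
      have h1 : q₁ ∈ Ioo (0 : I) 1 :=
        ⟨Subtype.coe_lt_coe.1 (by norm_num [q₁]), Subtype.coe_lt_coe.1 (by norm_num [q₁])⟩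
      have h3 : q₃ ∈ Ioo (0 : I) 1 :=
        ⟨Subtype.coe_lt_coe.1 (by norm_num [q₃]), Subtype.coe_lt_coe.1 (by norm_num [q₃])⟩
      rw [τ_chart .mid _ (subpath_mem _ fun u hu =>
        ⟨id, _, hh u (ordConnected_Ioo.uIcc_subset h1 h3 hu)⟩)]
      have e1 : ¬ midpt < q₁ := fun h => absurd (Subtype.coe_lt_coe.2 h) (by norm_num [q₁, midpt])
      have e3 : midpt < q₃ := Subtype.coe_lt_coe.1 (by norm_num [q₃, midpt])
      simp [holWord, chartWord, midWord, hh _ h1, hh _ h3, e1, e3]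
    rw [transport_subpath τ, ← mk_subpath_trans _ 0 q₃ 1, ← mk_subpath_trans _ 0 q₁ q₃, τ_trans,
      τ_trans, hnear, hmid, hnear]
    · intro u hu e
      have := hu.2
      rw [e] at this
      exact absurd (Subtype.coe_le_coe.2 this) (by norm_num [q₁, midpt])
    · intro u hu e
      have := hu.1
      rw [e] at this
      exact absurd (Subtype.coe_le_coe.2 this) (by norm_num [q₃, midpt])
  have inv (g : FundamentalGroup H.Collapsed H.pt) (a) (h : ∀ v, τ g v = v * a) (v) :
      τ (g⁻¹ : FundamentalGroup H.Collapsed H.pt) v = v * a⁻¹ := by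
    have h1 := τ_trans g (g⁻¹ : FundamentalGroup H.Collapsed H.pt) (v * a⁻¹)
    have h2 : Path.Homotopic.Quotient.trans g (g⁻¹ : FundamentalGroup H.Collapsed H.pt) =
      .refl _ := inv_mul_cancel g
    rw [h2, τ_refl, h, inv_mul_cancel_right] at h1
    exact h1.symm
  -- The inverse appears because `coreHom` inverts the cores. The order agrees as well: in `coreHom
  -- (x * y)` the loop of `y` is run first, which multiplies on the right by the inverse of `y` and
  -- then of `x`.
  have main (w : FreeGroup B) : ∀ v, τ (H.coreHom w) v = v * (PresentedGroup.mk (range R) w)⁻¹ := by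
    induction w using FreeGroup.induction_on with
    | C1 =>
      intro v
      rw [map_one, map_one, inv_one, mul_one]
      exact τ_refl _ v
    | of b =>
      rw [coreHom, FreeGroup.lift_apply_of]
      exact inv _ _ (core b)
    | inv_of b h =>
      rw [map_inv, map_inv]
      exact inv _ _ h
    | mul x y hx hy =>
      intro v
      rw [map_mul]
      refine (τ_trans (H.coreHom y) (H.coreHom x) v).trans ?_
      rw [hy, hx, map_mul, mul_inv_rev, mul_assoc]
  refine (injective_iff_map_eq_one _).2 fun g hg => ?_
  obtain ⟨w, rfl⟩ := PresentedGroup.mk_surjective _ g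
  have h := main w 1
  rw [← D.coreMap_mk, hg] at h
  have := (τ_refl _ _).symm.trans h
  simpa using this

include D in
theorem nonempty_mulEquiv (x : H.Collapsed) :
    Nonempty (FundamentalGroup H.Collapsed x ≃* PresentedGroup (range R)) := by
  have := H.pathConnectedSpace_collapsed β D.base_notMem
  exact ⟨(FundamentalGroup.fundamentalGroupMulEquivOfPathConnected x H.pt).trans
    (MulEquiv.ofBijective D.coreMap ⟨D.coreMap_injective, D.coreMap_surjective⟩).symm⟩

end Reading

end HandleStructure

/-! ### The reading of an associated handle-structure -/

theorem Circle.eq_of_exp_eq {x y : ℝ} (hx : x ∈ Icc 0 (2 * Real.pi)) (hy : y ∈ Ioo 0 (2 * Real.pi))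
    (h : Circle.exp x = Circle.exp y) : x = y := by
  have inj := Circle.exp_injOn_Ico (show 2 * Real.pi - 0 ≤ 2 * Real.pi by simp)
  rcases hx.2.eq_or_lt with rfl | hx'
  · have : (0 : ℝ) = y := inj ⟨le_rfl, Real.two_pi_pos⟩ ⟨hy.1.le, hy.2⟩ (by simpa using h)
    exact absurd this hy.1.ne
  · exact inj ⟨hx.1, hx'⟩ ⟨hy.1.le, hy.2⟩ h

/-- A finite family of arcs in an open interval stays away from the end points. -/
theorem exists_bounds {ι : Type*} [Finite ι] {a b : ℝ} (hab : a < b) (f : ι → I → ℝ)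
    (hf : ∀ i, Continuous (f i)) (h : ∀ i t, a < f i t ∧ f i t < b) :
    ∃ m M, a < m ∧ m ≤ M ∧ M < b ∧ ∀ i t, m < f i t ∧ f i t < M := by
  -- The midpoint is inserted so that the compact set is nonempty even without arcs, as for an empty
  -- relator.
  have hK : IsCompact (insert ((a + b) / 2) (⋃ i, range (f i))) :=
    (isCompact_iUnion fun i => isCompact_range (hf i)).insert _
  have hsub : insert ((a + b) / 2) (⋃ i, range (f i)) ⊆ Ioo a b := by
    refine insert_subset ⟨by linarith, by linarith⟩ (iUnion_subset fun i => ?_)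
    rintro _ ⟨t, rfl⟩
    exact h i t
  obtain ⟨m, hm, hm'⟩ := hK.exists_isLeast (insert_nonempty _ _)
  obtain ⟨M, hM, hM'⟩ := hK.exists_isGreatest (insert_nonempty _ _)
  have h1 := (hsub hm).1
  have h2 := (hsub hM).2
  have h3 := hm' hM
  refine ⟨(a + m) / 2, (M + b) / 2, by linarith, by linarith, by linarith, fun i t => ?_⟩
  have hft : f i t ∈ insert ((a + b) / 2) (⋃ i, range (f i)) :=
    Or.inr (mem_iUnion.2 ⟨i, t, rfl⟩)
  have h4 := hm' hft
  have h5 := hM' hft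
  constructor <;> linarith

namespace HandleStructure

section Letters

variable {X : Type*} (L : List (X × Bool)) (f : Fin L.length → I → ℝ)

/-- The midpoint of a letter of a word has been passed at a given angle. -/
def Passed (θ : ℝ) (i : Fin L.length) : Prop :=
  -- The convention at the midpoint follows `midWord`, which jumps strictly above the middle. An
  -- ascending strip is above the middle after its midpoint angle, a descending one strictly before
  -- it.
  if (L.get i).2 = true then f i midpt < θ else f i midpt ≤ θ

noncomputable instance (θ : ℝ) : DecidablePred (Passed L f θ) := Classical.decPred _

/-- The part of a word that has been passed at a given angle. -/
noncomputable def passedWord (θ : ℝ) : FreeGroup X :=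
  FreeGroup.mk (L.take (Finset.univ.filter (Passed L f θ)).card)

variable {L f}

theorem passed_of_lt {θ : ℝ} {i : Fin L.length} (h : f i midpt < θ) : Passed L f θ i := by
  unfold Passed
  split_ifs
  exacts [h, h.le]

theorem not_passed_of_gt {θ : ℝ} {i : Fin L.length} (h : θ < f i midpt) : ¬ Passed L f θ i := by
  unfold Passed
  split_ifs
  exacts [h.not_gt, h.not_ge]

theorem passedWord_congr {θ θ' : ℝ} (h : ∀ i, Passed L f θ i ↔ Passed L f θ' i) :
    passedWord L f θ = passedWord L f θ' := by
  unfold passedWord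
  congr 3
  exact Finset.filter_congr fun i _ => h i

theorem passedWord_eq_one {θ : ℝ} (h : ∀ i t, θ < f i t) : passedWord L f θ = 1 := by
  have : Finset.univ.filter (Passed L f θ) = ∅ :=
    Finset.filter_false_of_mem fun i _ => not_passed_of_gt (h i _)
  rw [passedWord, this]
  simp [FreeGroup.one_eq_mk]

theorem passedWord_eq_mk {θ : ℝ} (h : ∀ i t, f i t < θ) : passedWord L f θ = FreeGroup.mk L := by
  have : Finset.univ.filter (Passed L f θ) = Finset.univ :=
    Finset.filter_true_of_mem fun i _ => passed_of_lt (h i _)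
  rw [passedWord, this]
  simp

theorem eventually_passedWord_eq {θ : ℝ} (h : ∀ i, θ ≠ f i midpt) :
    ∀ᶠ θ' in 𝓝 θ, passedWord L f θ' = passedWord L f θ := by
  have : ∀ i, ∀ᶠ θ' in 𝓝 θ, Passed L f θ' i ↔ Passed L f θ i := fun i => by
    rcases (h i).lt_or_gt with hi | hi
    · filter_upwards [eventually_lt_nhds hi] with θ' h'
      simp only [not_passed_of_gt hi, not_passed_of_gt h']
    · filter_upwards [eventually_gt_nhds hi] with θ' h'
      simp only [passed_of_lt hi, passed_of_lt h']
  filter_upwards [eventually_all.2 this] with θ' h'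
  exact passedWord_congr h'

/-- The right side does not depend on `t`. On an ascending strip the generator enters the word and
the chart word simultaneously; on a descending one its inverse enters the word just when the
generator leaves the chart word. -/
theorem passedWord_arc (hf : ∀ i i' t t', i < i' → f i t < f i' t')
    (hmono : ∀ i, (L.get i).2 = true → StrictMono (f i))
    (hanti : ∀ i, (L.get i).2 = false → StrictAnti (f i)) (i : Fin L.length) (t : I) :
    passedWord L f (f i t) * (if midpt < t then FreeGroup.of (L.get i).1 else 1)⁻¹ =
      FreeGroup.mk (L.take i) *
        (if (L.get i).2 = true then 1 else (FreeGroup.of (L.get i).1)⁻¹) := by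
  have hlt (l) (h : l < i) : Passed L f (f i t) l := passed_of_lt (hf _ _ _ _ h)
  have hgt (l) (h : i < l) : ¬ Passed L f (f i t) l := not_passed_of_gt (hf _ _ _ _ h)
  have pos (h : Passed L f (f i t) i) :
      passedWord L f (f i t) = FreeGroup.mk (L.take i) * FreeGroup.mk [L.get i] := by
    have : Finset.univ.filter (Passed L f (f i t)) = Finset.Iic i := by
      ext l
      rcases lt_trichotomy l i with hl | rfl | hl
      · simp [hlt l hl, hl.le]
      · simp [h]
      · simp [hgt l hl, hl]
    rw [passedWord, this, Fin.card_Iic, FreeGroup.mul_mk]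
    exact congrArg _ (List.take_append_getElem i.2).symm
  have neg (h : ¬ Passed L f (f i t) i) :
      passedWord L f (f i t) = FreeGroup.mk (L.take i) := by
    have : Finset.univ.filter (Passed L f (f i t)) = Finset.Iio i := by
      ext l
      rcases lt_trichotomy l i with hl | rfl | hl
      · simp [hlt l hl, hl]
      · simp [h]
      · simp [hgt l hl, hl.le]
    rw [passedWord, this, Fin.card_Iio]
  have hpass : Passed L f (f i t) i ↔
      if (L.get i).2 = true then f i midpt < f i t else f i midpt ≤ f i t := Iff.rfl
  by_cases hs : (L.get i).2 = true
  · have hg : L.get i = ((L.get i).1, true) := Prod.ext rfl hs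
    rw [if_pos hs, mul_one]
    rw [if_pos hs, (hmono i hs).lt_iff_lt] at hpass
    split_ifs with ht
    · rw [pos (hpass.2 ht), hg]
      exact mul_inv_cancel_right _ _
    · rw [neg (hpass.not.2 ht), inv_one, mul_one]
  · rw [if_neg hs]
    rw [if_neg hs] at hpass
    have hs : (L.get i).2 = false := by simpa using hs
    have hg : L.get i = ((L.get i).1, false) := Prod.ext rfl hs
    rw [(hanti i hs).le_iff_ge] at hpass
    split_ifs with ht
    · rw [neg (hpass.not.2 ht.not_ge)]
    · rw [pos (hpass.2 (not_lt.1 ht)), hg, inv_one, mul_one]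
      rfl

end Letters

variable {X J : Type*} {r : J → List (X × Bool)} {H : HandleStructure X J (Letters r)}

theorem exists_reading (hH : IsAssociated r H) :
    ∃ β, Nonempty (H.Reading β fun j => FreeGroup.mk (r j)) := by
  obtain ⟨hp, hb, hplate⟩ := hH
  choose β f hf hmono hanti hmem hlt hplate using hplate
  choose m M hm hmM hM hb' using fun j => exists_bounds Real.two_pi_pos (f j) (hf j) (hmem j)
  have arc {j θ} (hθ : θ ∈ Icc 0 (2 * Real.pi)) {k t} (hk : H.plateOf k = j)
      (h : H.plateArc k t = β j * Circle.exp θ) : ∃ i, k = ⟨j, i⟩ ∧ θ = f j i t := by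
    obtain ⟨j', i⟩ := k
    obtain rfl : j' = j := (hp j' i).symm.trans hk
    rw [hplate] at h
    exact ⟨i, rfl, Circle.eq_of_exp_eq hθ (hmem _ i t) (mul_left_cancel h).symm⟩
  have hheight {j ρ s} (hρ : ρ ∈ Ioo (0 : I) 1) (i) {t : I} (ht : t ∈ Ioo 0 1) :
      height (H.polar j ρ s (β j * Circle.exp (f j i t))) = some (((r j).get i).1, t) := by
    refine (H.height_polar hρ).2 ⟨⟨j, i⟩, ?_, ht, hb j i⟩
    rw [← hplate, H.arcPt_eq_some_iff]
    exact ⟨hp j i, rfl⟩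
  refine ⟨β, ⟨{
    word := fun j => passedWord (r j) (f j)
    low := m
    high := M
    low_pos := hm
    low_le_high := hmM
    high_lt := hM
    word_low := fun j θ hθ => ⟨passedWord_eq_one fun i t => hθ.2.trans_lt (hb' j i t).1, ?_⟩
    word_high := fun j θ hθ => ⟨passedWord_eq_mk fun i t => (hb' j i t).2.trans_le hθ.1, ?_⟩
    eventually_eq := ?_ }⟩⟩
  · rintro k hk ⟨t, ht⟩
    obtain ⟨i, -, h⟩ := arc ⟨hθ.1, hθ.2.trans ((hmM j).trans (hM j).le)⟩ hk ht
    exact absurd hθ.2 (h ▸ (hb' j i t).1).not_ge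
  · rintro k hk ⟨t, ht⟩
    obtain ⟨i, -, h⟩ := arc ⟨(hm j).le.trans ((hmM j).trans hθ.1), hθ.2⟩ hk ht
    exact absurd hθ.1 (h ▸ (hb' j i t).2).not_ge
  · intro j ρ hρ s c hc θ hθ h
    cases c with
    | plate => contradiction
    | near =>
      have := eventually_passedWord_eq (L := r j) (f := f j) (θ := θ) ?_
      · filter_upwards [this] with θ' h'
        rw [h']
        rfl
      -- The word jumps only at midpoints of strips, and those directions lie over the middle level,
      -- which `near` omits.
      · rintro i rfl
        exact h.2 _ (hheight hρ i ⟨midpt_pos, midpt_lt_one⟩)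
    | mid =>
      obtain ⟨-, ⟨b, t⟩, h⟩ := h
      obtain ⟨k, hk, ht, -⟩ := (H.height_polar hρ).1 h
      obtain ⟨hk, hk'⟩ := H.arcPt_eq_some_iff.1 hk
      obtain ⟨i, rfl, rfl⟩ := arc ⟨hθ.1.le, hθ.2.le⟩ hk hk'
      have main (t' : I) (ht' : t' ∈ Ioo 0 1) := by
        have := passedWord_arc (hlt j) (hmono j) (hanti j) i t'
        rw [show (if midpt < t' then FreeGroup.of ((r j).get i).1 else 1) =
          chartWord .mid (H.polar j ρ s (β j * Circle.exp (f j i t'))) by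
            simp [chartWord, midWord, hheight hρ i ht']] at this
        exact this
      -- All nearby angles lie on the same open strip, on which the quotient is constant by
      -- `passedWord_arc`.
      have hopen : f j i '' Ioo 0 1 ∈ 𝓝 (f j i t) := by
        refine IsOpen.mem_nhds ?_ (mem_image_of_mem _ ht)
        cases hs : ((r j).get i).2 with
        | true => exact isOpen_image_of_strictMono (hf j i) (hmono j i hs) isOpen_Ioo subset_rfl
        | false => exact isOpen_image_of_strictAnti (hf j i) (hanti j i hs) isOpen_Ioo subset_rfl
      filter_upwards [hopen]
      rintro _ ⟨t', ht', rfl⟩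
      rw [main t' ht', main t ht]

end HandleStructure

/-! ### Matching of families of arcs -/

/-- An increasing homeomorphism between two intervals. -/
structure IsMatch (Φ : ℝ → ℝ) (p q p' q' : ℝ) : Prop where
  strictMonoOn : StrictMonoOn Φ (Icc p q)
  continuousOn : ContinuousOn Φ (Icc p q)
  left : Φ p = p'
  right : Φ q = q'

namespace IsMatch

theorem glue {Φ Ψ : ℝ → ℝ} {p m q p' m' q' : ℝ} (hΦ : IsMatch Φ p m p' m')
    (hΨ : IsMatch Ψ m q m' q') (hpm : p ≤ m) (hmq : m ≤ q) :
    ∃ Ω, IsMatch Ω p q p' q' ∧ EqOn Ω Φ (Icc p m) ∧ EqOn Ω Ψ (Icc m q) := by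
  classical
  let Ω : ℝ → ℝ := fun x => if x ≤ m then Φ x else Ψ x
  have h1 : EqOn Ω Φ (Icc p m) := fun x hx => if_pos hx.2
  have h2 : EqOn Ω Ψ (Icc m q) := fun x hx => by
    rcases hx.1.eq_or_lt with rfl | h
    · exact (if_pos le_rfl).trans (hΦ.right.trans hΨ.left.symm)
    · exact if_neg h.not_ge
  refine ⟨Ω, ⟨?_, ?_, ?_, ?_⟩, h1, h2⟩
  · rw [← Icc_union_Icc_eq_Icc hpm hmq]
    exact (hΦ.strictMonoOn.congr h1.symm).union (hΨ.strictMonoOn.congr h2.symm) (isGreatest_Icc hpm)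
      (isLeast_Icc hmq)
  · rw [← Icc_union_Icc_eq_Icc hpm hmq]
    exact (hΦ.continuousOn.congr h1).union_of_isClosed (hΨ.continuousOn.congr h2) isClosed_Icc
      isClosed_Icc
  · exact (h1 ⟨le_rfl, hpm⟩).trans hΦ.left
  · exact (h2 ⟨hmq, le_rfl⟩).trans hΨ.right

theorem exists_affine {p q p' q' : ℝ} (h : p < q) (h' : p' < q') : ∃ Φ, IsMatch Φ p q p' q' := by
  have hpos : 0 < (q' - p') / (q - p) := div_pos (sub_pos.2 h') (sub_pos.2 h)
  refine ⟨fun x => p' + (q' - p') / (q - p) * (x - p), fun x _ y _ hxy => ?_, by fun_prop, by simp,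
    ?_⟩
  · have := mul_lt_mul_of_pos_left hxy hpos
    linarith
  · have := (sub_pos.2 h).ne'
    field_simp
    ring

theorem surjOn {Φ : ℝ → ℝ} {p q p' q' : ℝ} (h : IsMatch Φ p q p' q') (hpq : p ≤ q) :
    SurjOn Φ (Icc p q) (Icc p' q') := by
  have := intermediate_value_Icc hpq h.continuousOn
  rwa [h.left, h.right] at this

end IsMatch

/-- Two real paths are both strictly increasing or both strictly decreasing. -/
def SameSense (f f' : I → ℝ) : Prop :=
  (StrictMono f ∧ StrictMono f') ∨ (StrictAnti f ∧ StrictAnti f')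

/-- The match is `f'` after the inverse of `f` on the range of `f`, an interval. It is continuous
because `f` maps the closed subsets of the compact interval `I` to closed sets. -/
theorem exists_isMatch_of_strictMono {f f' : I → ℝ} (hf : Continuous f) (hf' : Continuous f')
    (hm : StrictMono f) (hm' : StrictMono f') :
    ∃ Φ, IsMatch Φ (f 0) (f 1) (f' 0) (f' 1) ∧ ∀ t, Φ (f t) = f' t := by
  have hΦ : ∀ t, Function.extend f f' 0 (f t) = f' t := hm.injective.extend_apply f' 0
  have hr : Icc (f 0) (f 1) = range f := by
    refine Subset.antisymm ?_ ?_
    · rw [← image_univ]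
      exact (intermediate_value_Icc zero_le_one hf.continuousOn).trans (image_mono (subset_univ _))
    · rintro _ ⟨t, rfl⟩
      exact ⟨hm.monotone t.2.1, hm.monotone t.2.2⟩
  refine ⟨Function.extend f f' 0, ⟨?_, ?_, hΦ 0, hΦ 1⟩, hΦ⟩
  · rw [hr]
    rintro _ ⟨s, rfl⟩ _ ⟨t, rfl⟩ h
    rw [hΦ, hΦ]
    exact hm' (hm.lt_iff_lt.1 h)
  · rw [hr, continuousOn_iff_isClosed]
    intro T hT
    refine ⟨f '' (f' ⁻¹' T), ((hT.preimage hf').isCompact.image hf).isClosed, ?_⟩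
    ext x
    constructor
    · rintro ⟨h, t, rfl⟩
      refine ⟨⟨t, ?_, rfl⟩, t, rfl⟩
      rwa [mem_preimage, hΦ] at h
    · rintro ⟨⟨t, h, rfl⟩, -⟩
      refine ⟨?_, t, rfl⟩
      rwa [mem_preimage, hΦ]

theorem SameSense.exists_isMatch {f f' : I → ℝ} (hf : Continuous f) (hf' : Continuous f')
    (h : SameSense f f') : ∃ s t Φ, IsMatch Φ (f s) (f t) (f' s) (f' t) ∧
      (∀ u, f s ≤ f u ∧ f u ≤ f t) ∧ (∀ u, f' s ≤ f' u ∧ f' u ≤ f' t) ∧ ∀ u, Φ (f u) = f' u := by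
  rcases h with ⟨h, h'⟩ | ⟨h, h'⟩
  · obtain ⟨Φ, hΦ, e⟩ := exists_isMatch_of_strictMono hf hf' h h'
    exact ⟨0, 1, Φ, hΦ, fun u => ⟨h.monotone u.2.1, h.monotone u.2.2⟩,
      fun u => ⟨h'.monotone u.2.1, h'.monotone u.2.2⟩, e⟩
  · obtain ⟨Φ, hΦ, e⟩ := exists_isMatch_of_strictMono (hf.comp unitInterval.continuous_symm)
      (hf'.comp unitInterval.continuous_symm) (h.comp unitInterval.strictAnti_symm)
      (h'.comp unitInterval.strictAnti_symm)
    refine ⟨1, 0, Φ, by simpa using hΦ, fun u => ⟨h.antitone u.2.2, h.antitone u.2.1⟩,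
      fun u => ⟨h'.antitone u.2.2, h'.antitone u.2.1⟩, fun u => ?_⟩
    simpa using e (unitInterval.symm u)

/-- Two families of arcs in intervals with the same senses and the same order are matched by an
increasing homeomorphism. -/
theorem exists_isMatch_family {ι : Type*} (f f' : ι → I → ℝ) (hf : ∀ k, Continuous (f k))
    (hf' : ∀ k, Continuous (f' k)) (hs : ∀ k, SameSense (f k) (f' k)) (S : Finset ι)
    (hord : ∀ k ∈ S, ∀ l ∈ S, k ≠ l → (∀ s t, f k s < f l t ∧ f' k s < f' l t) ∨
      ∀ s t, f l s < f k t ∧ f' l s < f' k t) {p q p' q' : ℝ} (hpq : p < q) (hpq' : p' < q')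
    (hb : ∀ k ∈ S, ∀ t, f k t ∈ Ioo p q) (hb' : ∀ k ∈ S, ∀ t, f' k t ∈ Ioo p' q') :
    ∃ Φ, IsMatch Φ p q p' q' ∧ ∀ k ∈ S, ∀ t, Φ (f k t) = f' k t := by
  classical
  induction S using Finset.strongInduction generalizing p q p' q' with
  | H S ih =>
  rcases S.eq_empty_or_nonempty with rfl | ⟨k, hk⟩
  · obtain ⟨Φ, hΦ⟩ := IsMatch.exists_affine hpq hpq'
    exact ⟨Φ, hΦ, by simp⟩
  obtain ⟨s, t, Φ, hΦ, hfk, hfk', hkeq⟩ := (hs k).exists_isMatch (hf k) (hf' k)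
  -- The arc `k` splits the interval into three. The arcs before it and after it are matched by
  -- induction, and the three maps are glued at the ends of the arc.
  let A := S.filter fun l => ∀ s t, f l s < f k t ∧ f' l s < f' k t
  let C := S.filter fun l => ∀ s t, f k s < f l t ∧ f' k s < f' l t
  have hA : A ⊂ S := (Finset.ssubset_iff_of_subset (Finset.filter_subset _ _)).2
    ⟨k, hk, fun h => absurd ((Finset.mem_filter.1 h).2 0 0).1 (lt_irrefl _)⟩
  have hC : C ⊂ S := (Finset.ssubset_iff_of_subset (Finset.filter_subset _ _)).2
    ⟨k, hk, fun h => absurd ((Finset.mem_filter.1 h).2 0 0).1 (lt_irrefl _)⟩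
  obtain ⟨Φ₁, hΦ₁, e₁⟩ := ih A hA (fun k hk l hl => hord k (hA.1 hk) l (hA.1 hl)) (hb k hk s).1
    (hb' k hk s).1 (fun l hl u => ⟨(hb l (hA.1 hl) u).1, ((Finset.mem_filter.1 hl).2 u s).1⟩)
    (fun l hl u => ⟨(hb' l (hA.1 hl) u).1, ((Finset.mem_filter.1 hl).2 u s).2⟩)
  obtain ⟨Φ₂, hΦ₂, e₂⟩ := ih C hC (fun k hk l hl => hord k (hC.1 hk) l (hC.1 hl)) (hb k hk t).2
    (hb' k hk t).2 (fun l hl u => ⟨((Finset.mem_filter.1 hl).2 t u).1, (hb l (hC.1 hl) u).2⟩)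
    (fun l hl u => ⟨((Finset.mem_filter.1 hl).2 t u).2, (hb' l (hC.1 hl) u).2⟩)
  obtain ⟨Ψ, hΨ, e₃, e₄⟩ := hΦ₁.glue hΦ (hb k hk s).1.le (hfk s).2
  obtain ⟨Ω, hΩ, e₅, e₆⟩ := hΨ.glue hΦ₂ ((hb k hk s).1.le.trans (hfk s).2) (hb k hk t).2.le
  refine ⟨Ω, hΩ, fun l hl u => ?_⟩
  by_cases hlk : l = k
  · subst hlk
    rw [e₅ ⟨(hb l hl u).1.le, (hfk u).2⟩, e₄ (hfk u), hkeq]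
  · rcases hord l hl k hk hlk with h | h
    · rw [e₅ ⟨(hb l hl u).1.le, (h u t).1.le⟩, e₃ ⟨(hb l hl u).1.le, (h u s).1.le⟩,
        e₁ l (Finset.mem_filter.2 ⟨hl, h⟩)]
    · rw [e₆ ⟨(h t u).1.le, (hb l hl u).2.le⟩, e₂ l (Finset.mem_filter.2 ⟨hl, h⟩)]

theorem exists_mem_Ico_exp_eq (c : ℝ) (u : Circle) :
    ∃ x ∈ Ico c (c + 2 * Real.pi), Circle.exp x = u := by
  have h := HandleStructure.Reading.angle_mem (Circle.exp c) u
  refine ⟨c + HandleStructure.Reading.angle (Circle.exp c) u,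
    ⟨by linarith [h.1], by linarith [h.2]⟩, ?_⟩
  rw [Circle.exp_add, HandleStructure.Reading.mul_exp_angle]

/-- An increasing homeomorphism between intervals of length `2π` descends to the circle. -/
theorem IsMatch.exists_circle_homeomorph {Φ : ℝ → ℝ} {c c' : ℝ}
    (h : IsMatch Φ c (c + 2 * Real.pi) c' (c' + 2 * Real.pi)) :
    ∃ Θ : Circle ≃ₜ Circle, ∀ x ∈ Icc c (c + 2 * Real.pi), Θ (Circle.exp x) = Circle.exp (Φ x) := by
  have hpi := Real.two_pi_pos
  choose θ hθ hexp using exists_mem_Ico_exp_eq c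
  have hθ' {x : ℝ} (hx : x ∈ Ico c (c + 2 * Real.pi)) : θ (Circle.exp x) = x :=
    Circle.exp_injOn_Ico (by linarith) (hθ _) hx (hexp _)
  let F : Circle → Circle := fun u => Circle.exp (Φ (θ u))
  have hF : ∀ x ∈ Icc c (c + 2 * Real.pi), F (Circle.exp x) = Circle.exp (Φ x) := by
    intro x hx
    rcases hx.2.eq_or_lt with rfl | hx'
    · have : Circle.exp (c + 2 * Real.pi) = Circle.exp c := by simp
      simp only [F]
      rw [this, hθ' ⟨le_rfl, by linarith⟩, h.left, h.right]
      simp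
    · simp only [F]
      rw [hθ' ⟨hx.1, hx'⟩]
  have hlt {x : ℝ} (hx : x ∈ Ico c (c + 2 * Real.pi)) : Φ x ∈ Ico c' (c' + 2 * Real.pi) := by
    have hx' := Ico_subset_Icc_self hx
    rw [← h.right, ← h.left]
    exact ⟨h.strictMonoOn.monotoneOn ⟨le_rfl, by linarith⟩ hx' hx.1,
      h.strictMonoOn hx' ⟨by linarith, le_rfl⟩ hx.2⟩
  have hcont : Continuous F := by
    -- The circle is a quotient of the compact interval of length `2π`, so continuity of `F` can be
    -- tested on angles.
    have hq : IsQuotientMap fun x : Icc c (c + 2 * Real.pi) => Circle.exp x :=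
      IsQuotientMap.of_surjective_continuous
        (fun u => ⟨⟨θ u, Ico_subset_Icc_self (hθ u)⟩, hexp u⟩) (by fun_prop)
    rw [hq.continuous_iff]
    have : F ∘ (fun x : Icc c (c + 2 * Real.pi) => Circle.exp x) =
        fun x : Icc c (c + 2 * Real.pi) => Circle.exp (Φ x) :=
      funext fun x => hF x x.2
    rw [this]
    exact Circle.exp.continuous.comp h.continuousOn.domRestrict
  have hbij : Function.Bijective F := by
    constructor
    · intro u v huv
      have := Circle.exp_injOn_Ico (by linarith) (hlt (hθ u)) (hlt (hθ v)) huv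
      rw [← hexp u, ← hexp v, h.strictMonoOn.injOn (Ico_subset_Icc_self (hθ u))
        (Ico_subset_Icc_self (hθ v)) this]
    · intro v
      obtain ⟨y, hy, rfl⟩ := exists_mem_Ico_exp_eq c' v
      obtain ⟨x, hx, rfl⟩ := h.surjOn (by linarith) (Ico_subset_Icc_self hy)
      exact ⟨_, hF x hx⟩
  exact ⟨Continuous.homeoOfEquivCompactToT2 (f := Equiv.ofBijective F hbij) hcont, hF⟩

/-- Cutting the circle at the first point makes the cyclic order of the other two linear: any angles
witnessing it differ from `x`, `y`, `z` by one common multiple of `2π`. -/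
theorem ccwOrdered_exp_iff {x y z : ℝ} (hy : y ∈ Ioo x (x + 2 * Real.pi))
    (hz : z ∈ Ioo x (x + 2 * Real.pi)) :
    CcwOrdered (Circle.exp x) (Circle.exp y) (Circle.exp z) ↔ y < z := by
  constructor
  · rintro ⟨a, b, c, hab, hbc, hca, hx, hy', hz'⟩
    obtain ⟨n, rfl⟩ := Circle.exp_eq_exp.1 hx
    have e1 : y = b + n * (2 * Real.pi) := by
      refine Circle.exp_injOn_Ico (a := a + n * (2 * Real.pi)) (by linarith)
        (Ioo_subset_Ico_self hy) ⟨by linarith, by linarith⟩ (hy'.trans ?_)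
      exact (Circle.exp_eq_exp.2 ⟨n, rfl⟩).symm
    have e2 : z = c + n * (2 * Real.pi) := by
      refine Circle.exp_injOn_Ico (a := a + n * (2 * Real.pi)) (by linarith)
        (Ioo_subset_Ico_self hz) ⟨by linarith, by linarith⟩ (hz'.trans ?_)
      exact (Circle.exp_eq_exp.2 ⟨n, rfl⟩).symm
    linarith
  · exact fun h => ⟨x, y, z, hy.1, h, hz.2, rfl, rfl, rfl⟩

/-- Paths in the circle that are both counterclockwise or both clockwise have lifts with the same
sense. -/
theorem exists_sameSense {a a' : I → Circle} (ha : Continuous a) (ha' : Continuous a')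
    (hi : Function.Injective a) (hi' : Function.Injective a') (h : IsCcw a ↔ IsCcw a') :
    ∃ f f' : I → ℝ, Continuous f ∧ Continuous f' ∧ SameSense f f' ∧
      (∀ t, a t = Circle.exp (f t)) ∧ ∀ t, a' t = Circle.exp (f' t) := by
  by_cases hc : IsCcw a
  · obtain ⟨f, hf, hm, e⟩ := hc
    obtain ⟨f', hf', hm', e'⟩ := h.1 ⟨f, hf, hm, e⟩
    exact ⟨f, f', hf, hf', Or.inl ⟨hm, hm'⟩, e, e'⟩
  · obtain ⟨f, hf, hm, e⟩ := exists_angle_lift ha hi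
    obtain ⟨f', hf', hm', e'⟩ := exists_angle_lift ha' hi'
    refine ⟨f, f', hf, hf', Or.inr ⟨hm.resolve_left fun hm => hc ⟨f, hf, hm, e⟩,
      hm'.resolve_left fun hm => hc (h.2 ⟨f', hf', hm, e'⟩)⟩, e, e'⟩

/-- The lift of an embedded arc has length less than `2π`. -/
theorem lift_lt {a : I → Circle} (hi : Function.Injective a) {f : I → ℝ} (hf : Continuous f)
    (e : ∀ t, a t = Circle.exp (f t)) (s t : I) : f s < f t + 2 * Real.pi := by
  by_contra! h
  obtain ⟨u, hu⟩ := mem_range_of_exists_le_of_exists_ge hf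
    ⟨t, by linarith [Real.two_pi_pos]⟩ ⟨s, h⟩
  have : u = t := hi (by rw [e, e, hu]; simp)
  rw [this] at hu
  linarith [Real.two_pi_pos]

theorem mem_Ioo_of_ne {f : I → ℝ} (hf : Continuous f) {p q : ℝ} (h₀ : f 0 ∈ Ioo p q)
    (hp : ∀ t, f t ≠ p) (hq : ∀ t, f t ≠ q) (t : I) : f t ∈ Ioo p q := by
  constructor
  · by_contra! h
    obtain ⟨u, hu⟩ := mem_range_of_exists_le_of_exists_ge hf ⟨t, h⟩ ⟨0, h₀.1.le⟩
    exact hp u hu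
  · by_contra! h
    obtain ⟨u, hu⟩ := mem_range_of_exists_le_of_exists_ge hf ⟨0, h₀.2.le⟩ ⟨t, h⟩
    exact hq u hu

theorem lt_of_disjoint_range {f g : I → ℝ} (hf : Continuous f) (hg : Continuous g)
    (h : ∀ s t, f s ≠ g t) (h₀ : f 0 < g 0) (s t : I) : f s < g t := by
  have h1 (t) : f 0 < g t := by
    by_contra! h'
    obtain ⟨u, hu⟩ := mem_range_of_exists_le_of_exists_ge hg ⟨t, h'⟩ ⟨0, h₀.le⟩
    exact h _ _ hu.symm
  by_contra! h'
  obtain ⟨u, hu⟩ := mem_range_of_exists_le_of_exists_ge hf ⟨0, (h1 t).le⟩ ⟨s, h'⟩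
  exact h _ _ hu

theorem SameSense.add {f f' : I → ℝ} (h : SameSense f f') (c c' : ℝ) :
    SameSense (fun t => f t + c) (fun t => f' t + c') := by
  rcases h with ⟨h, h'⟩ | ⟨h, h'⟩
  · exact Or.inl ⟨h.add_const c, h'.add_const c'⟩
  · exact Or.inr ⟨h.add_const c, h'.add_const c'⟩

/-- The lift of an arc can be chosen between two consecutive lifts of a disjoint arc. -/
theorem exists_shift {a b : I → Circle} (hd : Disjoint (range a) (range b)) {f g : I → ℝ}
    (hf : Continuous f) (hg : Continuous g) (ea : ∀ t, a t = Circle.exp (f t))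
    (eb : ∀ t, b t = Circle.exp (g t)) (s t : I) :
    ∃ n : ℤ, ∀ u, g u + n * (2 * Real.pi) ∈ Ioo (f t) (f s + 2 * Real.pi) := by
  obtain ⟨x, hx, e⟩ := exists_mem_Ico_exp_eq (f s) (Circle.exp (g 0))
  obtain ⟨n, rfl⟩ := Circle.exp_eq_exp.1 e
  have hne (u v x) (e : Circle.exp x = Circle.exp (f v)) : g u + n * (2 * Real.pi) ≠ x := by
    rintro rfl
    refine disjoint_left.1 hd ⟨v, rfl⟩ ⟨u, ?_⟩
    rw [ea, eb, ← e]
    exact Circle.exp_eq_exp.2 ⟨-n, by push_cast; ring⟩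
  refine ⟨n, mem_Ioo_of_ne (by fun_prop) ⟨?_, hx.2⟩ (fun u => hne u t _ rfl)
    fun u => hne u s _ (by simp)⟩
  by_contra! h
  obtain ⟨v, hv⟩ := mem_range_of_exists_le_of_exists_ge hf ⟨s, hx.1⟩ ⟨t, h⟩
  exact hne 0 v _ rfl hv.symm

/-- Two families of disjoint arcs in the circle with the same senses and the same cyclic order are
matched by a homeomorphism of the circle. -/
theorem exists_circle_matching {ι : Type*} [Finite ι] (a a' : ι → I → Circle)
    (ha : ∀ k, Continuous (a k)) (ha' : ∀ k, Continuous (a' k))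
    (hi : ∀ k, Function.Injective (a k)) (hi' : ∀ k, Function.Injective (a' k))
    (hd : ∀ k l, k ≠ l → Disjoint (range (a k)) (range (a l)))
    (hd' : ∀ k l, k ≠ l → Disjoint (range (a' k)) (range (a' l)))
    (hcyc : ∀ k l m, CcwOrdered (a k 0) (a l 0) (a m 0) ↔ CcwOrdered (a' k 0) (a' l 0) (a' m 0))
    (hs : ∀ k, IsCcw (a k) ↔ IsCcw (a' k)) : ∃ Θ : Circle ≃ₜ Circle, ∀ k t, Θ (a k t) = a' k t := by
  classical
  have := Fintype.ofFinite ι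
  rcases isEmpty_or_nonempty ι with hι | ⟨⟨k₀⟩⟩
  · exact ⟨.refl _, fun k => isEmptyElim k⟩
  choose g g' hg hg' hsense e e' using fun k =>
    exists_sameSense (ha k) (ha' k) (hi k) (hi' k) (hs k)
  -- The circle is cut along one arc `k₀`, whose angles are least at `s` and greatest at `t`. The
  -- other arcs are lifted between its upper end and the next lift of its lower end.
  obtain ⟨s, t, Φ, hΦ, hst, hst', eΦ⟩ := (hsense k₀).exists_isMatch (hg k₀) (hg' k₀)
  have shift (k) (hk : k ≠ k₀) :=
    exists_shift (hd k₀ k hk.symm) (hg k₀) (hg k) (e k₀) (e k) s t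
  have shift' (k) (hk : k ≠ k₀) :=
    exists_shift (hd' k₀ k hk.symm) (hg' k₀) (hg' k) (e' k₀) (e' k) s t
  choose! n hn using shift
  choose! n' hn' using shift'
  let f : ι → I → ℝ := fun k u => g k u + n k * (2 * Real.pi)
  let f' : ι → I → ℝ := fun k u => g' k u + n' k * (2 * Real.pi)
  have hf (k) : Continuous (f k) := (hg k).add continuous_const
  have hf' (k) : Continuous (f' k) := (hg' k).add continuous_const
  have ef (k u) : Circle.exp (f k u) = a k u := by
    rw [e]; exact Circle.exp_eq_exp.2 ⟨n k, rfl⟩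
  have ef' (k u) : Circle.exp (f' k u) = a' k u := by
    rw [e']; exact Circle.exp_eq_exp.2 ⟨n' k, rfl⟩
  -- With `k₀` in first place, the cyclic order of the initial points is the linear order of the
  -- chosen lifts. Disjointness then extends it to whole arcs.
  have order {k l} (hk : k ≠ k₀) (hl : l ≠ k₀) : f k 0 < f l 0 ↔ f' k 0 < f' l 0 := by
    have h := hcyc k₀ k l
    rw [← ef k, ← ef l, ← ef' k, ← ef' l, e, e', ccwOrdered_exp_iff, ccwOrdered_exp_iff] at h
    · exact h
    · exact ⟨(hst' 0).2.trans_lt (hn' k hk 0).1, (hn' k hk 0).2.trans_le (by linarith [(hst' 0).1])⟩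
    · exact ⟨(hst' 0).2.trans_lt (hn' l hl 0).1, (hn' l hl 0).2.trans_le (by linarith [(hst' 0).1])⟩
    · exact ⟨(hst 0).2.trans_lt (hn k hk 0).1, (hn k hk 0).2.trans_le (by linarith [(hst 0).1])⟩
    · exact ⟨(hst 0).2.trans_lt (hn l hl 0).1, (hn l hl 0).2.trans_le (by linarith [(hst 0).1])⟩
  have hne {k l} (h : k ≠ l) (u v) : f k u ≠ f l v := fun he =>
    disjoint_left.1 (hd k l h) ⟨u, rfl⟩ ⟨v, by rw [← ef, ← ef, he]⟩
  have hne' {k l} (h : k ≠ l) (u v) : f' k u ≠ f' l v := fun he =>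
    disjoint_left.1 (hd' k l h) ⟨u, rfl⟩ ⟨v, by rw [← ef', ← ef', he]⟩
  have order' {k l} (hk : k ≠ k₀) (hl : l ≠ k₀) (h : k ≠ l) (hlt : f k 0 < f l 0) (u v) :
      f k u < f l v ∧ f' k u < f' l v :=
    ⟨lt_of_disjoint_range (hf k) (hf l) (hne h) hlt u v,
      lt_of_disjoint_range (hf' k) (hf' l) (hne' h) ((order hk hl).1 hlt) u v⟩
  have hord : ∀ k ∈ Finset.univ.erase k₀, ∀ l ∈ Finset.univ.erase k₀, k ≠ l →
      (∀ s t, f k s < f l t ∧ f' k s < f' l t) ∨ ∀ s t, f l s < f k t ∧ f' l s < f' k t := by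
    intro k hk l hl h
    have hk' := Finset.ne_of_mem_erase hk
    have hl' := Finset.ne_of_mem_erase hl
    rcases (hne h 0 0).lt_or_gt with hlt | hlt
    · exact Or.inl (order' hk' hl' h hlt)
    · exact Or.inr (order' hl' hk' h.symm hlt)
  obtain ⟨Ψ, hΨ, eΨ⟩ := exists_isMatch_family f f' hf hf' (fun k => (hsense k).add _ _)
    (Finset.univ.erase k₀) hord (lift_lt (hi k₀) (hg k₀) (e k₀) t s)
    (lift_lt (hi' k₀) (hg' k₀) (e' k₀) t s) (fun k hk => hn k (Finset.ne_of_mem_erase hk))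
    (fun k hk => hn' k (Finset.ne_of_mem_erase hk))
  obtain ⟨Ω, hΩ, e₁, e₂⟩ := hΦ.glue hΨ (hst s).2 (lift_lt (hi k₀) (hg k₀) (e k₀) t s).le
  obtain ⟨Θ, hΘ⟩ := hΩ.exists_circle_homeomorph
  refine ⟨Θ, fun k u => ?_⟩
  by_cases hk : k = k₀
  · subst hk
    have hlt := lift_lt (hi k) (hg k) (e k) u s
    rw [e, e', hΘ _ ⟨(hst u).1, hlt.le⟩, e₁ (hst u), eΦ]
  · rw [← ef, ← ef', hΘ _ ⟨(hst s).2.trans (hn k hk u).1.le, (hn k hk u).2.le⟩,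
      e₂ (Ioo_subset_Icc_self (hn k hk u)), eΨ k (Finset.mem_erase.2 ⟨hk, Finset.mem_univ _⟩)]

/-- Families of arcs whose angles, measured from given base points, have the same order and the
same senses are matched by a homeomorphism of the circle. -/
theorem exists_circle_matching_of_angles {ι : Type*} [Finite ι] [LinearOrder ι] (b b' : Circle)
    (f f' : ι → I → ℝ) (hf : ∀ i, Continuous (f i)) (hf' : ∀ i, Continuous (f' i))
    (hs : ∀ i, SameSense (f i) (f' i)) (hb : ∀ i t, 0 < f i t ∧ f i t < 2 * Real.pi)
    (hb' : ∀ i t, 0 < f' i t ∧ f' i t < 2 * Real.pi) (ho : ∀ i j s t, i < j → f i s < f j t)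
    (ho' : ∀ i j s t, i < j → f' i s < f' j t) :
    ∃ Θ : Circle ≃ₜ Circle, ∀ i t, Θ (b * Circle.exp (f i t)) = b' * Circle.exp (f' i t) := by
  have := Fintype.ofFinite ι
  obtain ⟨x, rfl⟩ := Circle.exp_surjective b
  obtain ⟨x', rfl⟩ := Circle.exp_surjective b'
  have hpi := Real.two_pi_pos
  have hord : ∀ i ∈ Finset.univ, ∀ j ∈ Finset.univ, i ≠ j →
      (∀ s t, f i s + x < f j t + x ∧ f' i s + x' < f' j t + x') ∨
        ∀ s t, f j s + x < f i t + x ∧ f' j s + x' < f' i t + x' := by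
    intro i _ j _ h
    rcases h.lt_or_gt with h | h
    · exact Or.inl fun s t => ⟨by linarith [ho i j s t h], by linarith [ho' i j s t h]⟩
    · exact Or.inr fun s t => ⟨by linarith [ho j i s t h], by linarith [ho' j i s t h]⟩
  obtain ⟨Φ, hΦ, e⟩ := exists_isMatch_family (fun i t => f i t + x) (fun i t => f' i t + x')
    (fun i => (hf i).add continuous_const) (fun i => (hf' i).add continuous_const)
    (fun i => (hs i).add _ _) Finset.univ hord
    (show x < x + 2 * Real.pi by linarith) (show x' < x' + 2 * Real.pi by linarith)
    (fun i _ t => ⟨by linarith [(hb i t).1], by linarith [(hb i t).2]⟩)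
    (fun i _ t => ⟨by linarith [(hb' i t).1], by linarith [(hb' i t).2]⟩)
  obtain ⟨Θ, hΘ⟩ := hΦ.exists_circle_homeomorph
  refine ⟨Θ, fun i t => ?_⟩
  rw [← Circle.exp_add, ← Circle.exp_add, add_comm, add_comm x', ← e i (Finset.mem_univ i)]
  exact hΘ _ ⟨by linarith [(hb i t).1], by linarith [(hb i t).2]⟩

/-! ### Extension of homeomorphisms from circles to total spaces -/

/-- The cone of a self-map of the circle. -/
noncomputable def Disc.cone (Θ : Circle → Circle) (w : Disc) : Disc :=
  ⟨(‖(w : ℂ)‖ : ℝ) * (Θ (Disc.dir w) : ℂ), by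
    simpa [Circle.norm_coe] using mem_closedBall_zero_iff.1 w.2⟩

theorem Disc.cone_circleToDisc (Θ : Circle → Circle) (z : Circle) :
    Disc.cone Θ (circleToDisc z) = circleToDisc (Θ z) := by
  refine Subtype.ext ?_
  change ((‖(z : ℂ)‖ : ℝ) : ℂ) * (Θ (Disc.dir (circleToDisc z)) : ℂ) = Θ z
  rw [Circle.norm_coe, Disc.dir_circleToDisc]
  simp

theorem Disc.cone_cone {Θ Ψ : Circle → Circle} (h : ∀ u, Ψ (Θ u) = u) (w : Disc) :
    Disc.cone Ψ (Disc.cone Θ w) = w := by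
  have hn : ‖(Disc.cone Θ w : ℂ)‖ = ‖(w : ℂ)‖ := by
    simp [Disc.cone, Circle.norm_coe]
  refine Subtype.ext ?_
  change ((‖(Disc.cone Θ w : ℂ)‖ : ℝ) : ℂ) * (Ψ (Disc.dir (Disc.cone Θ w)) : ℂ) = w
  rw [hn]
  rcases (norm_nonneg (w : ℂ)).eq_or_lt with h0 | h0
  · rw [← h0]
    simp [norm_eq_zero.1 h0.symm]
  · rw [Disc.dir_mul h0 (Θ (Disc.dir w)) (Disc.cone Θ w) rfl, h]
    exact Disc.norm_smul_dir w

theorem Disc.continuous_cone {Θ : Circle → Circle} (hΘ : Continuous Θ) :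
    Continuous (Disc.cone Θ) := by
  refine Continuous.subtype_mk (continuous_iff_continuousAt.2 fun w => ?_) _
  -- The direction is discontinuous at the centre, but there the radius tends to 0.
  by_cases hw : (w : ℂ) = 0
  · have h0 : ((‖(w : ℂ)‖ : ℝ) : ℂ) * (Θ (Disc.dir w) : ℂ) = 0 := by simp [hw]
    rw [ContinuousAt, h0, tendsto_zero_iff_norm_tendsto_zero]
    have : Tendsto (fun v : Disc => ‖(v : ℂ)‖) (𝓝 w) (𝓝 ‖(w : ℂ)‖) :=
      (continuous_subtype_val.norm).tendsto w
    rw [hw, norm_zero] at this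
    exact this.congr fun v => by simp [Circle.norm_coe]
  · have hd : ContinuousAt Disc.dir w := Disc.continuousOn_dir.continuousAt
      ((isOpen_ne.preimage continuous_subtype_val).mem_nhds hw)
    refine ContinuousAt.mul ?_ ?_
    · exact (Complex.continuous_ofReal.comp continuous_subtype_val.norm).continuousAt
    · exact (continuous_subtype_val.comp hΘ).continuousAt.comp hd

namespace HandleStructure

variable {B P K : Type*}

/-- Maps of the boundary circles of the beams and plates that match the strips. -/
structure Match (H H' : HandleStructure B P K) where
  beamOf_eq : ∀ k, H.beamOf k = H'.beamOf k
  plateOf_eq : ∀ k, H.plateOf k = H'.plateOf k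
  beam : B → Circle ≃ₜ Circle
  plate : P → Circle ≃ₜ Circle
  beam_arc : ∀ k t, beam (H.beamOf k) (H.beamArc k t) = H'.beamArc k t
  plate_arc : ∀ k t, plate (H.plateOf k) (H.plateArc k t) = H'.plateArc k t

namespace Match

variable {H H' : HandleStructure B P K} (m : H.Match H')

/-- The inverse of a match. -/
noncomputable def symm : H'.Match H where
  beamOf_eq k := (m.beamOf_eq k).symm
  plateOf_eq k := (m.plateOf_eq k).symm
  beam b := (m.beam b).symm
  plate p := (m.plate p).symm
  beam_arc k t := by
    rw [← m.beam_arc, ← m.beamOf_eq]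
    exact (m.beam _).symm_apply_apply _
  plate_arc k t := by
    rw [← m.plate_arc, ← m.plateOf_eq]
    exact (m.plate _).symm_apply_apply _

/-- The induced map of the beams and plates. -/
noncomputable def piecesMap : H.Pieces → H'.Pieces :=
  Sum.map (Sigma.map id fun b (q : Disc × I) => (Disc.cone (m.beam b) q.1, q.2))
    (Sigma.map id fun p (q : Disc × I) => (Disc.cone (m.plate p) q.1, q.2))

theorem continuous_piecesMap : Continuous m.piecesMap := by
  refine Continuous.sumMap (Continuous.sigma_map fun b => ?_) (Continuous.sigma_map fun p => ?_)
  · exact ((Disc.continuous_cone (m.beam b).continuous).comp continuous_fst).prodMk continuous_snd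
  · exact ((Disc.continuous_cone (m.plate p).continuous).comp continuous_fst).prodMk continuous_snd

/-- The induced map of the total spaces. -/
noncomputable def totalMap : H.Total → H'.Total :=
  Quot.map m.piecesMap (by
    rintro _ _ ⟨k, s, t, rfl, rfl⟩
    refine ⟨k, s, t, ?_, ?_⟩
    · rw [← m.beam_arc, ← Disc.cone_circleToDisc, ← m.beamOf_eq]
      rfl
    · rw [← m.plate_arc, ← Disc.cone_circleToDisc, ← m.plateOf_eq]
      rfl)

theorem continuous_totalMap : Continuous m.totalMap :=
  continuous_quot_lift _ (continuous_quot_mk.comp m.continuous_piecesMap)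

theorem totalMap_plateMap (p : P) (q : Disc × I) :
    m.totalMap (H.plateMap p q) = H'.plateMap p (Disc.cone (m.plate p) q.1, q.2) := rfl

theorem symm_totalMap (x : H.Total) : m.symm.totalMap (m.totalMap x) = x := by
  obtain ⟨⟨b, q⟩ | ⟨p, q⟩⟩ := x
  · exact congrArg (fun w => H.beamMap b (w, q.2))
      (Disc.cone_cone (m.beam b).symm_apply_apply q.1)
  · exact congrArg (fun w => H.plateMap p (w, q.2))
      (Disc.cone_cone (m.plate p).symm_apply_apply q.1)

/-- The induced homeomorphism of the total spaces. -/
noncomputable def totalHomeomorph : H.Total ≃ₜ H'.Total where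
  toFun := m.totalMap
  invFun := m.symm.totalMap
  left_inv := m.symm_totalMap
  right_inv := m.symm.symm_totalMap
  continuous_toFun := m.continuous_totalMap
  continuous_invFun := m.symm.continuous_totalMap

theorem totalMap_mem_sticky {x : H.Total} (hx : x ∈ H.sticky) : m.totalMap x ∈ H'.sticky := by
  rcases hx with ⟨b, z, t, ht, rfl⟩ | ⟨p, z, s, hz, rfl⟩
  · exact Or.inl ⟨b, _, t, ht, rfl⟩
  · refine Or.inr ⟨p, m.plate p z, s, fun k hk => ?_, ?_⟩
    · rw [← m.plateOf_eq] at hk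
      subst hk
      rintro ⟨t, ht⟩
      rw [← m.plate_arc] at ht
      exact hz k rfl ⟨t, (m.plate _).injective ht⟩
    · rw [totalMap_plateMap, Disc.cone_circleToDisc]

theorem image_eq {S : Set H.Total} {S' : Set H'.Total} (h : ∀ x ∈ S, m.totalMap x ∈ S')
    (h' : ∀ x ∈ S', m.symm.totalMap x ∈ S) : m.totalHomeomorph '' S = S' := by
  refine Subset.antisymm (image_subset_iff.2 h) fun x hx => ?_
  exact ⟨_, h' x hx, m.symm.symm_totalMap x⟩

theorem iso (m : H.Match H') : H.Iso H' := by
  refine ⟨m.totalHomeomorph, fun b => m.image_eq ?_ ?_, fun p => m.image_eq ?_ ?_,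
    m.image_eq (fun _ => m.totalMap_mem_sticky) fun _ => m.symm.totalMap_mem_sticky⟩ <;>
  · rintro _ ⟨q, rfl⟩
    exact ⟨_, rfl⟩

end Match

end HandleStructure

/-! ### Senses of arcs and evenly spaced arcs -/

/-- A path in the circle cannot run counterclockwise and clockwise. -/
theorem not_isCcw_of_strictAnti {γ : I → Circle} {g : I → ℝ} (hg : Continuous g) (hm : StrictAnti g)
    (e : ∀ t, γ t = Circle.exp (g t)) : ¬ IsCcw γ := by
  rintro ⟨f, hf, hmf, ef⟩
  have hpi := Real.two_pi_pos
  have hint (t) : ∃ n : ℤ, f t = g t + n * (2 * Real.pi) :=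
    Circle.exp_eq_exp.1 ((ef t).symm.trans (e t))
  obtain ⟨n₀, h₀⟩ := hint 0
  obtain ⟨n₁, h₁⟩ := hint 1
  have hf01 := hmf (zero_lt_one (α := I))
  have hg01 := hm (zero_lt_one (α := I))
  have hn : n₀ < n₁ := by
    have : (n₀ : ℝ) < n₁ := by nlinarith
    exact_mod_cast this
  have hn' : (n₀ : ℝ) + 1 ≤ n₁ := by exact_mod_cast hn
  -- The difference `f - g` is continuous and increases from one multiple of `2π` to a larger one,
  -- so it takes a value halfway between consecutive multiples, where the two exponentials differ.
  obtain ⟨t, ht⟩ := mem_range_of_exists_le_of_exists_ge (c := (n₀ : ℝ) * (2 * Real.pi) + Real.pi)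
    (f := fun t => f t - g t) (by fun_prop) ⟨0, by linarith [Real.pi_pos]⟩
    ⟨1, by nlinarith [Real.pi_pos]⟩
  obtain ⟨n, h⟩ := hint t
  have h2 : (2 * (n - n₀ : ℤ) - 1 : ℝ) * Real.pi = 0 := by push_cast; linarith
  have h3 : (2 * (n - n₀ : ℤ) - 1 : ℝ) = 0 := (mul_eq_zero.1 h2).resolve_right Real.pi_ne_zero
  have h4 : 2 * (n - n₀) - 1 = 0 := by exact_mod_cast h3
  omega

/-- The angles on the arc number `m` out of `n` arcs that are evenly distributed on the circle. -/
noncomputable def slot (n m : ℕ) (s : Bool) (t : I) : ℝ :=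
  -- The arc is the middle third of the sector, traversed upwards or downwards according to `s`.
  2 * Real.pi * (m + if s = true then (1 + t : ℝ) / 3 else (2 - t : ℝ) / 3) / n

section Slot

variable {n m m' : ℕ} {s s' : Bool}

theorem continuous_slot : Continuous (slot n m s) := by
  unfold slot
  split_ifs <;> fun_prop

theorem slot_offset_mem (t : I) :
    (if s = true then (1 + t : ℝ) / 3 else (2 - t : ℝ) / 3) ∈ Ioo (0 : ℝ) 1 := by
  have h0 := t.2.1
  have h1 := t.2.2
  split_ifs <;> constructor <;> linarith

theorem slot_lt_slot_iff (hn : 0 < n) {t t' : I} : slot n m s t < slot n m' s' t' ↔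
    (m + if s = true then (1 + t : ℝ) / 3 else (2 - t : ℝ) / 3) <
      m' + if s' = true then (1 + t' : ℝ) / 3 else (2 - t' : ℝ) / 3 := by
  have : (0 : ℝ) < n := by exact_mod_cast hn
  unfold slot
  rw [div_lt_div_iff_of_pos_right this, mul_lt_mul_iff_right₀ Real.two_pi_pos]

theorem slot_lt_slot (hn : 0 < n) (h : m < m') (t t' : I) : slot n m s t < slot n m' s' t' := by
  rw [slot_lt_slot_iff hn]
  have h1 : (m : ℝ) + 1 ≤ m' := by exact_mod_cast h
  have h2 := (slot_offset_mem (s := s) t).2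
  have h3 := (slot_offset_mem (s := s') t').1
  linarith

theorem strictMono_slot (hn : 0 < n) : StrictMono (slot n m true) := fun t t' h => by
  have : (t : ℝ) < t' := h
  rw [slot_lt_slot_iff hn, if_pos rfl, if_pos rfl]
  linarith

theorem strictAnti_slot (hn : 0 < n) : StrictAnti (slot n m false) := fun t t' h => by
  have : (t : ℝ) < t' := h
  rw [slot_lt_slot_iff hn, if_neg (by simp), if_neg (by simp)]
  linarith

theorem slot_mem (h : m < n) (t : I) : 0 < slot n m s t ∧ slot n m s t < 2 * Real.pi := by
  have h0 := slot_offset_mem (s := s) t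
  have h1 : (m : ℝ) + 1 ≤ n := by exact_mod_cast h
  have h2 : (0 : ℝ) ≤ m := m.cast_nonneg
  have hn : (0 : ℝ) < n := by linarith
  unfold slot
  constructor
  · exact div_pos (mul_pos Real.two_pi_pos (by linarith [h0.1])) hn
  · rw [div_lt_iff₀ hn]
    exact mul_lt_mul_of_pos_left (by linarith [h0.2]) Real.two_pi_pos

theorem slot_eq_of_exp_eq (h : m < n) (h' : m' < n) {t t' : I}
    (e : Circle.exp (slot n m s t) = Circle.exp (slot n m' s' t')) :
    slot n m s t = slot n m' s' t' :=
  Circle.eq_of_exp_eq ⟨(slot_mem h t).1.le, (slot_mem h t).2.le⟩ (slot_mem h' t') e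

theorem injective_exp_slot (h : m < n) : Function.Injective fun t => Circle.exp (slot n m s t) := by
  intro t t' e
  have e := slot_eq_of_exp_eq h h e
  cases s with
  | true => exact (strictMono_slot (m.zero_le.trans_lt h)).injective e
  | false => exact (strictAnti_slot (m.zero_le.trans_lt h)).injective e

theorem disjoint_exp_slot (h : m < n) (h' : m' < n) (hne : m ≠ m') :
    Disjoint (range fun t => Circle.exp (slot n m s t))
      (range fun t => Circle.exp (slot n m' s' t)) := by
  rw [disjoint_left]
  rintro _ ⟨t, rfl⟩ ⟨t', e⟩
  have e := slot_eq_of_exp_eq h' h e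
  have hn := m.zero_le.trans_lt h
  rcases hne.lt_or_gt with hlt | hlt
  · exact (slot_lt_slot hn hlt t t').ne' e
  · exact (slot_lt_slot hn hlt t' t).ne e

theorem isCcw_exp_slot (hn : 0 < n) : IsCcw (fun t => Circle.exp (slot n m s t)) ↔ s = true := by
  cases s with
  | true => exact iff_of_true ⟨_, continuous_slot, strictMono_slot hn, fun _ => rfl⟩ rfl
  | false =>
    exact iff_of_false (not_isCcw_of_strictAnti continuous_slot (strictAnti_slot hn) fun _ => rfl)
      (by simp)

end Slot

/-! ### Existence, uniqueness and finiteness of associated handle-structures -/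

namespace HandleStructure

variable {X J : Type*}

/-- On a plate the arcs follow the order of the word. On the beams one enumeration of all letters
keeps the arcs disjoint on each beam. The sign of a letter sets the sense of both of its arcs, hence
the orientation. -/
theorem exists_isAssociated_isOriented [Finite J] (r : J → List (X × Bool)) :
    ∃ H : HandleStructure X J (Letters r), IsAssociated r H ∧ H.IsOriented := by
  obtain ⟨N, ⟨e⟩⟩ := Finite.exists_equiv_fin (Letters r)
  let sign : Letters r → Bool := fun k => ((r k.1).get k.2).2
  have hpos (k : Letters r) : 0 < (r k.1).length := (Nat.zero_le _).trans_lt k.2.2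
  have hN (k : Letters r) : 0 < N := (Nat.zero_le _).trans_lt (e k).2
  refine ⟨{
    beamOf := fun k => ((r k.1).get k.2).1
    plateOf := fun k => k.1
    beamArc := fun k t => Circle.exp (slot N (e k) (sign k) t)
    plateArc := fun k t => Circle.exp (slot (r k.1).length k.2 (sign k) t)
    continuous_beamArc := fun k => Circle.exp.continuous.comp continuous_slot
    injective_beamArc := fun k => injective_exp_slot (e k).2
    continuous_plateArc := fun k => Circle.exp.continuous.comp continuous_slot
    injective_plateArc := fun k => injective_exp_slot k.2.2
    disjoint_beamArc := fun k l h _ => disjoint_exp_slot (e k).2 (e l).2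
      fun h' => h (e.injective (Fin.ext h'))
    disjoint_plateArc := ?_ }, ⟨fun _ _ => rfl, fun _ _ => rfl, fun j => ?_⟩, fun k => ?_⟩
  · rintro ⟨j, i⟩ ⟨j', i'⟩ h rfl
    refine disjoint_exp_slot i.2 i'.2 fun h' => h ?_
    exact congrArg (Sigma.mk j) (Fin.ext h')
  · refine ⟨1, fun i => slot (r j).length i (sign ⟨j, i⟩), fun i => continuous_slot, ?_, ?_,
      fun i => slot_mem i.2, fun i i' t t' h => slot_lt_slot (hpos ⟨j, i⟩) h t t',
      fun i t => (one_mul _).symm⟩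
    · intro i hi
      simp only [sign, hi]
      exact strictMono_slot (hpos ⟨j, i⟩)
    · intro i hi
      simp only [sign, hi]
      exact strictAnti_slot (hpos ⟨j, i⟩)
  · exact (isCcw_exp_slot (hN k)).trans (isCcw_exp_slot (hpos k)).symm

variable {r : J → List (X × Bool)}

/-- Around a beam the choices provide the matching homeomorphism. Around a plate none are needed:
the word gives the order of the strips and the signs give their senses. -/
theorem iso_of_sameChoices [Finite J] {H H' : HandleStructure X J (Letters r)}
    (h : IsAssociated r H) (h' : IsAssociated r H') (hs : H.SameChoices H') : H.Iso H' := by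
  obtain ⟨hp, hb, hplate⟩ := h
  obtain ⟨hp', hb', hplate'⟩ := h'
  have hbeam (k) : H.beamOf k = H'.beamOf k := (hb k.1 k.2).trans (hb' k.1 k.2).symm
  have beams (b : X) : ∃ Θ : Circle ≃ₜ Circle, ∀ k : {k // H.beamOf k = b}, ∀ t,
      Θ (H.beamArc k t) = H'.beamArc k t := by
    refine exists_circle_matching _ _ (fun k => H.continuous_beamArc k)
      (fun k => H'.continuous_beamArc k) (fun k => H.injective_beamArc k)
      (fun k => H'.injective_beamArc k)
      (fun k l hkl => H.disjoint_beamArc k l (fun e => hkl (Subtype.ext e)) (k.2.trans l.2.symm))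
      (fun k l hkl => H'.disjoint_beamArc k l (fun e => hkl (Subtype.ext e)) ?_)
      (fun k l m => hs.1 k l m (k.2.trans l.2.symm) (l.2.trans m.2.symm)) fun k => hs.2 k
    rw [← hbeam, ← hbeam, k.2, l.2]
  have plates (j : J) : ∃ Θ : Circle ≃ₜ Circle, ∀ i t,
      Θ (H.plateArc ⟨j, i⟩ t) = H'.plateArc ⟨j, i⟩ t := by
    obtain ⟨β, f, hf, hm, ha, hmem, ho, e⟩ := hplate j
    obtain ⟨β', f', hf', hm', ha', hmem', ho', e'⟩ := hplate' j
    have hs (i) : SameSense (f i) (f' i) := by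
      cases hi : ((r j).get i).2 with
      | true => exact Or.inl ⟨hm i hi, hm' i hi⟩
      | false => exact Or.inr ⟨ha i hi, ha' i hi⟩
    obtain ⟨Θ, hΘ⟩ := exists_circle_matching_of_angles β β' f f' hf hf' hs hmem hmem' ho ho'
    exact ⟨Θ, fun i t => by rw [e, e', hΘ]⟩
  choose Θ hΘ using beams
  choose Ψ hΨ using plates
  exact Match.iso
    { beamOf_eq := hbeam
      plateOf_eq := fun k => (hp k.1 k.2).trans (hp' k.1 k.2).symm
      beam := Θ
      plate := Ψ
      beam_arc := fun k t => hΘ _ ⟨k, rfl⟩ t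
      plate_arc := fun k t => by
        rw [show H.plateOf k = k.1 from hp k.1 k.2]
        exact hΨ k.1 k.2 t }

/-- The cyclic order and the senses form a value in a finite set, as there are finitely many
letters. One structure is selected for every value that occurs. -/
theorem finite_isAssociated [Finite J] (r : J → List (X × Bool)) :
    ∃ (N : ℕ) (F : Fin N → HandleStructure X J (Letters r)), (∀ i, IsAssociated r (F i)) ∧
      ∀ H : HandleStructure X J (Letters r), IsAssociated r H → ∃ i, H.Iso (F i) := by
  let c : {H : HandleStructure X J (Letters r) // IsAssociated r H} →
      (Letters r → Letters r → Letters r → Prop) × (Letters r → Prop) := fun H =>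
    (fun k l m => CcwOrdered (H.1.beamArc k 0) (H.1.beamArc l 0) (H.1.beamArc m 0),
      fun k => IsCcw (H.1.beamArc k))
  obtain ⟨N, ⟨e⟩⟩ := Finite.exists_equiv_fin (range c)
  choose F hF using fun i => (e.symm i).2
  refine ⟨N, fun i => (F i).1, fun i => (F i).2, fun H hH => ⟨e ⟨c ⟨H, hH⟩, _, rfl⟩, ?_⟩⟩
  have hc : c ⟨H, hH⟩ = c (F (e ⟨c ⟨H, hH⟩, _, rfl⟩)) := by
    rw [hF, e.symm_apply_apply]
  refine iso_of_sameChoices hH (F _).2 ⟨fun k l m _ _ => ?_, fun k => ?_⟩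
  · exact iff_of_eq (congrFun (congrFun (congrFun (congrArg Prod.fst hc) k) l) m)
  · exact iff_of_eq (congrFun (congrArg Prod.snd hc) k)

end HandleStructure

end

theorem propositionP {X J : Type*} [Finite X] [Finite J] (r : J → List (X × Bool))
    {G : Type*} [Group G]
    (e : PresentedGroup (Set.range fun j => FreeGroup.mk (r j)) ≃* G) :
    -- a handle-structure can be associated to the presentation
    (∃ H : HandleStructure X J (Letters r), IsAssociated r H ∧ H.IsOriented) ∧
    -- it is determined by the choice of the places where the strips are attached to the beams
    (∀ H H' : HandleStructure X J (Letters r), IsAssociated r H → IsAssociated r H' →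
      H.SameChoices H' → H.Iso H') ∧
    -- only finitely many choices are possible
    (∃ (N : ℕ) (F : Fin N → HandleStructure X J (Letters r)), (∀ i, IsAssociated r (F i)) ∧
      ∀ H : HandleStructure X J (Letters r), IsAssociated r H → ∃ i, H.Iso (F i)) ∧
    -- whatever the choices, the fundamental group of `M / S` is `G`
    (∀ H : HandleStructure X J (Letters r), IsAssociated r H →
      PathConnectedSpace (Collapse H.sticky) ∧
      ∀ x : Collapse H.sticky, Nonempty (FundamentalGroup (Collapse H.sticky) x ≃* G)) := by
  refine ⟨HandleStructure.exists_isAssociated_isOriented r,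
    fun _ _ => HandleStructure.iso_of_sameChoices, HandleStructure.finite_isAssociated r,
    fun H hH => ?_⟩
  obtain ⟨β, ⟨D⟩⟩ := HandleStructure.exists_reading hH
  exact ⟨H.pathConnectedSpace_collapsed β D.base_notMem, fun x =>
    (D.nonempty_mulEquiv x).map fun f => f.trans e⟩
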